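/- Let $\mathcal K\neq\{0\}$ be a compact (Hausdorff) abelian group, written additively, and let $\varphi_0:\mathbb R\to\mathcal K$ be a continuous homomorphism with dense image. Let $\mathrm{He}_{\mathcal K}=(\mathbb R\times\mathcal K)\rtimes\mathbb R$, where $x\in\mathbb R$ acts on $\mathbb R\times\mathcal K$ by $x\circ(y,k)=(y,k+\varphi_0(xy))$; its elements are written $(y,k)\,x$, with $x\,(y,k)=(x\circ(y,k))\,x$. As Haar measure of this (unimodular) group take the product of Lebesgue measure $dy\,dx$ and the normalized Haar measure of $\mathcal K$. Let $\Gamma\subseteq\mathbb R$ be the group of all $t$ for which there is a continuous character $\chi_t$ of $\mathcal K$ with $\chi_t(\varphi_0(z))=e^{itz}$ for all $z\in\mathbb R$ (so $\Gamma$ is identified with $\widehat{\mathcal K}$). For $t\in\Gamma\setminus\{0\}$ let $\pi_t$ be the representation on $L^2(\mathbb R)$ given by $$(\pi_t((y,k)\,x)f)(\psi)=\chi_t(k)\,e^{-ity\psi}f(\psi-x),$$ and for $w=(w_1,w_2)\in\mathbb R^2$ let $\chi_w$ be the one-dimensional representation $\chi_w((y,k)\,x)=e^{i(xw_1+yw_2)}$.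 For a unitary representation $\pi$ and $f\in L^1(\mathrm{He}_{\mathcal K})$ put $\pi(f)=\int f(g)\,\pi(g)\,dg$. Let $\widehat{\mathrm{He}_{\mathcal K}}$ be the set of unitary equivalence classes of irreducible (strongly continuous) unitary representations, with its usual (hull-kernel, Fell) topology and the Borel sets of this topology. Then these representations are irreducible and pairwise inequivalent, and every irreducible unitary representation of $\mathrm{He}_{\mathcal K}$ is equivalent to one of them, so that $\widehat{\mathrm{He}_{\mathcal K}}=(\Gamma\setminus\{0\})\cup\mathbb R^2$; each $\{\pi_t\}$ is open in the dual, and $w\mapsto\chi_w$ is a homeomorphism of $\mathbb R^2$ (euclidean topology) onto an open subset of the dual. There is exactly one Borel measure $\nu$ on $\widehat{\mathrm{He}_{\mathcal K}}$, the Plancherel measure, such that for all $f\in L^1(\mathrm{He}_{\mathcal K})\cap L^2(\mathrm{He}_{\mathcal K})$ the function $\pi\mapsto\|\pi(f)\|_2^2$ (squared Hilbert-Schmidt norm) is $\nu$-measurable and $$\int\|\pi(f)\|_2^2\,d\nu(\pi)=\|f\|_2^2 ,$$ and it satisfies $$d\nu=\frac1{4\pi^2}\,dw\ \text{ on }\mathbb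 R^2,\qquad \nu(\{\pi_t\})=\frac{|t|}{2\pi}\ \text{ for } t\in\Gamma\setminus\{0\}.$$ -/

import Mathlib

open MeasureTheory Topology
open scoped ENNReal

universe u v

noncomputable section

/-! ## Unitary representations, the unitary dual and Plancherel measures -/

/-- A strongly continuous unitary representation of `G` on the Hilbert space `H`
(multiplication in the group `H ≃ₗᵢ[ℂ] H` of unitary operators is composition). -/
structure UnitaryRep (G : Type*) [Group G] [TopologicalSpace G]
    (H : Type*) [NormedAddCommGroup H] [InnerProductSpace ℂ H] where
  /-- the underlying homomorphism into the unitary group -/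
  toHom : G →* (H ≃ₗᵢ[ℂ] H)
  /-- strong continuity -/
  continuous_apply : ∀ ξ : H, Continuous fun g => toHom g ξ

namespace UnitaryRep

variable {G : Type*} [Group G] [TopologicalSpace G]
  {H : Type*} [NormedAddCommGroup H] [InnerProductSpace ℂ H]
  {H' : Type*} [NormedAddCommGroup H'] [InnerProductSpace ℂ H']

/-- (Topological) irreducibility: the space is non-zero and the only closed invariant subspaces
are the trivial ones. -/
def IsIrreducible (π : UnitaryRep G H) : Prop :=
  Nontrivial H ∧ ∀ W : Submodule ℂ H, IsClosed (W : Set H) →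
    (∀ g, ∀ ξ ∈ W, π.toHom g ξ ∈ W) → W = ⊥ ∨ W = ⊤

/-- Unitary equivalence. -/
def IsEquivalent (π : UnitaryRep G H) (σ : UnitaryRep G H') : Prop :=
  ∃ U : H ≃ₗᵢ[ℂ] H', ∀ g ξ, U (π.toHom g ξ) = σ.toHom g (U ξ)

theorem aestronglyMeasurable_apply [SigmaCompactSpace G] [MeasurableSpace G] [BorelSpace G]
    (π : UnitaryRep G H) (ξ : H) (μ : Measure G) :
    AEStronglyMeasurable (fun g => π.toHom g ξ) μ := by
  borelize H
  refine (stronglyMeasurable_iff_measurable_separable.2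
    ⟨(π.continuous_apply ξ).measurable, ?_⟩).aestronglyMeasurable
  rw [← Set.image_univ, ← iUnion_compactCovering G, Set.image_iUnion]
  exact TopologicalSpace.IsSeparable.iUnion fun n =>
    ((isCompact_compactCovering G n).image (π.continuous_apply ξ)).isSeparable

theorem integrable_smul_apply [SigmaCompactSpace G] [MeasurableSpace G] [BorelSpace G]
    (π : UnitaryRep G H) (ξ : H) {μ : Measure G} {f : G → ℂ} (hf : Integrable f μ) :
    Integrable (fun g => f g • π.toHom g ξ) μ :=
  Integrable.mono' (hf.norm.mul_const ‖ξ‖)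
    (hf.aestronglyMeasurable.smul (π.aestronglyMeasurable_apply ξ μ))
    (Filter.Eventually.of_forall fun g => by simp [norm_smul])

/-- The operator `π(f) = ∫ f(g) π(g) dg` for `f ∈ L¹(G)`, the integral being taken strongly with
respect to the chosen Haar measure `volume` of `G`. -/
def integrated [SigmaCompactSpace G] [MeasureSpace G] [BorelSpace G]
    (π : UnitaryRep G H) (f : G → ℂ) (hf : Integrable f) : H →L[ℂ] H :=
  LinearMap.mkContinuous
    { toFun := fun ξ => ∫ g, f g • π.toHom g ξ
      map_add' := fun ξ η => by
        rw [← integral_add (π.integrable_smul_apply ξ hf) (π.integrable_smul_apply η hf)]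
        simp
      map_smul' := fun c ξ => by
        rw [RingHom.id_apply, ← integral_smul]
        refine integral_congr_ae (Filter.Eventually.of_forall fun g => ?_)
        simp only [map_smul]
        exact smul_comm _ _ _ }
    (∫ g, ‖f g‖)
    (fun ξ => by
      refine (norm_integral_le_integral_norm _).trans (le_of_eq ?_)
      rw [← integral_mul_const]
      refine integral_congr_ae (Filter.Eventually.of_forall fun g => ?_)
      simp [norm_smul])

end UnitaryRep

/-- The squared Hilbert-Schmidt norm `‖T‖₂² = ∑ ‖T e‖²`, `e` running through an orthonormal basis
of the Hilbert space; the value (possibly `∞`) does not depend on the basis. -/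
def hilbertSchmidtNormSq {H : Type*} [NormedAddCommGroup H] [InnerProductSpace ℂ H]
    [CompleteSpace H] (T : H →L[ℂ] H) : ℝ≥0∞ :=
  ∑' e : (exists_hilbertBasis ℂ H).choose, ‖T (e : H)‖ₑ ^ 2

/-- An irreducible unitary representation of `G` together with its Hilbert space. -/
structure IrrepBundle (G : Type u) [Group G] [TopologicalSpace G] where
  /-- the Hilbert space -/
  space : Type v
  [normed : NormedAddCommGroup space]
  [inner : InnerProductSpace ℂ space]
  [complete : CompleteSpace space]
  /-- the representation -/
  rep : UnitaryRep G space
  irreducible : rep.IsIrreducible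

attribute [instance] IrrepBundle.normed IrrepBundle.inner IrrepBundle.complete

/-- Unitary equivalence on bundled irreducible representations. -/
instance irrepSetoid (G : Type u) [Group G] [TopologicalSpace G] :
    Setoid (IrrepBundle.{u, v} G) where
  r π σ := π.rep.IsEquivalent σ.rep
  iseqv :=
    { refl := fun _ => ⟨LinearIsometryEquiv.refl ℂ _, fun _ _ => rfl⟩
      symm := by
        rintro π σ ⟨U, hU⟩
        refine ⟨U.symm, fun g ξ => ?_⟩
        rw [LinearIsometryEquiv.symm_apply_eq, hU, LinearIsometryEquiv.apply_symm_apply]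
      trans := by
        rintro π σ τ ⟨U, hU⟩ ⟨V, hV⟩
        refine ⟨U.trans V, fun g ξ => ?_⟩
        simp [hU, hV] }

/-- The unitary dual of `G`: equivalence classes of irreducible unitary representations. -/
def UnitaryDual (G : Type u) [Group G] [TopologicalSpace G] : Type (max u (v + 1)) :=
  Quotient (irrepSetoid.{u, v} G)

namespace UnitaryDual

section

variable {G : Type u} [Group G] [TopologicalSpace G]

/-- A selected representative of each class. -/
def out (c : UnitaryDual.{u, v} G) : IrrepBundle.{u, v} G := Quotient.out c

/-- `c` is the class of the representation `π` (which may live in another universe). -/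
def IsClassOf (c : UnitaryDual.{u, v} G) {H : Type*} [NormedAddCommGroup H]
    [InnerProductSpace ℂ H] (π : UnitaryRep G H) : Prop :=
  c.out.rep.IsEquivalent π

end

variable (G : Type u) [Group G] [TopologicalSpace G] [SigmaCompactSpace G] [MeasureSpace G]
  [BorelSpace G]

/-- The usual (hull-kernel, or Fell) topology of the dual, i.e. the topology of the dual of the
group `C*`-algebra. As `L¹(G)` is dense in `C*(G)`, the sets `{π : ‖π(f)‖ > 1}`, `f ∈ L¹(G)`, form
a base of it. -/
instance : TopologicalSpace (UnitaryDual.{u, v} G) :=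
  TopologicalSpace.generateFrom
    {S | ∃ (f : G → ℂ) (hf : Integrable f), S = {c | 1 < ‖c.out.rep.integrated f hf‖}}

/-- The Borel structure of the dual. -/
instance : MeasurableSpace (UnitaryDual.{u, v} G) := borel _

instance : BorelSpace (UnitaryDual.{u, v} G) := ⟨rfl⟩

variable {G}

/-- `ν` is a Plancherel measure of the unimodular group `G`, with Haar measure `volume`: for all
`f ∈ L¹(G) ∩ L²(G)` the Fourier transform `(π(f))_π` is square integrable as a field of
Hilbert-Schmidt operators and `∫ ‖π(f)‖₂² dν(π) = ‖f‖₂²`. -/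
def IsPlancherelMeasure (ν : Measure (UnitaryDual.{u, v} G)) : Prop :=
  ∀ (f : G → ℂ) (hf : Integrable f), MemLp f 2 →
    AEMeasurable (fun c : UnitaryDual.{u, v} G =>
      hilbertSchmidtNormSq (c.out.rep.integrated f hf)) ν ∧
    ∫⁻ c : UnitaryDual.{u, v} G, hilbertSchmidtNormSq (c.out.rep.integrated f hf) ∂ν
      = eLpNorm f 2 volume ^ 2

end UnitaryDual

/-! ## The Heisenberg type groups -/

/-- The group `(ℝ × K) ⋊ ℝ` with `x ∘ (y, k) = (y, k + φ₀ (x y))`. The triple `(y, k, x)` stands for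
the element `(y, k) x`, i.e. the product of `(y, k)` in the normal factor with `x`. -/
@[ext]
structure HeisK {K : Type u} [AddCommGroup K] (φ₀ : ℝ →+ K) : Type u where
  /-- first coordinate in the normal factor `ℝ × K` -/
  y : ℝ
  /-- second coordinate in the normal factor `ℝ × K` -/
  k : K
  /-- coordinate in the acting factor `ℝ` -/
  x : ℝ

namespace HeisK

variable {K : Type u} [AddCommGroup K] (φ₀ : ℝ →+ K)

instance : Mul (HeisK φ₀) := ⟨fun g h => ⟨g.y + h.y, g.k + (h.k + φ₀ (g.x * h.y)), g.x + h.x⟩⟩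

instance : One (HeisK φ₀) := ⟨⟨0, 0, 0⟩⟩

instance : Inv (HeisK φ₀) := ⟨fun g => ⟨-g.y, -g.k + φ₀ (g.x * g.y), -g.x⟩⟩

theorem mul_def (g h : HeisK φ₀) :
    g * h = ⟨g.y + h.y, g.k + (h.k + φ₀ (g.x * h.y)), g.x + h.x⟩ := rfl

theorem one_def : (1 : HeisK φ₀) = ⟨0, 0, 0⟩ := rfl

theorem inv_def (g : HeisK φ₀) : g⁻¹ = ⟨-g.y, -g.k + φ₀ (g.x * g.y), -g.x⟩ := rfl

instance : Group (HeisK φ₀) :=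
  Group.ofLeftAxioms
    (fun a b c => by
      simp only [mul_def, mul_add, add_mul, map_add]
      ext
      · simp only [add_assoc]
      · simp only; abel
      · simp only [add_assoc])
    (fun a => by simp [mul_def, one_def])
    (fun a => by
      ext
      · simp [mul_def, one_def, inv_def]
      · simp only [mul_def, one_def, inv_def, neg_mul, map_neg]; abel
      · simp [mul_def, one_def, inv_def])

/-- The coordinates of an element. -/
def coordEquiv : HeisK φ₀ ≃ ℝ × K × ℝ where
  toFun g := (g.y, g.k, g.x)
  invFun p := ⟨p.1, p.2.1, p.2.2⟩
  left_inv _ := rfl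
  right_inv _ := rfl

variable [TopologicalSpace K]

/-- The product topology. -/
instance : TopologicalSpace (HeisK φ₀) := TopologicalSpace.induced (coordEquiv φ₀) inferInstance

/-- The coordinates as a homeomorphism. -/
def coordHomeomorph : HeisK φ₀ ≃ₜ ℝ × K × ℝ :=
  (coordEquiv φ₀).toHomeomorphOfIsInducing ⟨rfl⟩

theorem continuous_y : Continuous fun g : HeisK φ₀ => g.y :=
  continuous_fst.comp (coordHomeomorph φ₀).continuous

theorem continuous_k : Continuous fun g : HeisK φ₀ => g.k :=
  (continuous_fst.comp continuous_snd).comp (coordHomeomorph φ₀).continuous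

theorem continuous_x : Continuous fun g : HeisK φ₀ => g.x :=
  (continuous_snd.comp continuous_snd).comp (coordHomeomorph φ₀).continuous

instance [CompactSpace K] : SigmaCompactSpace (HeisK φ₀) :=
  (coordHomeomorph φ₀).isClosedEmbedding.sigmaCompactSpace

variable [IsTopologicalAddGroup K] [CompactSpace K] [MeasurableSpace K] [BorelSpace K]

instance : MeasurableSpace (HeisK φ₀) := borel _

instance : BorelSpace (HeisK φ₀) := ⟨rfl⟩

/-- The Haar measure of `HeisK φ₀` is the product of Lebesgue measure in the two real coordinates
and the normalized Haar measure of the compact group `K`. -/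
instance : MeasureSpace (HeisK φ₀) where
  volume := Measure.map (coordEquiv φ₀).symm ((volume : Measure ℝ).prod
    ((Measure.addHaarMeasure (⊤ : TopologicalSpace.PositiveCompacts K)).prod
      (volume : Measure ℝ)))

end HeisK

section Dual

variable {K : Type u} [AddCommGroup K] [TopologicalSpace K] (φ₀ : ℝ →+ K)

/-- The dual group of `K` as a subgroup `Γ` of `ℝ`: `t ∈ Γ` if there is a continuous character `χ`
of `K` (necessarily unique if `φ₀` has dense image) such that `χ (φ₀ z) = exp (i t z)`. -/
def dualSubgroup : AddSubgroup ℝ where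
  carrier := {t | ∃ χ : AddChar K Circle, Continuous χ ∧ ∀ z : ℝ, χ (φ₀ z) = Circle.exp (t * z)}
  zero_mem' := ⟨1, continuous_const, fun z => by simp⟩
  add_mem' := by
    rintro s t ⟨χ, hχ, h⟩ ⟨χ', hχ', h'⟩
    exact ⟨χ * χ', hχ.mul hχ', fun z => by
      rw [AddChar.mul_apply, h, h', add_mul, Circle.exp_add]⟩
  neg_mem' := by
    rintro t ⟨χ, hχ, h⟩
    refine ⟨χ⁻¹, ?_, fun z => ?_⟩
    · have : (⇑χ⁻¹ : K → Circle) = fun k => (χ k)⁻¹ := funext fun k => AddChar.inv_apply' χ k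
      rw [this]
      exact hχ.inv
    · rw [AddChar.inv_apply', h, neg_mul, Circle.exp_neg]

/-- The character `χ_t` of `K` that corresponds to `t ∈ Γ`. -/
def dualChar (t : dualSubgroup φ₀) : AddChar K Circle := t.2.choose

theorem continuous_dualChar (t : dualSubgroup φ₀) : Continuous (dualChar φ₀ t) :=
  t.2.choose_spec.1

theorem dualChar_apply (t : dualSubgroup φ₀) (z : ℝ) :
    dualChar φ₀ t (φ₀ z) = Circle.exp (t * z) :=
  t.2.choose_spec.2 z

end Dual

/-! ## The irreducible representations -/

/-- `L²(ℝ)`. -/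
abbrev L2R : Type := Lp ℂ 2 (volume : Measure ℝ)

namespace Weyl

theorem memLp (c : Circle) (a x : ℝ) (f : L2R) :
    MemLp (fun ψ : ℝ => (c * Circle.exp (-(a * ψ)) : ℂ) * f (ψ - x)) 2 := by
  have h1 : MemLp (fun ψ : ℝ => f (ψ - x)) 2 (volume : Measure ℝ) :=
    (Lp.memLp f).comp_measurePreserving (measurePreserving_sub_right volume x)
  refine (memLp_congr_norm ?_ h1.1 (Filter.Eventually.of_forall fun ψ => ?_)).2 h1
  · exact (Continuous.aestronglyMeasurable (by fun_prop)).mul h1.1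
  · rw [norm_mul, norm_mul, Circle.norm_coe, Circle.norm_coe, one_mul, one_mul]

/-- The operator `f ↦ (ψ ↦ c exp(-i a ψ) f(ψ - x))` on `L²(ℝ)`. -/
def op (c : Circle) (a x : ℝ) (f : L2R) : L2R := (memLp c a x f).toLp _

theorem op_ae (c : Circle) (a x : ℝ) (f : L2R) :
    op c a x f =ᵐ[volume] fun ψ => (c * Circle.exp (-(a * ψ)) : ℂ) * f (ψ - x) :=
  (memLp c a x f).coeFn_toLp

theorem ae_shift {p : ℝ → Prop} (h : ∀ᵐ ψ, p ψ) (x : ℝ) : ∀ᵐ ψ : ℝ, p (ψ - x) :=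
  (measurePreserving_sub_right volume x).quasiMeasurePreserving.ae h

theorem op_op (c c' : Circle) (a a' x x' : ℝ) (f : L2R) :
    op c a x (op c' a' x' f) = op (c * c' * Circle.exp (a' * x)) (a + a') (x + x') f := by
  refine Lp.ext ?_
  filter_upwards [op_ae c a x (op c' a' x' f), ae_shift (op_ae c' a' x' f) x,
    op_ae (c * c' * Circle.exp (a' * x)) (a + a') (x + x') f] with ψ h1 h2 h3
  have e1 : Circle.exp (-(a' * (ψ - x))) = Circle.exp (a' * x) * Circle.exp (-(a' * ψ)) := by
    rw [← Circle.exp_add]; congr 1; ring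
  have e2 : Circle.exp (-((a + a') * ψ)) = Circle.exp (-(a * ψ)) * Circle.exp (-(a' * ψ)) := by
    rw [← Circle.exp_add]; congr 1; ring
  rw [h1, h2, h3, e1, e2, sub_sub]
  push_cast
  ring

theorem op_one (f : L2R) : op 1 0 0 f = f := by
  refine Lp.ext ?_
  filter_upwards [op_ae 1 0 0 f] with ψ h
  rw [h]; simp

/-- `op` as a linear isometry. -/
def isometry (c : Circle) (a x : ℝ) : L2R →ₗᵢ[ℂ] L2R where
  toFun := op c a x
  map_add' f g := by
    refine Lp.ext ?_
    filter_upwards [op_ae c a x f, op_ae c a x g, op_ae c a x (f + g),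
      Lp.coeFn_add (op c a x f) (op c a x g), ae_shift (Lp.coeFn_add f g) x] with ψ h1 h2 h3 h4 h5
    rw [h3, h4, h5, Pi.add_apply, Pi.add_apply, h1, h2]
    ring
  map_smul' r f := by
    refine Lp.ext ?_
    filter_upwards [op_ae c a x f, op_ae c a x (r • f),
      Lp.coeFn_smul r (op c a x f), ae_shift (Lp.coeFn_smul r f) x] with ψ h1 h2 h3 h4
    rw [RingHom.id_apply, h2, h3, h4, Pi.smul_apply, Pi.smul_apply, h1, smul_eq_mul, smul_eq_mul]
    ring
  norm_map' f := by
    change ‖op c a x f‖ = ‖f‖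
    rw [Lp.norm_def, Lp.norm_def]
    congr 1
    rw [eLpNorm_congr_ae (op_ae c a x f)]
    rw [← eLpNorm_comp_measurePreserving (Lp.aestronglyMeasurable f)
      (measurePreserving_sub_right (volume : Measure ℝ) x)]
    exact eLpNorm_congr_norm_ae (Filter.Eventually.of_forall fun ψ => by
      rw [norm_mul, norm_mul, Circle.norm_coe, Circle.norm_coe, one_mul, one_mul]; rfl)

theorem isometry_apply (c : Circle) (a x : ℝ) (f : L2R) : isometry c a x f = op c a x f := rfl

/-- `op` as a unitary operator. -/
def unitaryOp (c : Circle) (a x : ℝ) : L2R ≃ₗᵢ[ℂ] L2R :=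
  LinearIsometryEquiv.ofSurjective (isometry c a x) fun f =>
    ⟨op (c⁻¹ * Circle.exp (a * x)) (-a) (-x) f, by
      rw [isometry_apply, op_op]
      have : c * (c⁻¹ * Circle.exp (a * x)) * Circle.exp (-a * x) = 1 := by
        rw [mul_inv_cancel_left, ← Circle.exp_add]; simp
      rw [this, add_neg_cancel, add_neg_cancel, op_one]⟩

theorem unitaryOp_apply (c : Circle) (a x : ℝ) (f : L2R) : unitaryOp c a x f = op c a x f := rfl

theorem op_shift (x : ℝ) (f : L2R) :
    op 1 0 x f = Lp.compMeasurePreserving (fun ψ => ψ - x)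
      (measurePreserving_sub_right (volume : Measure ℝ) x) f := by
  refine Lp.ext ?_
  filter_upwards [op_ae 1 0 x f, Lp.coeFn_compMeasurePreserving f
    (measurePreserving_sub_right (volume : Measure ℝ) x)] with ψ h1 h2
  rw [h1, h2]
  simp

theorem continuous_translation (f : L2R) : Continuous fun x : ℝ => op 1 0 x f := by
  simp_rw [op_shift]
  let F : ℝ → C(ℝ, ℝ) := fun x => ⟨fun ψ => ψ - x, by fun_prop⟩
  have hF : Continuous F := ContinuousMap.continuous_of_continuous_uncurry _ (by
    change Continuous fun p : ℝ × ℝ => p.2 - p.1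
    fun_prop)
  exact (continuous_const : Continuous fun _ : ℝ => f).compMeasurePreservingLp hF
    (fun x => measurePreserving_sub_right (volume : Measure ℝ) x) (by simp)

theorem continuous_modulation (f : L2R) : Continuous fun a : ℝ => op 1 a 0 f := by
  refine continuous_iff_continuousAt.2 fun a₀ => ?_
  refine (Lp.tendsto_Lp_iff_tendsto_eLpNorm'' _ (fun a => memLp 1 a 0 f) _ (memLp 1 a₀ 0 f)).2 ?_
  simp only [eLpNorm_eq_lintegral_rpow_enorm_toReal two_ne_zero ENNReal.ofNat_ne_top,
    ENNReal.toReal_ofNat, Circle.coe_one, one_mul, sub_zero, Pi.sub_apply, ← sub_mul, enorm_mul]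
  have hfin : ∫⁻ ψ : ℝ, ((2 : ℝ≥0∞) * ‖f ψ‖ₑ) ^ (2 : ℝ) ≠ ∞ := by
    simp only [ENNReal.mul_rpow_of_nonneg _ _ (zero_le_two : (0 : ℝ) ≤ 2)]
    rw [lintegral_const_mul' _ _ (by norm_num)]
    refine ENNReal.mul_ne_top (by norm_num) ?_
    have := lintegral_rpow_enorm_lt_top_of_eLpNorm_lt_top two_ne_zero ENNReal.ofNat_ne_top
      (Lp.memLp f).2
    simpa using this.ne
  have key : Filter.Tendsto (fun a : ℝ => ∫⁻ ψ : ℝ,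
      (‖(Circle.exp (-(a * ψ)) : ℂ) - Circle.exp (-(a₀ * ψ))‖ₑ * ‖f ψ‖ₑ) ^ (2 : ℝ))
      (𝓝 a₀) (𝓝 (∫⁻ _ : ℝ, 0)) := by
    refine tendsto_lintegral_filter_of_dominated_convergence' _
      (Filter.Eventually.of_forall fun a => ?_)
      (Filter.Eventually.of_forall fun a => Filter.Eventually.of_forall fun ψ => ?_) hfin
      (Filter.Eventually.of_forall fun ψ => ?_)
    · refine AEMeasurable.pow_const (AEMeasurable.mul ?_ (Lp.aestronglyMeasurable f).enorm) _
      exact (Continuous.aestronglyMeasurable (by fun_prop)).enorm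
    · refine ENNReal.rpow_le_rpow ?_ zero_le_two
      gcongr
      refine (enorm_sub_le).trans (le_of_eq ?_)
      rw [← ofReal_norm, ← ofReal_norm, Circle.norm_coe, Circle.norm_coe]
      norm_num
    · have h0 : Filter.Tendsto (fun a : ℝ =>
          ‖(Circle.exp (-(a * ψ)) : ℂ) - Circle.exp (-(a₀ * ψ))‖ₑ) (𝓝 a₀) (𝓝 0) := by
        have hc : Continuous fun a : ℝ =>
            ‖(Circle.exp (-(a * ψ)) : ℂ) - Circle.exp (-(a₀ * ψ))‖ₑ := by fun_prop
        simpa using hc.tendsto a₀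
      have h1 := ENNReal.Tendsto.mul_const (b := ‖f ψ‖ₑ) h0 (Or.inr enorm_ne_top)
      rw [zero_mul] at h1
      simpa [Function.comp_def] using (ENNReal.continuous_rpow_const (y := (2 : ℝ))).tendsto 0 |>.comp h1
  rw [lintegral_zero] at key
  simpa [Function.comp_def] using (ENNReal.continuous_rpow_const (y := (1 / 2 : ℝ))).tendsto 0 |>.comp key

theorem op_eq (c : Circle) (a x : ℝ) (f : L2R) :
    op c a x f = (c : ℂ) • unitaryOp 1 a 0 (op 1 0 x f) := by
  rw [unitaryOp_apply, op_op]
  refine Lp.ext ?_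
  filter_upwards [op_ae c a x f, op_ae (1 * 1 * Circle.exp (0 * 0)) (a + 0) (0 + x) f,
    Lp.coeFn_smul (c : ℂ) (op (1 * 1 * Circle.exp (0 * 0)) (a + 0) (0 + x) f)] with ψ h1 h2 h3
  rw [h3, Pi.smul_apply, h1, h2]
  simp [mul_assoc]

theorem continuous_op {X : Type*} [TopologicalSpace X] {c : X → Circle} {a x : X → ℝ}
    (hc : Continuous c) (ha : Continuous a) (hx : Continuous x) (f : L2R) :
    Continuous fun p => op (c p) (a p) (x p) f := by
  have key : Continuous fun q : ℝ × ℝ => unitaryOp 1 q.1 0 (op 1 0 q.2 f) := by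
    refine continuous_iff_continuousAt.2 fun q₀ => ?_
    have h1 : Filter.Tendsto (fun q : ℝ × ℝ => ‖op 1 0 q.2 f - op 1 0 q₀.2 f‖
        + ‖unitaryOp 1 q.1 0 (op 1 0 q₀.2 f) - unitaryOp 1 q₀.1 0 (op 1 0 q₀.2 f)‖)
        (𝓝 q₀) (𝓝 0) := by
      have c1 : Continuous fun q : ℝ × ℝ => ‖op 1 0 q.2 f - op 1 0 q₀.2 f‖ :=
        (((continuous_translation f).comp continuous_snd).sub continuous_const).norm
      have c2 : Continuous fun q : ℝ × ℝ =>
          ‖unitaryOp 1 q.1 0 (op 1 0 q₀.2 f) - unitaryOp 1 q₀.1 0 (op 1 0 q₀.2 f)‖ :=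
        (((continuous_modulation (op 1 0 q₀.2 f)).comp continuous_fst).sub continuous_const).norm
      have c3 := (c1.add c2).tendsto q₀
      simp only [Pi.add_apply, sub_self, norm_zero, add_zero] at c3
      exact c3
    refine tendsto_iff_norm_sub_tendsto_zero.2
      (squeeze_zero (fun _ => norm_nonneg _) (fun q => ?_) h1)
    refine (norm_sub_le_norm_sub_add_norm_sub _ (unitaryOp 1 q.1 0 (op 1 0 q₀.2 f)) _).trans ?_
    rw [← map_sub, LinearIsometryEquiv.norm_map]
  have h : (fun p => op (c p) (a p) (x p) f) =
      fun p => (c p : ℂ) • unitaryOp 1 (a p) 0 (op 1 0 (x p) f) := funext fun p => op_eq _ _ _ _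
  rw [h]
  have hc' : Continuous fun p => (c p : ℂ) := Continuous.subtype_val hc
  have hk : Continuous fun p => unitaryOp 1 (a p) 0 (op 1 0 (x p) f) := by
    generalize hF : (fun q : ℝ × ℝ => unitaryOp 1 q.1 0 (op 1 0 q.2 f)) = F at key
    have hF' : ∀ p, unitaryOp 1 (a p) 0 (op 1 0 (x p) f) = F (a p, x p) := fun p => by rw [← hF]
    rw [funext hF']
    exact key.comp (ha.prodMk hx)
  exact hc'.smul hk

end Weyl

/-- Multiplication by a complex number of modulus one as a unitary operator on `ℂ`. -/
def circleUnitary : Circle →* (ℂ ≃ₗᵢ[ℂ] ℂ) where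
  toFun c := LinearIsometryEquiv.ofSurjective
    ({ toLinearMap := LinearMap.mulLeft ℂ (c : ℂ)
       norm_map' := fun z => by
        change ‖(c : ℂ) * z‖ = ‖z‖
        rw [norm_mul, Circle.norm_coe, one_mul] } : ℂ →ₗᵢ[ℂ] ℂ)
    fun z => ⟨(c : ℂ)⁻¹ * z, by simp⟩
  map_one' := by ext; simp
  map_mul' c d := by
    ext
    change ((c * d : Circle) : ℂ) * _ = (c : ℂ) * ((d : ℂ) * _)
    rw [Circle.coe_mul, mul_assoc]

theorem circleUnitary_apply (c : Circle) (z : ℂ) : circleUnitary c z = c * z := rfl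

section Representations

variable {K : Type u} [AddCommGroup K] [TopologicalSpace K] (φ₀ : ℝ →+ K)

/-- The representation `π_t` on `L²(ℝ)`:
`(π_t((y, k) x) f)(ψ) = χ_t(k) exp(-i t y ψ) f(ψ - x)`. -/
def schrodingerRep (t : dualSubgroup φ₀) : UnitaryRep (HeisK φ₀) L2R where
  toHom :=
    { toFun := fun g => Weyl.unitaryOp (dualChar φ₀ t g.k) (t * g.y) g.x
      map_one' := by
        ext1 f
        simp only [HeisK.one_def, Weyl.unitaryOp_apply, AddChar.map_zero_eq_one, mul_zero,
          Weyl.op_one]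
        rfl
      map_mul' := fun g h => by
        ext1 f
        change Weyl.op _ _ _ f = Weyl.op _ _ _ (Weyl.op _ _ _ f)
        rw [Weyl.op_op]
        simp only [HeisK.mul_def, AddChar.map_add_eq_mul, dualChar_apply, mul_add]
        rw [← mul_assoc, mul_comm g.x h.y, mul_assoc (t : ℝ)] }
  continuous_apply f :=
    Weyl.continuous_op ((continuous_dualChar φ₀ t).comp (HeisK.continuous_k φ₀))
      (continuous_const.mul (HeisK.continuous_y φ₀)) (HeisK.continuous_x φ₀) f

/-- The one dimensional representation `χ_w`, `w ∈ ℝ²`: the composition of the projection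
`(y, k) x ↦ (x, y)` with the character `v ↦ exp(i (v | w))` of `ℝ²`. -/
def planeRep (w : ℝ × ℝ) : UnitaryRep (HeisK φ₀) ℂ where
  toHom := circleUnitary.comp
    { toFun := fun g => Circle.exp (g.x * w.1 + g.y * w.2)
      map_one' := by simp [HeisK.one_def]
      map_mul' := fun g h => by
        rw [← Circle.exp_add]
        congr 1
        simp only [HeisK.mul_def]
        ring }
  continuous_apply z := by
    have h1 := HeisK.continuous_y φ₀
    have h2 := HeisK.continuous_x φ₀
    change Continuous fun g : HeisK φ₀ => (Circle.exp (g.x * w.1 + g.y * w.2) : ℂ) * z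
    fun_prop

end Representations

end

/-! ## Plancherel's theorem for integrable functions -/

section Fourier

open FourierTransform SchwartzMap

/-! The elements `(0, k) 0` are central, so by Schur's lemma they act in an irreducible
representation by a character of `K`. Restricted along the dense homomorphism `φ₀`, this character
is `exp (i t z)` for exactly one `t ∈ Γ`. This central character sorts the dual.

If `t = 0`, all operators commute, hence are scalars, and the representation is some `χ_w`. If `t ≠
0`, the operators at `(p / t, 0) q` satisfy the Weyl relations, and the Stone-von Neumann theorem
leaves only `π_t`. That theorem is proved with von Neumann's operator `P = ∫ κ(q) W(q) dq`, where
`κ` is a Gaussian (`vacuumKernel`). It is non-zero, self-adjoint and satisfies `P W(w) P = 2π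
conj(κ(w)) P`. Every vector `P ξ ≠ 0` therefore has, up to normalization, one universal matrix
coefficient (`exists_vacuum`). Irreducible representations with a common non-zero diagonal
coefficient are equivalent (`isEquivalent_of_inner_eq`).

The Plancherel formula comes from Fourier expansion in the compact central variable. With central
character `χ_t` the operator `π(f)` depends only on the Fourier coefficient `slice f t`, a function
on the plane. For `t ≠ 0`, `π_t(f)` has as kernel a sheared partial Fourier transform of this slice
at scale `t`, so its squared Hilbert-Schmidt norm is `2π / |t|` times the squared norm of the slice.
At `t = 0` the plane Fourier transform contributes the factor `4π²`. The weights `|t| / 2π` and `1 /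
4π²` cancel these factors, and Parseval's identity on `K` sums the slices to `‖f‖₂²`. The Parseval
identity rests on the completeness of the characters of `K`, obtained here by averaging rank one
operators over Haar measure.

For topology and uniqueness, the functions `conj χ_t ⊗ h` (`HeisK.tensor`) are annihilated by every
representation with another central character. They isolate each `π_t` and compute its mass. For `t
= 0` they reduce the claims to the plane, where modulated Gaussians cut out discs, and translated
Gaussians together with characteristic functions determine a measure. `K` need not be metrizable, so
`Γ` may be uncountable and `ν` not σ-finite. Uniqueness survives because all atoms have positive
mass and every set of atoms is open. -/

theorem integral_fourier_mul_eq_of_integrable {f g : ℝ → ℂ} (hf : Integrable f)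
    (hg : Integrable g) : ∫ w, 𝓕 f w * g w = ∫ y, f y * 𝓕 g y :=
  VectorFourier.integral_fourierIntegral_smul_eq_flip (e := Real.fourierChar)
    (μ := (volume : Measure ℝ)) (ν := volume) (L := innerₗ ℝ)
    Real.continuous_fourierChar continuous_inner hf hg |>.trans (by
      have : (innerₗ ℝ).flip = innerₗ ℝ := by
        ext; simp
      rw [this]
      rfl)

theorem continuous_fourier_of_integrable {g : ℝ → ℂ} (hg : Integrable g) :
    Continuous (𝓕 g : ℝ → ℂ) :=
  VectorFourier.fourierIntegral_continuous Real.continuous_fourierChar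
    (innerSL ℝ).continuous₂ hg

/-- Both transforms pair in the same way with test functions, since each lets the Fourier transform
move onto the test function. Locally integrable functions with equal pairings agree almost
everywhere. -/
theorem fourier_toLp_ae_eq {g : ℝ → ℂ} (h1 : Integrable g) (h2 : MemLp g 2) :
    (𝓕 (h2.toLp g) : Lp ℂ 2 (volume : Measure ℝ)) =ᵐ[volume] (𝓕 g : ℝ → ℂ) := by
  refine ae_eq_of_integral_contDiff_smul_eq
    ((Lp.memLp _).locallyIntegrable (by norm_num))
    (continuous_fourier_of_integrable h1).locallyIntegrable fun φ hφ hφs => ?_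
  have hφ' : ContDiff ℝ (⊤ : ℕ∞) (fun x => (φ x : ℂ)) :=
    Complex.ofRealCLM.contDiff.comp hφ
  have hφs' : HasCompactSupport (fun x => (φ x : ℂ)) :=
    hφs.comp_left (g := fun r : ℝ => (r : ℂ)) Complex.ofReal_zero
  let Φ : 𝓢(ℝ, ℂ) := hφs'.toSchwartzMap hφ'
  have e1 := congrArg (fun T => T Φ) (Lp.fourier_toTemperedDistribution_eq (h2.toLp g))
  simp only [TemperedDistribution.fourier_apply, Lp.toTemperedDistribution_apply] at e1
  have e2 : ∫ x, (𝓕 Φ) x • (h2.toLp g) x = ∫ x, (𝓕 (Φ : ℝ → ℂ)) x * g x := by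
    refine integral_congr_ae ?_
    filter_upwards [h2.coeFn_toLp] with x hx
    rw [hx, smul_eq_mul, SchwartzMap.fourier_coe]
  rw [e2, integral_fourier_mul_eq_of_integrable Φ.integrable h1] at e1
  have e3 : ∀ x, Φ x = (φ x : ℂ) := fun x => rfl
  simp only [e3, smul_eq_mul] at e1
  simp only [Complex.real_smul]
  exact e1.symm

theorem eLpNorm_two_sq_eq_lintegral {α : Type*} {m : MeasurableSpace α} {E : Type*}
    [NormedAddCommGroup E] (μ : Measure α) (f : α → E) :
    eLpNorm f 2 μ ^ 2 = ∫⁻ x, ‖f x‖ₑ ^ 2 ∂μ := by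
  have := eLpNorm_nnreal_pow_eq_lintegral (f := f) (μ := μ) (p := 2) two_ne_zero
  simpa using this

theorem memLp_two_iff_lintegral {α : Type*} {m : MeasurableSpace α} {E : Type*}
    [NormedAddCommGroup E] {μ : Measure α} {f : α → E} (hf : AEStronglyMeasurable f μ) :
    MemLp f 2 μ ↔ ∫⁻ x, ‖f x‖ₑ ^ 2 ∂μ < ∞ := by
  rw [← eLpNorm_two_sq_eq_lintegral, MemLp, and_iff_right hf]
  simp [lt_top_iff_ne_top]

theorem Lp.enorm_sq_eq_lintegral {α : Type*} {m : MeasurableSpace α} {E : Type*}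
    [NormedAddCommGroup E] {μ : Measure α} (f : Lp E 2 μ) :
    ‖f‖ₑ ^ 2 = ∫⁻ x, ‖f x‖ₑ ^ 2 ∂μ := by
  rw [Lp.enorm_def, eLpNorm_two_sq_eq_lintegral]

theorem lintegral_enorm_fourier_sq {g : ℝ → ℂ} (h1 : Integrable g) (h2 : MemLp g 2) :
    ∫⁻ w, ‖(𝓕 g : ℝ → ℂ) w‖ₑ ^ 2 = ∫⁻ y, ‖g y‖ₑ ^ 2 := by
  have e : ‖(𝓕 (h2.toLp g) : Lp ℂ 2 (volume : Measure ℝ))‖ₑ = ‖h2.toLp g‖ₑ := by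
    rw [← ofReal_norm, ← ofReal_norm, Lp.norm_fourier_eq]
  have e2 := congrArg (· ^ 2) e
  simp only [Lp.enorm_sq_eq_lintegral] at e2
  have e3 : ∫⁻ w, ‖(𝓕 (h2.toLp g) : Lp ℂ 2 (volume : Measure ℝ)) w‖ₑ ^ 2
      = ∫⁻ w, ‖(𝓕 g : ℝ → ℂ) w‖ₑ ^ 2 :=
    lintegral_congr_ae ((fourier_toLp_ae_eq h1 h2).mono fun x hx => by simp only [hx])
  rw [← e3, e2]
  exact lintegral_congr_ae ((h2.coeFn_toLp).mono fun x hx => by simp only [hx])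

theorem lintegral_comp_mul_left (F : ℝ → ℝ≥0∞) {a : ℝ} (ha : a ≠ 0) :
    ∫⁻ x, F (a * x) = ENNReal.ofReal |a⁻¹| * ∫⁻ x, F x := by
  have h := Real.map_volume_mul_left ha
  rw [← smul_eq_mul, ← lintegral_smul_measure, ← h]
  exact ((Homeomorph.mulLeft₀ a ha).measurableEmbedding.lintegral_map _).symm

/-- The integral is the normalized Fourier transform at `(t / 2π) w`, so the constant is the
Jacobian of this dilation. It is the source of the mass `|t| / 2π` of `π_t`. -/
theorem lintegral_enorm_integral_exp_sq {g : ℝ → ℂ} (h1 : Integrable g) (h2 : MemLp g 2)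
    {t : ℝ} (ht : t ≠ 0) :
    ∫⁻ w, ‖∫ y, (Circle.exp (-(t * y * w)) : ℂ) * g y‖ₑ ^ 2
      = ENNReal.ofReal (2 * Real.pi / |t|) * ∫⁻ y, ‖g y‖ₑ ^ 2 := by
  have hpi : (2 * Real.pi) ≠ 0 := by positivity
  have e : ∀ w, ∫ y, (Circle.exp (-(t * y * w)) : ℂ) * g y
      = (𝓕 g : ℝ → ℂ) ((t / (2 * Real.pi)) * w) := fun w => by
    rw [Real.fourier_real_eq]
    refine integral_congr_ae (Filter.Eventually.of_forall fun y => ?_)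
    simp only [Circle.smul_def, smul_eq_mul]
    rw [Real.fourierChar_apply']
    congr 4
    field_simp
  simp only [e]
  rw [lintegral_comp_mul_left (fun w => ‖(𝓕 g : ℝ → ℂ) w‖ₑ ^ 2) (div_ne_zero ht hpi),
    lintegral_enorm_fourier_sq h1 h2]
  congr 2
  rw [inv_div, abs_div, abs_of_pos (by positivity : 0 < 2 * Real.pi)]

variable {X : Type*} [MeasurableSpace X] {μ : Measure X} [SFinite μ]

theorem aestronglyMeasurable_partial_integral_exp {G : ℝ × X → ℂ}
    (hG : AEStronglyMeasurable G (volume.prod μ)) (t : ℝ) :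
    AEStronglyMeasurable (fun p : ℝ × X =>
      ∫ y, (Circle.exp (-(t * y * p.1)) : ℂ) * G (y, p.2)) (volume.prod μ) := by
  have h : AEStronglyMeasurable (fun q : (ℝ × X) × ℝ =>
      (Circle.exp (-(t * q.2 * q.1.1)) : ℂ) * G (q.2, q.1.2)) ((volume.prod μ).prod volume) := by
    refine AEStronglyMeasurable.mul ?_ ?_
    · have hc : Measurable fun q : ℝ × ℝ => (Circle.exp (-(t * q.2 * q.1)) : ℂ) :=
        Continuous.measurable (by fun_prop)
      exact (hc.comp ((measurable_fst.comp measurable_fst).prodMk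
        measurable_snd)).stronglyMeasurable.aestronglyMeasurable
    · have hq : Measure.QuasiMeasurePreserving (fun q : (ℝ × X) × ℝ => (q.2, q.1.2))
          (((volume : Measure ℝ).prod μ).prod volume) ((volume : Measure ℝ).prod μ) :=
        (Measure.measurePreserving_swap (μ := μ)
          (ν := (volume : Measure ℝ))).quasiMeasurePreserving.comp
          (Measure.quasiMeasurePreserving_snd.comp
            (measurePreserving_prodAssoc (volume : Measure ℝ) μ
              (volume : Measure ℝ)).quasiMeasurePreserving)
      exact hG.comp_quasiMeasurePreserving hq
  exact h.integral_prod_right'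

theorem lintegral_partial_integral_exp_sq {G : ℝ × X → ℂ} (h1 : Integrable G (volume.prod μ))
    (h2 : MemLp G 2 (volume.prod μ)) {t : ℝ} (ht : t ≠ 0) :
    ∫⁻ p : ℝ × X, ‖∫ y, (Circle.exp (-(t * y * p.1)) : ℂ) * G (y, p.2)‖ₑ ^ 2 ∂(volume.prod μ)
      = ENNReal.ofReal (2 * Real.pi / |t|) * ∫⁻ p, ‖G p‖ₑ ^ 2 ∂(volume.prod μ) := by
  have hfin := (memLp_two_iff_lintegral h2.1).1 h2
  rw [lintegral_prod_symm _ ((aestronglyMeasurable_partial_integral_exp h2.1 t).enorm.pow_const _),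
    lintegral_prod_symm _ (h2.1.enorm.pow_const _), ← lintegral_const_mul'' _
      ((h2.1.enorm.pow_const 2).lintegral_prod_left')]
  refine lintegral_congr_ae ?_
  have a1 := h1.prod_left_ae
  have a2 : ∀ᵐ x ∂μ, ∫⁻ y, ‖G (y, x)‖ₑ ^ 2 < ∞ := by
    rw [lintegral_prod_symm _ (h2.1.enorm.pow_const _)] at hfin
    exact ae_lt_top' ((h2.1.enorm.pow_const 2).lintegral_prod_left') hfin.ne
  filter_upwards [a1, a2] with x hx1 hx2
  exact lintegral_enorm_integral_exp_sq hx1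
    ((memLp_two_iff_lintegral hx1.aestronglyMeasurable).2 hx2) ht

/-- Two one-dimensional transforms with `t = -1`, one per variable, each contribute a factor `2π`.
-/
theorem lintegral_enorm_integral_exp_plane_sq {F : ℝ × ℝ → ℂ} (h1 : Integrable F)
    (h2 : MemLp F 2) :
    ∫⁻ w : ℝ × ℝ, ‖∫ p : ℝ × ℝ, (Circle.exp (p.2 * w.1 + p.1 * w.2) : ℂ) * F p‖ₑ ^ 2
      = ENNReal.ofReal (4 * Real.pi ^ 2) * ∫⁻ p, ‖F p‖ₑ ^ 2 := by
  set G : ℝ × ℝ → ℂ := fun p => ∫ y, (Circle.exp (-((-1) * y * p.1)) : ℂ) * F (y, p.2) with hG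
  have hGm : AEStronglyMeasurable G (volume.prod volume) :=
    aestronglyMeasurable_partial_integral_exp h2.1 (-1)
  have hG2 := lintegral_partial_integral_exp_sq (μ := (volume : Measure ℝ)) h1 h2
    (t := -1) (by norm_num)
  have hG2' : MemLp G 2 (volume.prod volume) := by
    rw [memLp_two_iff_lintegral hGm, hG2]
    exact ENNReal.mul_lt_top ENNReal.ofReal_lt_top ((memLp_two_iff_lintegral h2.1).1 h2)
  have key : ∀ w : ℝ × ℝ, ∫ p : ℝ × ℝ, (Circle.exp (p.2 * w.1 + p.1 * w.2) : ℂ) * F p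
      = ∫ x, (Circle.exp (-((-1) * x * w.1)) : ℂ) * G (w.2, x) := fun w => by
    have hi : Integrable (fun p : ℝ × ℝ => (Circle.exp (p.2 * w.1 + p.1 * w.2) : ℂ) * F p)
        (volume.prod volume) := by
      refine h1.bdd_mul (c := 1) (Continuous.aestronglyMeasurable (by fun_prop)) ?_
      exact Filter.Eventually.of_forall fun p => (Circle.norm_coe _).le
    rw [Measure.volume_eq_prod, integral_prod_symm _ hi]
    refine integral_congr_ae (Filter.Eventually.of_forall fun x => ?_)
    simp only [hG]
    rw [← integral_const_mul]
    refine integral_congr_ae (Filter.Eventually.of_forall fun y => ?_)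
    simp only
    rw [← mul_assoc, ← Circle.coe_mul, ← Circle.exp_add]
    congr 3
    ring
  simp only [key]
  have hGs : ∀ v, Integrable fun x => G (v, x) := fun v => by
    have hi : Integrable (fun p : ℝ × ℝ => (Circle.exp (-((-1) * p.1 * v)) : ℂ) * F p)
        (volume.prod volume) := by
      refine h1.bdd_mul (c := 1) (Continuous.aestronglyMeasurable (by fun_prop)) ?_
      exact Filter.Eventually.of_forall fun p => (Circle.norm_coe _).le
    exact hi.integral_prod_right
  -- Every slice of `G` is integrable, but square integrability holds only for almost every slice,
  -- by Tonelli.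
  have hGs2 : ∀ᵐ v, MemLp (fun x => G (v, x)) 2 := by
    have hfin := (memLp_two_iff_lintegral hGm).1 hG2'
    rw [lintegral_prod _ (hGm.enorm.pow_const _)] at hfin
    filter_upwards [ae_lt_top' ((hGm.enorm.pow_const 2).lintegral_prod_right') hfin.ne] with v hv
    exact (memLp_two_iff_lintegral (hGs v).aestronglyMeasurable).2 hv
  have hm : AEStronglyMeasurable (fun w : ℝ × ℝ =>
      ∫ x, (Circle.exp (-((-1) * x * w.1)) : ℂ) * G (w.2, x)) (volume.prod volume) :=
    aestronglyMeasurable_partial_integral_exp (μ := (volume : Measure ℝ))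
      (G := fun p => G p.swap) hGm.prod_swap (-1)
  rw [Measure.volume_eq_prod, lintegral_prod_symm _ (hm.enorm.pow_const 2)]
  have : ∀ᵐ v : ℝ, ∫⁻ u : ℝ, ‖∫ x, (Circle.exp (-((-1) * x * u)) : ℂ) * G (v, x)‖ₑ ^ 2
      = ENNReal.ofReal (2 * Real.pi / |(-1 : ℝ)|) * ∫⁻ x, ‖G (v, x)‖ₑ ^ 2 := by
    filter_upwards [hGs2] with v hv
    exact lintegral_enorm_integral_exp_sq (hGs v) hv (by norm_num)
  rw [lintegral_congr_ae this, lintegral_const_mul'' _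
    ((hGm.enorm.pow_const 2).lintegral_prod_right'), ← lintegral_prod _ (hGm.enorm.pow_const 2),
    hG2, ← mul_assoc, ← ENNReal.ofReal_mul (by positivity)]
  congr 2
  simp
  ring

end Fourier

/-! ## Parseval's identity and the Hilbert-Schmidt norm -/

section Hilbert

variable {H : Type*} [NormedAddCommGroup H] [InnerProductSpace ℂ H]
  {H' : Type*} [NormedAddCommGroup H'] [InnerProductSpace ℂ H']
  {ι ι' : Type*}

theorem HilbertBasis.tsum_enorm_inner_sq (b : HilbertBasis ι ℂ H) (x : H) :
    ∑' i, ‖inner ℂ (b i) x‖ₑ ^ 2 = ‖x‖ₑ ^ 2 := by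
  have h := lp.hasSum_norm (p := 2) (by norm_num) (b.repr x)
  simp only [ENNReal.toReal_ofNat, Real.rpow_ofNat, b.repr_apply_apply,
    LinearIsometryEquiv.norm_map] at h
  have e : ∀ z : ℂ, ‖z‖ₑ ^ 2 = ENNReal.ofReal (‖z‖ ^ 2) := fun z => by
    rw [ENNReal.ofReal_pow (norm_nonneg _), ofReal_norm]
  simp only [e]
  rw [← ENNReal.ofReal_tsum_of_nonneg (fun _ => by positivity) h.summable, h.tsum_eq,
    ENNReal.ofReal_pow (norm_nonneg _), ofReal_norm]

theorem HilbertBasis.tsum_enorm_inner_sq' (b : HilbertBasis ι ℂ H) (x : H) :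
    ∑' i, ‖inner ℂ x (b i)‖ₑ ^ 2 = ‖x‖ₑ ^ 2 := by
  rw [← b.tsum_enorm_inner_sq x]
  refine tsum_congr fun i => ?_
  rw [← inner_conj_symm, RCLike.enorm_conj]

/-- Distinct basis vectors have distance `√2 > 1`, so the balls of radius `1 / 2` around them are
disjoint non-empty open sets. -/
theorem HilbertBasis.countable [TopologicalSpace.SeparableSpace H] (b : HilbertBasis ι ℂ H) :
    Countable ι := by
  have hd : ∀ i j, i ≠ j → 1 < dist (b i) (b j) := fun i j hij => by
    have h0 : inner ℂ (b i) (b j) = 0 := b.orthonormal.2 hij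
    have h1 := @norm_sub_sq ℂ H _ _ _ (b i) (b j)
    rw [h0, b.orthonormal.1, b.orthonormal.1] at h1
    rw [dist_eq_norm]
    norm_num at h1
    nlinarith [norm_nonneg (b i - b j)]
  have hdisj : Pairwise (Function.onFun Disjoint fun i => Metric.ball (b i) (1 / 2)) :=
    fun i j hij => Metric.ball_disjoint_ball (by linarith [hd i j hij])
  exact hdisj.countable_of_isOpen_disjoint (fun _ => Metric.isOpen_ball)
    (fun i => ⟨b i, Metric.mem_ball_self (by norm_num)⟩)

variable [CompleteSpace H] [CompleteSpace H']

/-- Both sides are the double sum of `|⟨T b_i, b'_j⟩|²`. Used twice, this shows that the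
Hilbert-Schmidt norm does not depend on the basis. Sums in `ℝ≥0∞` commute without any countability
assumption. -/
theorem HilbertBasis.tsum_enorm_apply_eq_adjoint (b : HilbertBasis ι ℂ H)
    (b' : HilbertBasis ι' ℂ H') (T : H →L[ℂ] H') :
    ∑' i, ‖T (b i)‖ₑ ^ 2 = ∑' j, ‖ContinuousLinearMap.adjoint T (b' j)‖ₑ ^ 2 := by
  simp only [← b'.tsum_enorm_inner_sq (T _),
    ← b.tsum_enorm_inner_sq' (ContinuousLinearMap.adjoint T _)]
  rw [ENNReal.tsum_comm]
  simp only [ContinuousLinearMap.adjoint_inner_left]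

theorem hilbertSchmidtNormSq_eq (b : HilbertBasis ι ℂ H) (T : H →L[ℂ] H) :
    hilbertSchmidtNormSq T = ∑' i, ‖T (b i)‖ₑ ^ 2 := by
  obtain ⟨b', hb'⟩ := (exists_hilbertBasis ℂ H).choose_spec
  have : hilbertSchmidtNormSq T = ∑' i, ‖T (b' i)‖ₑ ^ 2 := by
    rw [hilbertSchmidtNormSq, hb']
  rw [this, b'.tsum_enorm_apply_eq_adjoint b', b.tsum_enorm_apply_eq_adjoint b']

theorem hilbertSchmidtNormSq_conj (U : H ≃ₗᵢ[ℂ] H') {T : H →L[ℂ] H} {T' : H' →L[ℂ] H'}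
    (h : ∀ ξ, U (T ξ) = T' (U ξ)) : hilbertSchmidtNormSq T = hilbertSchmidtNormSq T' := by
  obtain ⟨w, b, -⟩ := exists_hilbertBasis ℂ H
  let b' : HilbertBasis w ℂ H' := ⟨U.symm.trans b.repr⟩
  rw [hilbertSchmidtNormSq_eq b, hilbertSchmidtNormSq_eq b']
  refine tsum_congr fun i => ?_
  have : b' i = U (b i) := by
    classical
    rw [← b'.repr_symm_single, ← b.repr_symm_single]
    rfl
  rw [this, ← h, ← ofReal_norm, ← ofReal_norm, LinearIsometryEquiv.norm_map]

theorem hilbertSchmidtNormSq_of_apply_eq_mul {T : ℂ →L[ℂ] ℂ} {c : ℂ} (h : ∀ z, T z = c * z) :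
    hilbertSchmidtNormSq T = ‖c‖ₑ ^ 2 := by
  obtain ⟨w, b, -⟩ := exists_hilbertBasis ℂ ℂ
  rw [hilbertSchmidtNormSq_eq b]
  have : ∀ i, ‖T (b i)‖ₑ ^ 2 = ‖c‖ₑ ^ 2 * ‖inner ℂ (b i) (1 : ℂ)‖ₑ ^ 2 := fun i => by
    rw [h, enorm_mul, mul_pow, ← inner_conj_symm, RCLike.enorm_conj]
    simp
  simp only [this]
  rw [ENNReal.tsum_mul_left, b.tsum_enorm_inner_sq]
  simp

end Hilbert

/-! ### Parseval's identity in one variable of a product -/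

section Slice

variable {X Y : Type*} [MeasurableSpace X] [MeasurableSpace Y] {μ : Measure X} {ν : Measure Y}

theorem tsum_enorm_integral_mul_basis {ι : Type*} (b : HilbertBasis ι ℂ (Lp ℂ 2 ν))
    {h : Y → ℂ} (hh : MemLp h 2 ν) :
    ∑' i, ‖∫ y, h y * b i y ∂ν‖ₑ ^ 2 = ∫⁻ y, ‖h y‖ₑ ^ 2 ∂ν := by
  have hc : MemLp (fun y => (starRingEnd ℂ) (h y)) 2 ν :=
    (memLp_congr_norm (Complex.continuous_conj.comp_aestronglyMeasurable hh.1) hh.1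
      (Filter.Eventually.of_forall fun y => by simp)).2 hh
  have e : ∀ i, inner ℂ (hc.toLp _) (b i) = ∫ y, h y * b i y ∂ν := fun i => by
    rw [L2.inner_def]
    refine integral_congr_ae ?_
    filter_upwards [hc.coeFn_toLp] with y hy
    rw [hy, RCLike.inner_apply, RingHomCompTriple.comp_apply, RingHom.id_apply, mul_comm]
  simp only [← e]
  rw [b.tsum_enorm_inner_sq', Lp.enorm_sq_eq_lintegral]
  refine lintegral_congr_ae ?_
  filter_upwards [hc.coeFn_toLp] with y hy
  rw [hy, RCLike.enorm_conj]

/-- This is the Hilbert-Schmidt norm of the integral operator with kernel `k`: Parseval for almost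
every row `k (x, ·)`, then integration over `x`. Countability of the basis allows the sum to pass
under the integral. -/
theorem tsum_lintegral_integral_mul_basis [SFinite μ] [SFinite ν] {ι : Type*} [Countable ι]
    (b : HilbertBasis ι ℂ (Lp ℂ 2 ν)) {k : X × Y → ℂ} (hk : MemLp k 2 (μ.prod ν)) :
    ∑' i, ∫⁻ x, ‖∫ y, k (x, y) * b i y ∂ν‖ₑ ^ 2 ∂μ = ∫⁻ p, ‖k p‖ₑ ^ 2 ∂(μ.prod ν) := by
  rw [← lintegral_tsum, lintegral_prod _ (hk.1.enorm.pow_const 2)]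
  · refine lintegral_congr_ae ?_
    have hfin := (memLp_two_iff_lintegral hk.1).1 hk
    rw [lintegral_prod _ (hk.1.enorm.pow_const 2)] at hfin
    filter_upwards [hk.1.prodMk_left,
      ae_lt_top' (hk.1.enorm.pow_const 2).lintegral_prod_right' hfin.ne] with x h1 h2
    exact tsum_enorm_integral_mul_basis b ((memLp_two_iff_lintegral h1).2 h2)
  · intro i
    have hm : AEStronglyMeasurable (fun p : X × Y => k p * b i p.2) (μ.prod ν) :=
      hk.1.mul (Lp.aestronglyMeasurable (b i)).comp_snd
    exact hm.integral_prod_right'.enorm.pow_const 2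

end Slice

/-! ## Isometric representations of compact abelian groups -/

section EigenCharacter

variable {A : Type*} [AddCommGroup A] [TopologicalSpace A]
  {H : Type*} [NormedAddCommGroup H] [InnerProductSpace ℂ H]

/-- Since `u ≠ 0`, the eigenvalues are unique, hence multiplicative and of modulus one. Continuity
follows from the formula `c a = ⟨u, τ a u⟩ / ⟨u, u⟩`. -/
theorem exists_addChar_of_eigenvector {τ : A → H →ₗᵢ[ℂ] H}
    (hadd : ∀ a b ξ, τ (a + b) ξ = τ a (τ b ξ)) {u : H} (hcont : Continuous fun a => τ a u)
    (hu : u ≠ 0) (h : ∀ a, ∃ c : ℂ, τ a u = c • u) :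
    ∃ χ : AddChar A Circle, Continuous χ ∧ ∀ a, τ a u = (χ a : ℂ) • u := by
  choose c hc using h
  have hinj : ∀ {x y : ℂ}, x • u = y • u → x = y := fun {x y} h => smul_left_injective ℂ hu h
  have hnorm : ∀ a, ‖c a‖ = 1 := fun a => by
    have := (τ a).norm_map u
    rw [hc, norm_smul] at this
    exact mul_right_cancel₀ (norm_ne_zero_iff.2 hu) (by rw [this, one_mul])
  have hmul : ∀ a b, c (a + b) = c a * c b := fun a b => hinj (by
    rw [← hc, hadd, hc b, map_smul, hc a, smul_smul, mul_comm])
  have hne : ∀ a, c a ≠ 0 := fun a h0 => by simpa [h0] using hnorm a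
  have h0 : c 0 = 1 := by
    have := hmul 0 0
    rw [add_zero] at this
    exact mul_left_cancel₀ (hne 0) (by rw [← this, mul_one])
  have hcc : Continuous c := by
    have e : c = fun a => inner ℂ u (τ a u) / inner ℂ u u := funext fun a => by
      rw [hc, inner_smul_right, mul_div_cancel_right₀ _ (inner_self_ne_zero.2 hu)]
    rw [e]
    fun_prop
  let χ : AddChar A Circle :=
    { toFun := fun a => ⟨c a, mem_sphere_zero_iff_norm.2 (hnorm a)⟩
      map_zero_eq_one' := Subtype.ext h0
      map_add_eq_mul' := fun a b => Subtype.ext (hmul a b) }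
  exact ⟨χ, hcc.subtype_mk _, hc⟩

end EigenCharacter

section CompactRep

variable {K : Type*} [AddCommGroup K] [TopologicalSpace K] [IsTopologicalAddGroup K]
  [CompactSpace K] [MeasurableSpace K] [BorelSpace K]

/-- The normalized Haar measure of a compact group. -/
noncomputable abbrev normalizedHaar (K : Type*) [AddCommGroup K] [TopologicalSpace K]
    [IsTopologicalAddGroup K] [CompactSpace K] [MeasurableSpace K] [BorelSpace K] : Measure K :=
  Measure.addHaarMeasure (⊤ : TopologicalSpace.PositiveCompacts K)

instance : IsProbabilityMeasure (normalizedHaar K) :=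
  ⟨by
    have := Measure.addHaarMeasure_self (K₀ := (⊤ : TopologicalSpace.PositiveCompacts K))
    simpa using this⟩

theorem Continuous.integrable_of_compactSpace {E : Type*} [NormedAddCommGroup E]
    {f : K → E} (hf : Continuous f) : Integrable f (normalizedHaar K) :=
  hf.integrable_of_hasCompactSupport (HasCompactSupport.of_compactSpace f)

variable {H : Type*} [NormedAddCommGroup H] [InnerProductSpace ℂ H] [CompleteSpace H]
  {τ : K → H →ₗᵢ[ℂ] H}

/-- The Haar average `S` of the rank one operators `⟨τ k v, ·⟩ τ k v` is compact, self-adjoint,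
commutes with `τ` and maps into `V`. It is non-zero because `⟨v, S v⟩ = ∫ |⟨v, τ k v⟩|² dk > 0`.
Hence it has an eigenvalue `μ ≠ 0`, whose eigenspace is finite-dimensional, invariant and inside
`V`. -/
theorem exists_finiteDimensional_invariant (h0 : ∀ ξ, τ 0 ξ = ξ)
    (hadd : ∀ a b ξ, τ (a + b) ξ = τ a (τ b ξ)) (hcont : ∀ ξ, Continuous fun a => τ a ξ)
    {V : Submodule ℂ H} (hV : IsClosed (V : Set H)) (hinv : ∀ a, ∀ ξ ∈ V, τ a ξ ∈ V)
    (hne : V ≠ ⊥) :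
    ∃ E ≤ V, E ≠ ⊥ ∧ FiniteDimensional ℂ E ∧ ∀ a, ∀ ξ ∈ E, τ a ξ ∈ E := by
  obtain ⟨v, hvV, hv⟩ := V.ne_bot_iff.1 hne
  let R : K → (H →L[ℂ] H) := fun k => InnerProductSpace.rankOne ℂ (τ k v) (τ k v)
  have hRc : Continuous R := by
    have e : R = fun k => (ContinuousLinearMap.toSpanSingleton ℂ (τ k v)).comp
        (innerSL ℂ (τ k v)) := funext fun k => InnerProductSpace.rankOne_def' _ _
    rw [e]
    exact ((ContinuousLinearMap.toSpanSingletonCLE (𝕜 := ℂ) (E := H)).continuous.comp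
      (hcont v)).clm_comp ((innerSL ℂ).continuous.comp (hcont v))
  have hRi : Integrable R (normalizedHaar K) := hRc.integrable_of_compactSpace
  let S : H →L[ℂ] H := ∫ k, R k ∂(normalizedHaar K)
  have hS : ∀ x, S x = ∫ k, inner ℂ (τ k v) x • τ k v ∂(normalizedHaar K) := fun x => by
    change (∫ k, R k ∂(normalizedHaar K)) x = _
    rw [ContinuousLinearMap.integral_apply hRi]
    rfl
  have hSi : ∀ x, Integrable (fun k => inner ℂ (τ k v) x • τ k v) (normalizedHaar K) := fun x =>
    (((hcont v).inner continuous_const).smul (hcont v)).integrable_of_compactSpace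
  have hS' : ∀ x y, inner ℂ y (S x)
      = ∫ k, inner ℂ (τ k v) x * inner ℂ y (τ k v) ∂(normalizedHaar K) := fun x y => by
    rw [hS, ← integral_inner (hSi x)]
    simp only [inner_smul_right]
  -- The compact operators form a closed convex set, so the average of rank one operators stays in
  -- it.
  have hcompact : IsCompactOperator S := by
    have hmem : S ∈ (compactOperator (RingHom.id ℂ) H H : Set (H →L[ℂ] H)) := by
      refine Convex.integral_mem (μ := normalizedHaar K) (f := R)
        ((compactOperator (RingHom.id ℂ) H H).restrictScalars ℝ).convex
        isClosed_setOfPred_isCompactOperator (Filter.Eventually.of_forall fun k => ?_) hRi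
      have : IsCompactOperator (ContinuousLinearMap.toSpanSingleton ℂ (τ k v)) :=
        isCompactOperator_of_locallyCompactSpace_rng
          (ContinuousLinearMap.toSpanSingleton ℂ (τ k v))
      exact this.comp_clm (innerSL ℂ (τ k v))
    exact hmem
  have hsymm : S.IsSymmetric := fun x y => by
    change inner ℂ (S x) y = inner ℂ x (S y)
    rw [← inner_conj_symm, hS', hS', ← integral_conj]
    refine integral_congr_ae (Filter.Eventually.of_forall fun k => ?_)
    simp only [map_mul, inner_conj_symm]
    ring
  -- Translating the integration variable by `l` replaces `v`'s orbit point `τ k v` by `τ l (τ k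
  -- v)`; the isometry `τ l` then cancels in the inner products.
  have hcomm : ∀ l x, S (τ l x) = τ l (S x) := fun l x => by
    refine ext_inner_left ℂ fun y => ?_
    have hl : ∀ z, τ l (τ (-l) z) = z := fun z => by rw [← hadd, add_neg_cancel, h0]
    rw [hS', ← integral_add_left_eq_self _ l]
    conv_rhs => rw [← hl y, LinearIsometry.inner_map_map, hS']
    refine integral_congr_ae (Filter.Eventually.of_forall fun k => ?_)
    simp only [hadd, LinearIsometry.inner_map_map]
    conv_lhs => rw [← hl y, LinearIsometry.inner_map_map]
  have hSV : ∀ x, S x ∈ V := fun x => by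
    rw [hS]
    exact Convex.integral_mem (V.restrictScalars ℝ).convex hV
      (Filter.Eventually.of_forall fun k => V.smul_mem _ (hinv k v hvV)) (hSi x)
  have hSne : S ≠ 0 := fun hS0 => by
    have h1 := hS' v v
    have h2 : ∀ k, inner ℂ (τ k v) v * inner ℂ v (τ k v) = ((‖inner ℂ v (τ k v)‖ ^ 2 : ℝ) : ℂ) :=
      fun k => by
        rw [← inner_conj_symm, Complex.conj_mul']
        push_cast; rfl
    simp only [h2] at h1
    rw [integral_complex_ofReal, hS0] at h1
    simp only [zero_apply, inner_zero_right] at h1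
    have h3 : Continuous fun k => ‖inner ℂ v (τ k v)‖ ^ 2 := by
      have := hcont v
      fun_prop
    have h4 : 0 < ∫ k, ‖inner ℂ v (τ k v)‖ ^ 2 ∂(normalizedHaar K) := by
      refine h3.integral_pos_of_hasCompactSupport_nonneg_nonzero
        (HasCompactSupport.of_compactSpace _) (fun k => by positivity) (x := 0) ?_
      rw [h0]
      simpa using hv
    rw [← Complex.ofReal_zero, Complex.ofReal_inj] at h1
    exact h4.ne h1
  have hex : ∃ μ : ℂ, Module.End.HasEigenvalue (S : Module.End ℂ H) μ ∧ μ ≠ 0 := by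
    by_contra! hcon
    exact hSne ((ContinuousLinearMap.eq_zero_of_forall_hasEigenvalue_eq_zero hcompact hsymm).1 hcon)
  obtain ⟨μ, hμ, hμ0⟩ := hex
  refine ⟨Module.End.eigenspace (S : Module.End ℂ H) μ, fun x hx => ?_, hμ,
    ContinuousLinearMap.finite_dimensional_eigenspace hcompact μ hμ0, fun a x hx => ?_⟩
  · have hx' : S x = μ • x := Module.End.mem_eigenspace_iff.1 hx
    have : x = μ⁻¹ • S x := by rw [hx', smul_smul, inv_mul_cancel₀ hμ0, one_smul]
    rw [this]
    exact V.smul_mem _ (hSV x)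
  · have hx' : S x = μ • x := Module.End.mem_eigenspace_iff.1 hx
    refine Module.End.mem_eigenspace_iff.2 ?_
    change S (τ a x) = _
    rw [hcomm, hx', map_smul]

end CompactRep

/-! ### Commuting isometries on a finite-dimensional space -/

section CommonEigenvector

variable {A : Type*} [AddCommGroup A] {H : Type*} [NormedAddCommGroup H] [InnerProductSpace ℂ H]
  {τ : A → H →ₗᵢ[ℂ] H}

/-- Induction on the dimension: if some `τ a` is not a scalar on `E`, one of its eigenspaces in `E`
is non-zero and strictly smaller, and it is invariant because the group is commutative. -/
theorem exists_common_eigenvector (hadd : ∀ a b ξ, τ (a + b) ξ = τ a (τ b ξ))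
    (E : Submodule ℂ H) [FiniteDimensional ℂ E] (hE : E ≠ ⊥) (hinv : ∀ a, ∀ ξ ∈ E, τ a ξ ∈ E) :
    ∃ u ∈ E, u ≠ 0 ∧ ∀ a, ∃ c : ℂ, τ a u = c • u := by
  induction hn : Module.finrank ℂ E using Nat.strong_induction_on generalizing E with
  | _ n ih =>
    subst hn
    by_cases hscal : ∀ a, ∃ c : ℂ, ∀ ξ ∈ E, τ a ξ = c • ξ
    · obtain ⟨u, huE, hu⟩ := E.ne_bot_iff.1 hE
      exact ⟨u, huE, hu, fun a => (hscal a).imp fun c hc => hc u huE⟩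
    · push Not at hscal
      obtain ⟨a, ha⟩ := hscal
      have : Nontrivial E := Submodule.nontrivial_iff_ne_bot.2 hE
      let T : Module.End ℂ E := (τ a).toLinearMap.restrict (hinv a)
      obtain ⟨c, hc⟩ := Module.End.exists_eigenvalue T
      let E' : Submodule ℂ H := E ⊓ LinearMap.ker ((τ a).toLinearMap - c • LinearMap.id)
      have hmem : ∀ ξ, ξ ∈ E' ↔ ξ ∈ E ∧ τ a ξ = c • ξ := fun ξ => by
        simp [E', sub_eq_zero]
      have hle : E' ≤ E := inf_le_left
      have hlt : E' < E := by
        refine lt_of_le_of_ne hle fun heq => ?_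
        obtain ⟨ξ, hξ, hξ'⟩ := ha c
        rw [← heq] at hξ
        exact hξ' ((hmem ξ).1 hξ).2
      have : FiniteDimensional ℂ E' := Submodule.finiteDimensional_of_le hle
      have hne : E' ≠ ⊥ := by
        obtain ⟨w, hw⟩ := hc.exists_hasEigenvector
        refine E'.ne_bot_iff.2 ⟨w, (hmem _).2 ⟨w.2, ?_⟩, fun h => hw.2 (Subtype.ext h)⟩
        exact congrArg Subtype.val hw.apply_eq_smul
      obtain ⟨u, hu, hu0, huc⟩ := ih _ (Submodule.finrank_lt_finrank_of_lt hlt) E' hne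
        (fun b ξ hξ => (hmem _).2 ⟨hinv b ξ (hle hξ), by
          rw [← hadd, add_comm, hadd, ((hmem ξ).1 hξ).2, map_smul]⟩) rfl
      exact ⟨u, hle hu, hu0, huc⟩

end CommonEigenvector

/-! ## Completeness of the characters of a compact abelian group -/

section CharMap

variable {K : Type*} [AddCommGroup K] [TopologicalSpace K]

/-- The continuous characters as elements of `C(K, ℂ)`. -/
noncomputable def charMap (χ : {χ : AddChar K Circle // Continuous χ}) : C(K, ℂ) :=
  ⟨fun k => (χ.1 k : ℂ), continuous_subtype_val.comp χ.2⟩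

theorem charMap_apply (χ : {χ : AddChar K Circle // Continuous χ}) (k : K) :
    charMap χ k = (χ.1 k : ℂ) := rfl

end CharMap

section Completeness

variable {K : Type*} [AddCommGroup K] [TopologicalSpace K] [IsTopologicalAddGroup K]
  [CompactSpace K] [MeasurableSpace K] [BorelSpace K]

/-- The orthogonal complement of the eigenvectors is invariant. Were it non-zero, it would contain
an eigenvector, which would be orthogonal to itself. -/
theorem span_common_eigenvectors_dense {H : Type*} [NormedAddCommGroup H] [InnerProductSpace ℂ H]
    [CompleteSpace H] {τ : K → H →ₗᵢ[ℂ] H} (h0 : ∀ ξ, τ 0 ξ = ξ)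
    (hadd : ∀ a b ξ, τ (a + b) ξ = τ a (τ b ξ)) (hcont : ∀ ξ, Continuous fun a => τ a ξ) :
    (Submodule.span ℂ {u | ∀ a, ∃ c : ℂ, τ a u = c • u}).topologicalClosure = ⊤ := by
  set D := Submodule.span ℂ {u | ∀ a, ∃ c : ℂ, τ a u = c • u}
  rw [Submodule.topologicalClosure_eq_top_iff]
  by_contra hne
  have hinv : ∀ a, ∀ ξ ∈ Dᗮ, τ a ξ ∈ Dᗮ := fun a ξ hξ => by
    have : D ≤ (Submodule.span ℂ {τ a ξ})ᗮ := Submodule.span_le.2 fun u hu => by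
      rw [SetLike.mem_coe, Submodule.mem_orthogonal_singleton_iff_inner_left]
      obtain ⟨c, hc⟩ := hu (-a)
      have h1 : inner ℂ u (τ a ξ) = inner ℂ (τ (-a) u) ξ := by
        have h2 := (τ a).inner_map_map (τ (-a) u) ξ
        rwa [← hadd, add_neg_cancel, h0] at h2
      rw [h1, hc, inner_smul_left, Submodule.inner_right_of_mem_orthogonal
        (Submodule.subset_span hu) hξ, mul_zero]
    refine (Submodule.mem_orthogonal D _).2 fun u hu => ?_
    exact Submodule.mem_orthogonal_singleton_iff_inner_left.1 (this hu)
  obtain ⟨E, hEV, hE, hfin, hEinv⟩ := exists_finiteDimensional_invariant h0 hadd hcont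
    D.isClosed_orthogonal hinv hne
  obtain ⟨u, hu, hu0, huc⟩ := exists_common_eigenvector hadd E hE hEinv
  exact hu0 (inner_self_eq_zero.1 (Submodule.inner_right_of_mem_orthogonal
    (show u ∈ D from Submodule.subset_span huc) (hEV hu)))

/-- If every character were trivial at `x`, translation by `x` would fix all eigenvectors of the
regular representation, hence all of `L²(K)`. A Urysohn function that separates `x` from `0` is not
fixed; continuous functions that agree almost everywhere agree, as Haar measure charges open sets.
-/
theorem exists_addChar_ne_one [T2Space K] {x : K} (hx : x ≠ 0) :
    ∃ χ : AddChar K Circle, Continuous χ ∧ χ x ≠ 1 := by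
  by_contra! hcon
  let τ : K → Lp ℂ 2 (normalizedHaar K) →ₗᵢ[ℂ] Lp ℂ 2 (normalizedHaar K) := fun a =>
    Lp.compMeasurePreservingₗᵢ ℂ (fun z => a + z) (measurePreserving_add_left _ a)
  have hτ : ∀ a f, τ a f =ᵐ[normalizedHaar K] fun z => f (a + z) := fun a f =>
    Lp.coeFn_compMeasurePreserving f (measurePreserving_add_left (normalizedHaar K) a)
  have hshift : ∀ a {p : K → Prop}, (∀ᵐ z ∂(normalizedHaar K), p z) →
      ∀ᵐ z ∂(normalizedHaar K), p (a + z) := fun a p h =>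
    (measurePreserving_add_left (normalizedHaar K) a).quasiMeasurePreserving.ae h
  have h0 : ∀ f, τ 0 f = f := fun f => by
    refine Lp.ext ?_
    filter_upwards [hτ 0 f] with z hz
    rw [hz, zero_add]
  have hadd : ∀ a b f, τ (a + b) f = τ a (τ b f) := fun a b f => by
    refine Lp.ext ?_
    filter_upwards [hτ (a + b) f, hτ a (τ b f), hshift a (hτ b f)] with z h1 h2 h3
    rw [h1, h2, h3, add_comm a b, add_assoc]
  have hcont : ∀ f, Continuous fun a => τ a f := fun f => by
    let F : K → C(K, K) := fun a => ⟨fun z => a + z, by fun_prop⟩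
    have hF : Continuous F := ContinuousMap.continuous_of_continuous_uncurry _ (by
      change Continuous fun p : K × K => p.1 + p.2
      fun_prop)
    exact (continuous_const : Continuous fun _ : K => f).compMeasurePreservingLp hF
      (fun a => measurePreserving_add_left (normalizedHaar K) a) (by simp)
  have hfix : ∀ f, τ x f = f := by
    have hle : Submodule.span ℂ {u | ∀ a, ∃ c : ℂ, τ a u = c • u} ≤
        LinearMap.ker ((τ x).toContinuousLinearMap - ContinuousLinearMap.id ℂ _ :
          Lp ℂ 2 (normalizedHaar K) →L[ℂ] Lp ℂ 2 (normalizedHaar K)).toLinearMap :=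
      Submodule.span_le.2 fun u hu => by
        by_cases hu0 : u = 0
        · simp [hu0]
        obtain ⟨χ, hχ, hχu⟩ := exists_addChar_of_eigenvector hadd (hcont u) hu0 hu
        have : τ x u = u := by rw [hχu, hcon χ hχ]; simp
        simp [this]
    have hle' := Submodule.topologicalClosure_minimal _ hle (ContinuousLinearMap.isClosed_ker _)
    rw [span_common_eigenvectors_dense h0 hadd hcont] at hle'
    intro f
    have := hle' (Submodule.mem_top (x := f))
    simpa [sub_eq_zero] using this
  obtain ⟨g, hg0, hg1, -⟩ := exists_continuous_zero_one_of_isClosed (isClosed_singleton (x := x))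
    (isClosed_singleton (x := (0 : K))) (by simpa using hx)
  let f : C(K, ℂ) := ⟨fun z => (g z : ℂ), by fun_prop⟩
  have h1 : (fun z => f (x + z)) =ᵐ[normalizedHaar K] f := by
    have h2 := ContinuousMap.coeFn_toLp (p := 2) (𝕜 := ℂ) (normalizedHaar K) f
    have h3 := hτ x (ContinuousMap.toLp 2 (normalizedHaar K) ℂ f)
    rw [hfix] at h3
    filter_upwards [h2, h3, hshift x h2] with z a1 a2 a3
    rw [← a3, ← a2, a1]
  have h4 : (fun z => f (x + z)) = f :=
    (Continuous.ae_eq_iff_eq (normalizedHaar K) (by fun_prop) f.continuous).1 h1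
  have h5 := congrFun h4 0
  have a0 : g x = 0 := hg0 rfl
  have a1 : g 0 = 1 := hg1 rfl
  simp [f, a0, a1] at h5

theorem integral_addChar_eq_zero {χ : AddChar K Circle} (hne : χ ≠ 1) :
    ∫ k, (χ k : ℂ) ∂(normalizedHaar K) = 0 := by
  obtain ⟨a, ha⟩ : ∃ a, χ a ≠ 1 := by
    by_contra! h
    exact hne (DFunLike.ext _ _ fun a => by rw [h, AddChar.one_apply])
  have h := integral_add_left_eq_self (μ := normalizedHaar K) (fun k => (χ k : ℂ)) a
  simp only [AddChar.map_add_eq_mul, Circle.coe_mul] at h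
  rw [integral_const_mul] at h
  by_contra h0
  exact ha (Circle.ext (by simpa using mul_right_cancel₀ h0 (h.trans (one_mul _).symm)))

/-- Stone-Weierstrass. Products and conjugates of characters are characters, so the star algebra
they generate is just their linear span. -/
theorem span_charMap_closure_eq_top [T2Space K] :
    (Submodule.span ℂ (Set.range (charMap (K := K)))).topologicalClosure = ⊤ := by
  let S : StarSubalgebra ℂ C(K, ℂ) :=
    { toSubalgebra := Algebra.adjoin ℂ (Set.range charMap)
      star_mem' := by
        change Algebra.adjoin ℂ (Set.range charMap) ≤
          star (Algebra.adjoin ℂ (Set.range charMap))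
        refine Algebra.adjoin_le ?_
        rintro - ⟨χ, rfl⟩
        refine Algebra.subset_adjoin ⟨⟨χ.1⁻¹, ?_⟩, ?_⟩
        · have : (⇑χ.1⁻¹ : K → Circle) = fun k => (χ.1 k)⁻¹ :=
            funext fun k => AddChar.inv_apply' _ _
          rw [this]
          exact χ.2.inv
        · ext k
          rw [charMap_apply, AddChar.inv_apply', Circle.coe_inv_eq_conj]
          rfl }
  have hS : Subalgebra.toSubmodule S.toSubalgebra = Submodule.span ℂ (Set.range charMap) := by
    refine Algebra.adjoin_eq_span_of_subset _ (Set.Subset.trans ?_ Submodule.subset_span)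
    intro x hx
    refine Submonoid.closure_induction (fun _ => id) ⟨⟨1, continuous_const⟩, ?_⟩ ?_ hx
    · ext k; simp [charMap_apply]
    · rintro - - - - ⟨χ, rfl⟩ ⟨χ', rfl⟩
      refine ⟨⟨χ.1 * χ'.1, χ.2.mul χ'.2⟩, ?_⟩
      ext k; simp [charMap_apply]
  rw [← hS]
  refine congrArg (Subalgebra.toSubmodule <| StarSubalgebra.toSubalgebra ·)
    (ContinuousMap.starSubalgebra_topologicalClosure_eq_top_of_separatesPoints S ?_)
  intro x y hxy
  obtain ⟨χ, hχ, hne⟩ := exists_addChar_ne_one (sub_ne_zero.2 hxy)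
  refine ⟨_, ⟨charMap ⟨χ, hχ⟩, Algebra.subset_adjoin ⟨_, rfl⟩, rfl⟩, fun h => hne ?_⟩
  have h' : χ x = χ y := Circle.ext h
  rw [AddChar.map_sub_eq_div, h', div_self']

theorem exists_hilbertBasis_charMap [T2Space K] :
    ∃ b : HilbertBasis {χ : AddChar K Circle // Continuous χ} ℂ (Lp ℂ 2 (normalizedHaar K)),
      ⇑b = fun χ => ContinuousMap.toLp 2 (normalizedHaar K) ℂ (charMap χ) := by
  have ho : Orthonormal ℂ fun χ : {χ : AddChar K Circle // Continuous χ} =>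
      ContinuousMap.toLp (E := ℂ) 2 (normalizedHaar K) ℂ (charMap χ) := by
    classical
    rw [orthonormal_iff_ite]
    intro χ χ'
    rw [ContinuousMap.inner_toLp]
    have e : ∀ k, charMap χ' k * (starRingEnd ℂ) (charMap χ k) = ((χ'.1 * χ.1⁻¹) k : ℂ) :=
      fun k => by
        rw [AddChar.mul_apply, AddChar.inv_apply', Circle.coe_mul, Circle.coe_inv_eq_conj]
        rfl
    simp only [e]
    split_ifs with h
    · simp [h]
    · refine integral_addChar_eq_zero fun h1 => h ?_
      exact Subtype.ext (mul_inv_eq_one.1 h1).symm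
  refine ⟨HilbertBasis.mk ho ?_, HilbertBasis.coe_mk _ _⟩
  have h := (ContinuousMap.toLp_denseRange ℂ (normalizedHaar K) ℂ
    (p := 2) (by simp)).topologicalClosure_map_submodule span_charMap_closure_eq_top
  rw [Submodule.map_span, ← Set.range_comp] at h
  exact h.ge

theorem tsum_enorm_integral_char_sq [T2Space K] {h : K → ℂ} (hh : MemLp h 2 (normalizedHaar K)) :
    ∑' χ : {χ : AddChar K Circle // Continuous χ},
      ‖∫ k, h k * (χ.1 k : ℂ) ∂(normalizedHaar K)‖ₑ ^ 2 = ∫⁻ k, ‖h k‖ₑ ^ 2 ∂(normalizedHaar K) := by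
  obtain ⟨b, hb⟩ := exists_hilbertBasis_charMap (K := K)
  rw [← tsum_enorm_integral_mul_basis b hh]
  refine tsum_congr fun χ => ?_
  congr 2
  refine integral_congr_ae ?_
  rw [hb]
  filter_upwards [ContinuousMap.coeFn_toLp (p := 2) (𝕜 := ℂ) (normalizedHaar K) (charMap χ)]
    with k hk
  rw [hk, charMap_apply]

variable {Y : Type*} [MeasurableSpace Y] {ν : Measure Y}

theorem memLp_integral_char [T2Space K] {f : Y × K → ℂ}
    (hf : MemLp f 2 (ν.prod (normalizedHaar K))) (χ : {χ : AddChar K Circle // Continuous χ}) :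
    MemLp (fun y => ∫ k, f (y, k) * (χ.1 k : ℂ) ∂(normalizedHaar K)) 2 ν := by
  have hχm : AEStronglyMeasurable (fun p : Y × K => (χ.1 p.2 : ℂ)) (ν.prod (normalizedHaar K)) :=
    (charMap χ).continuous.aestronglyMeasurable.comp_snd
  have hfin := (memLp_two_iff_lintegral hf.1).1 hf
  refine (memLp_two_iff_lintegral (hf.1.mul hχm).integral_prod_right').2 ?_
  refine lt_of_le_of_lt ?_ hfin
  rw [lintegral_prod _ (hf.1.enorm.pow_const 2)] at hfin ⊢
  refine lintegral_mono_ae ?_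
  filter_upwards [hf.1.prodMk_left,
    ae_lt_top' (hf.1.enorm.pow_const 2).lintegral_prod_right' hfin.ne] with y h1 h2
  rw [← tsum_enorm_integral_char_sq ((memLp_two_iff_lintegral h1).2 h2)]
  exact ENNReal.le_tsum (f := fun χ : {χ : AddChar K Circle // Continuous χ} =>
    ‖∫ k, f (y, k) * (χ.1 k : ℂ) ∂(normalizedHaar K)‖ₑ ^ 2) χ

/-- Parseval's identity for square integrable functions with values in a separable `L²`. -/
theorem tsum_lintegral_integral_char_sq [SFinite ν] [T2Space K]
    [TopologicalSpace.SeparableSpace (Lp ℂ 2 ν)] {f : Y × K → ℂ}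
    (hf : MemLp f 2 (ν.prod (normalizedHaar K))) :
    ∑' χ : {χ : AddChar K Circle // Continuous χ},
      ∫⁻ y, ‖∫ k, f (y, k) * (χ.1 k : ℂ) ∂(normalizedHaar K)‖ₑ ^ 2 ∂ν
      = ∫⁻ p, ‖f p‖ₑ ^ 2 ∂(ν.prod (normalizedHaar K)) := by
  obtain ⟨w, b, -⟩ := exists_hilbertBasis ℂ (Lp ℂ 2 ν)
  have : Countable w := b.countable
  have hswap : MemLp (fun p : K × Y => f (p.2, p.1)) 2 ((normalizedHaar K).prod ν) :=
    hf.comp_measurePreserving Measure.measurePreserving_swap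
  have hfin := (memLp_two_iff_lintegral hf.1).1 hf
  have hslice := tsum_lintegral_integral_mul_basis b hswap
  have hrhs : ∫⁻ p : K × Y, ‖f (p.2, p.1)‖ₑ ^ 2 ∂((normalizedHaar K).prod ν)
      = ∫⁻ p, ‖f p‖ₑ ^ 2 ∂(ν.prod (normalizedHaar K)) :=
    lintegral_prod_swap (fun p : Y × K => ‖f p‖ₑ ^ 2)
  rw [hrhs] at hslice
  have hFm : ∀ n, AEStronglyMeasurable (fun k => ∫ y, f (y, k) * b n y ∂ν) (normalizedHaar K) :=
    fun n => (hswap.1.mul (Lp.aestronglyMeasurable (b n)).comp_snd).integral_prod_right'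
  have hF : ∀ n, MemLp (fun k => ∫ y, f (y, k) * b n y ∂ν) 2 (normalizedHaar K) := fun n => by
    rw [memLp_two_iff_lintegral (hFm n)]
    refine lt_of_le_of_lt ?_ (hslice ▸ hfin)
    exact ENNReal.le_tsum (f := fun i => ∫⁻ k, ‖∫ y, f (y, k) * b i y ∂ν‖ₑ ^ 2
      ∂(normalizedHaar K)) n
  have hχm : ∀ χ : {χ : AddChar K Circle // Continuous χ},
      AEStronglyMeasurable (fun p : Y × K => (χ.1 p.2 : ℂ)) (ν.prod (normalizedHaar K)) := fun χ =>
    (charMap χ).continuous.aestronglyMeasurable.comp_snd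
  have hG := fun χ : {χ : AddChar K Circle // Continuous χ} => memLp_integral_char hf χ
  have hfub : ∀ (χ : {χ : AddChar K Circle // Continuous χ}) (n : w),
      ∫ y, (∫ k, f (y, k) * (χ.1 k : ℂ) ∂(normalizedHaar K)) * b n y ∂ν
        = ∫ k, (∫ y, f (y, k) * b n y ∂ν) * (χ.1 k : ℂ) ∂(normalizedHaar K) := fun χ n => by
    have hb : MemLp (fun p : Y × K => b n p.1) 2 (ν.prod (normalizedHaar K)) :=
      (Lp.memLp (b n)).comp_measurePreserving measurePreserving_fst
    have hi : Integrable (fun p : Y × K => (f p * b n p.1) * (χ.1 p.2 : ℂ))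
        (ν.prod (normalizedHaar K)) :=
      (hf.integrable_mul hb).mul_bdd (c := 1) (hχm χ)
        (Filter.Eventually.of_forall fun p => (Circle.norm_coe _).le)
    simp only [← integral_mul_const]
    rw [← integral_integral_swap (f := fun y k => f (y, k) * b n y * (χ.1 k : ℂ)) hi]
    refine integral_congr_ae (Filter.Eventually.of_forall fun y =>
      integral_congr_ae (Filter.Eventually.of_forall fun k => ?_))
    simp only
    ring
  -- There may be uncountably many characters, so their sum is not moved under an integral over `Y`.
  -- Expansion in the countable basis `b` of `L²(Y)` replaces that integral by a sum, sums are
  -- exchanged, and Parseval on `K` applies to each coefficient function.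
  calc _ = ∑' (χ : {χ : AddChar K Circle // Continuous χ}) (n : w),
        ‖∫ k, (∫ y, f (y, k) * b n y ∂ν) * (χ.1 k : ℂ) ∂(normalizedHaar K)‖ₑ ^ 2 :=
        tsum_congr fun χ => by
          rw [← tsum_enorm_integral_mul_basis b (hG χ)]
          simp only [hfub]
    _ = ∑' n, ∫⁻ k, ‖∫ y, f (y, k) * b n y ∂ν‖ₑ ^ 2 ∂(normalizedHaar K) := by
        rw [ENNReal.tsum_comm]
        exact tsum_congr fun n => tsum_enorm_integral_char_sq (hF n)
    _ = _ := hslice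

end Completeness

/-! ## Unitary representations: Schur's lemma and cyclic vectors -/

section UnitaryRepGeneral

variable {G : Type*} [Group G] [TopologicalSpace G]
  {H : Type*} [NormedAddCommGroup H] [InnerProductSpace ℂ H]
  {H' : Type*} [NormedAddCommGroup H'] [InnerProductSpace ℂ H']
  {H'' : Type*} [NormedAddCommGroup H''] [InnerProductSpace ℂ H'']

namespace UnitaryRep

theorem IsEquivalent.symm {π : UnitaryRep G H} {σ : UnitaryRep G H'} (h : π.IsEquivalent σ) :
    σ.IsEquivalent π := by
  obtain ⟨U, hU⟩ := h
  refine ⟨U.symm, fun g ξ => ?_⟩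
  rw [LinearIsometryEquiv.symm_apply_eq, hU, LinearIsometryEquiv.apply_symm_apply]

theorem IsEquivalent.trans {π : UnitaryRep G H} {σ : UnitaryRep G H'} {ρ : UnitaryRep G H''}
    (h : π.IsEquivalent σ) (h' : σ.IsEquivalent ρ) : π.IsEquivalent ρ := by
  obtain ⟨U, hU⟩ := h
  obtain ⟨V, hV⟩ := h'
  exact ⟨U.trans V, fun g ξ => by simp [hU, hV]⟩

theorem toHom_mul_apply (π : UnitaryRep G H) (g h : G) (ξ : H) :
    π.toHom (g * h) ξ = π.toHom g (π.toHom h ξ) := by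
  rw [map_mul]; rfl

theorem toHom_one_apply (π : UnitaryRep G H) (ξ : H) : π.toHom 1 ξ = ξ := by
  rw [map_one]; rfl

theorem toHom_inv_apply_apply (π : UnitaryRep G H) (g : G) (ξ : H) :
    π.toHom g⁻¹ (π.toHom g ξ) = ξ := by
  rw [← toHom_mul_apply, inv_mul_cancel, toHom_one_apply]

theorem inner_toHom_left (π : UnitaryRep G H) (g : G) (ξ η : H) :
    inner ℂ (π.toHom g ξ) η = inner ℂ ξ (π.toHom g⁻¹ η) := by
  rw [← (π.toHom g⁻¹).inner_map_map, toHom_inv_apply_apply]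

/-- Schur's lemma for operators of the representation. -/
theorem IsIrreducible.exists_smul [CompleteSpace H] {π : UnitaryRep G H} (hπ : π.IsIrreducible)
    {z : G} (hz : ∀ g ξ, π.toHom z (π.toHom g ξ) = π.toHom g (π.toHom z ξ)) :
    ∃ c : ℂ, ∀ ξ, π.toHom z ξ = c • ξ := by
  have := hπ.1
  let op : G → H →L[ℂ] H := fun g => ((π.toHom g).toContinuousLinearEquiv : H →L[ℂ] H)
  have hstar : ∀ g, star (op g) = op g⁻¹ := fun g => by
    refine ((ContinuousLinearMap.eq_adjoint_iff _ _).2 fun ξ η => ?_).symm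
    change inner ℂ (π.toHom g⁻¹ ξ) η = inner ℂ ξ (π.toHom g η)
    rw [inner_toHom_left, inv_inv]
  have hmul : ∀ g h, op g * op h = op (g * h) := fun g h => by
    ext ξ
    exact (π.toHom_mul_apply g h ξ).symm
  have hcomm : ∀ g, Commute (op z) (op g) := fun g => by
    ext ξ
    exact hz g ξ
  -- The functional calculus of a normal operator also involves its adjoint. Adjoints of group
  -- operators are again group operators, so commutation passes to `star (op z)`.
  have hcomm' : ∀ g, Commute (star (op z)) (op g) := fun g => by
    have h := (hcomm g⁻¹).star_star
    rwa [hstar g⁻¹, inv_inv] at h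
  have hnormal : IsStarNormal (op z) := ⟨by
    rw [hstar, commute_iff_eq, hmul, hmul, inv_mul_cancel, mul_inv_cancel]⟩
  suffices h : ∃ c : ℂ, spectrum ℂ (op z) ⊆ {c} by
    obtain ⟨c, hc⟩ := h
    refine ⟨c, fun ξ => ?_⟩
    have h1 := CFC.eq_algebraMap_of_spectrum_subset_singleton (p := IsStarNormal) (op z) c hc
    exact congrArg (fun T : H →L[ℂ] H => T ξ) h1
  by_contra! hcon
  obtain ⟨a, ha⟩ := spectrum.nonempty (op z)
  obtain ⟨b, hb, hab⟩ : ∃ b ∈ spectrum ℂ (op z), b ≠ a := by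
    by_contra! h
    exact hcon a fun b hb => h b hb
  -- With this radius the tent functions at `a` and `b` have product zero, while neither vanishes on
  -- the spectrum. The kernel of the first function of `op z` is then invariant, not everything, and
  -- contains the non-zero range of the second, against irreducibility.
  set r := dist a b / 2 with hr
  have hr0 : 0 < r := half_pos (dist_pos.2 hab.symm)
  let bump : ℂ → ℂ → ℂ := fun c w => ((max 0 (r - dist w c) : ℝ) : ℂ)
  have hbc : ∀ c, Continuous (bump c) := fun c => by
    change Continuous fun w => ((max 0 (r - dist w c) : ℝ) : ℂ)
    fun_prop
  have hne : ∀ c ∈ spectrum ℂ (op z), cfc (bump c) (op z) ≠ 0 := fun c hc h0 => by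
    have h1 := cfc_map_spectrum (bump c) (op z) hnormal (hbc c).continuousOn
    rw [h0, spectrum.zero_eq] at h1
    have h2 : bump c c ∈ ({0} : Set ℂ) := h1 ▸ Set.mem_image_of_mem _ hc
    have h3 : bump c c = (r : ℂ) := by
      simp only [bump, dist_self, sub_zero, max_eq_right hr0.le]
    rw [h3] at h2
    exact hr0.ne' (Complex.ofReal_eq_zero.1 h2)
  have hprod : cfc (bump a) (op z) * cfc (bump b) (op z) = 0 := by
    rw [← cfc_mul (bump a) (bump b) (op z) (hbc a).continuousOn (hbc b).continuousOn]
    have : (fun w => bump a w * bump b w) = fun _ => 0 := funext fun w => by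
      have htri := dist_triangle_left a b w
      simp only [bump]
      rw [← Complex.ofReal_mul]
      rcases le_total r (dist w a) with h | h
      · rw [max_eq_left (by linarith)]; simp
      · rw [max_eq_left (b := r - dist w b) (by linarith)]; simp
    rw [this]
    exact cfc_const_zero ℂ (op z)
  let W : Submodule ℂ H := LinearMap.ker (cfc (bump a) (op z) : H →L[ℂ] H).toLinearMap
  have hW : ∀ ξ, ξ ∈ W ↔ (cfc (bump a) (op z) : H →L[ℂ] H) ξ = 0 := fun ξ => Iff.rfl
  rcases hπ.2 W (ContinuousLinearMap.isClosed_ker _) (fun g ξ hξ => by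
    have h1 := (hcomm g).cfc (hcomm' g) (bump a)
    have h2 : (cfc (bump a) (op z) * op g) ξ = (op g * cfc (bump a) (op z)) ξ := by rw [h1.eq]
    rw [hW]
    change (cfc (bump a) (op z) * op g) ξ = 0
    rw [h2]
    change op g ((cfc (bump a) (op z) : H →L[ℂ] H) ξ) = 0
    rw [(hW ξ).1 hξ, map_zero]) with h | h
  · refine hne b hb (ContinuousLinearMap.ext fun ξ => ?_)
    have h1 : (cfc (bump b) (op z) : H →L[ℂ] H) ξ ∈ W :=
      congrArg (fun T : H →L[ℂ] H => T ξ) hprod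
    rw [h] at h1
    exact h1
  · refine hne a ha (ContinuousLinearMap.ext fun ξ => ?_)
    exact (hW ξ).1 (h ▸ Submodule.mem_top)

theorem IsIrreducible.denseRange_linearCombination {π : UnitaryRep G H} (hπ : π.IsIrreducible)
    {v : H} (hv : v ≠ 0) : DenseRange (Finsupp.linearCombination ℂ fun g => π.toHom g v) := by
  set T := Finsupp.linearCombination ℂ fun g => π.toHom g v with hT
  have hmem : ∀ g, π.toHom g v ∈ LinearMap.range T := fun g =>
    ⟨Finsupp.single g 1, by simp [hT]⟩
  have hinv : ∀ g, ∀ ξ ∈ LinearMap.range T, π.toHom g ξ ∈ LinearMap.range T := by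
    rintro g - ⟨f, rfl⟩
    rw [hT, Finsupp.linearCombination_apply, Finsupp.sum, map_sum]
    refine Submodule.sum_mem _ fun h _ => ?_
    rw [map_smul, ← toHom_mul_apply]
    exact Submodule.smul_mem _ _ (hmem _)
  rcases hπ.2 (LinearMap.range T).topologicalClosure
    (Submodule.isClosed_topologicalClosure _) (fun g ξ hξ => by
      have h1 : Set.MapsTo (π.toHom g) (LinearMap.range T : Set H) (LinearMap.range T) := hinv g
      exact map_mem_closure (π.toHom g).continuous hξ h1) with h | h
  · refine absurd ?_ hv
    have h1 := Submodule.le_topologicalClosure _ (hmem 1)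
    rw [h, toHom_one_apply] at h1
    exact h1
  · have h1 : Dense (LinearMap.range T : Set H) := by
      rw [dense_iff_closure_eq, ← Submodule.topologicalClosure_coe, h, Submodule.top_coe]
    exact h1

/-- Irreducible representations with a common matrix coefficient are equivalent. -/
theorem IsIrreducible.isEquivalent_of_inner_eq [CompleteSpace H] [CompleteSpace H']
    {π : UnitaryRep G H} {σ : UnitaryRep G H'} (hπ : π.IsIrreducible) (hσ : σ.IsIrreducible)
    {v : H} {w : H'} (hv : v ≠ 0)
    (h : ∀ g, inner ℂ v (π.toHom g v) = inner ℂ w (σ.toHom g w)) : π.IsEquivalent σ := by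
  have hw : w ≠ 0 := fun hw => hv (by
    have h1 := h 1
    rwa [toHom_one_apply, hw, inner_zero_left, inner_self_eq_zero] at h1)
  set T := Finsupp.linearCombination ℂ fun g => π.toHom g v with hT
  set S := Finsupp.linearCombination ℂ fun g => σ.toHom g w with hS
  -- The Gram matrix of an orbit has entries `⟨v, π(g⁻¹ h) v⟩`, so it is determined by the matrix
  -- coefficient. Matching the orbits is therefore isometric on formal combinations and extends to
  -- the dense spans.
  have hinner : ∀ f, inner ℂ (S f) (S f) = inner ℂ (T f) (T f) := fun f => by
    simp only [hT, hS, Finsupp.linearCombination_apply, Finsupp.sum, sum_inner, inner_sum,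
      inner_smul_left, inner_smul_right, inner_toHom_left, ← toHom_mul_apply, h]
  have hnorm : ∀ f, ‖S (LinearEquiv.refl ℂ (G →₀ ℂ) f)‖ = ‖T f‖ := fun f => by
    rw [LinearEquiv.refl_apply, @norm_eq_sqrt_re_inner ℂ, hinner, ← @norm_eq_sqrt_re_inner ℂ]
  have hTd := hπ.denseRange_linearCombination hv
  let U := (LinearEquiv.refl ℂ (G →₀ ℂ)).extendOfIsometry T S hTd
    (hσ.denseRange_linearCombination hw) hnorm
  have hU : ∀ f, U (T f) = S f := LinearEquiv.extendOfIsometry_eq _ _ _ hTd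
    (hσ.denseRange_linearCombination hw) hnorm
  refine ⟨U, fun g ξ => ?_⟩
  refine hTd.induction_on (p := fun ξ => U (π.toHom g ξ) = σ.toHom g (U ξ)) ξ
    (isClosed_eq (by fun_prop) (by fun_prop)) fun f => ?_
  have hshiftT : π.toHom g (T f) = T (f.mapDomain (g * ·)) := by
    rw [hT, Finsupp.linearCombination_mapDomain, Finsupp.linearCombination_apply,
      Finsupp.linearCombination_apply, Finsupp.sum, Finsupp.sum, map_sum]
    simp only [Function.comp_apply, toHom_mul_apply, map_smul]
  have hshiftS : σ.toHom g (S f) = S (f.mapDomain (g * ·)) := by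
    rw [hS, Finsupp.linearCombination_mapDomain, Finsupp.linearCombination_apply,
      Finsupp.linearCombination_apply, Finsupp.sum, Finsupp.sum, map_sum]
    simp only [Function.comp_apply, toHom_mul_apply, map_smul]
  rw [hshiftT, hU, hU, hshiftS]

end UnitaryRep

end UnitaryRepGeneral

/-! ## Continuous characters of the real line -/

/-- From `f(s) ∫₀ᵃ f = ∫ₛ^{s+a} f`, with `a` chosen so that `∫₀ᵃ f ≠ 0`, the character is
differentiable and satisfies `f' = c f`. Hence `f = exp (c s)`, and modulus one makes `c` purely
imaginary. -/
theorem exists_forall_addChar_real_eq {χ : AddChar ℝ Circle} (hχ : Continuous χ) :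
    ∃ t : ℝ, ∀ z, χ z = Circle.exp (t * z) := by
  set f : ℝ → ℂ := fun z => (χ z : ℂ) with hf
  have hfc : Continuous f := continuous_subtype_val.comp hχ
  have hadd : ∀ a b, f (a + b) = f a * f b := fun a b => by
    simp only [hf, AddChar.map_add_eq_mul, Circle.coe_mul]
  have hf0 : f 0 = 1 := by simp [hf]
  let F : ℝ → ℂ := fun x => ∫ u in (0 : ℝ)..x, f u
  have hF : ∀ x, HasDerivAt F (f x) x := fun x =>
    intervalIntegral.integral_hasDerivAt_right (hfc.intervalIntegrable _ _)
      (hfc.stronglyMeasurableAtFilter _ _) hfc.continuousAt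
  obtain ⟨a, ha⟩ : ∃ a, F a ≠ 0 := by
    by_contra! h
    have h1 : F = fun _ => 0 := funext h
    have h2 := (hF 0).unique (h1 ▸ hasDerivAt_const (0 : ℝ) (0 : ℂ))
    rw [hf0] at h2
    exact one_ne_zero h2
  have hfF : ∀ s, f s = (F (s + a) - F s) / F a := fun s => by
    rw [eq_div_iff ha]
    simp only [F]
    rw [intervalIntegral.integral_interval_sub_left (hfc.intervalIntegrable _ _)
      (hfc.intervalIntegrable _ _), ← intervalIntegral.integral_const_mul]
    simp only [← hadd]
    rw [intervalIntegral.integral_comp_add_left (fun u => f u), add_zero]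
  set c : ℂ := (f a - 1) / F a with hc
  have hderiv : ∀ s, HasDerivAt f (c * f s) s := fun s => by
    have h1 := (((hF (s + a)).comp_add_const s a).sub (hF s)).div_const (F a)
    have h3 : (f (s + a) - f s) / F a = c * f s := by
      rw [hadd, hc]; ring
    rw [← h3]
    exact h1.congr_of_eventuallyEq (Filter.Eventually.of_forall hfF)
  have hexp : ∀ s : ℝ, HasDerivAt (fun s : ℝ => Complex.exp (-(c * s)))
      (-c * Complex.exp (-(c * s))) s :=
    fun s => by
      have h1 : HasDerivAt (fun s : ℝ => -(c * (s : ℂ))) (-c) s := by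
        have := ((Complex.ofRealCLM.hasDerivAt (x := s)).const_mul c).neg
        rw [Complex.ofRealCLM_apply, Complex.ofReal_one, mul_one] at this
        exact this
      simpa [mul_comm] using h1.cexp
  have hconst : ∀ s, f s * Complex.exp (-(c * s)) = 1 := fun s => by
    have h1 : ∀ s : ℝ, HasDerivAt (fun s : ℝ => f s * Complex.exp (-(c * s))) 0 s := fun s => by
      have := (hderiv s).mul (hexp s)
      have h3 : c * f s * Complex.exp (-(c * s)) + f s * (-c * Complex.exp (-(c * s))) = 0 := by
        ring
      rw [h3] at this
      exact this
    have h2 := is_const_of_deriv_eq_zero (fun s => (h1 s).differentiableAt)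
      (fun s => (h1 s).deriv) s 0
    simpa [hf0] using h2
  have hfe : ∀ s, f s = Complex.exp (c * s) := fun s => by
    have := hconst s
    rw [Complex.exp_neg, mul_inv_eq_one₀ (Complex.exp_ne_zero _)] at this
    exact this
  have hre : c.re = 0 := by
    have h1 : ‖f 1‖ = 1 := Circle.norm_coe _
    rw [hfe, Complex.norm_exp] at h1
    simpa using h1
  refine ⟨c.im, fun z => Circle.ext ?_⟩
  change f z = _
  rw [hfe, Circle.coe_exp]
  congr 1
  apply Complex.ext <;> simp [hre]

/-! ## The Stone-von Neumann theorem -/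

section StoneVonNeumann

/-- The complex conjugate of the matrix coefficient of the Gaussian vacuum vector. -/
noncomputable def vacuumKernel (p : ℝ × ℝ) : ℂ :=
  Complex.exp (-((p.1 : ℂ) ^ 2 + (p.2 : ℂ) ^ 2) / 4 + Complex.I * p.1 * p.2 / 2)

theorem vacuumKernel_zero : vacuumKernel 0 = 1 := by simp [vacuumKernel]

theorem continuous_vacuumKernel : Continuous vacuumKernel := by
  unfold vacuumKernel
  fun_prop

theorem norm_vacuumKernel (p : ℝ × ℝ) :
    ‖vacuumKernel p‖ = Real.exp (-(1 / 4) * p.1 ^ 2) * Real.exp (-(1 / 4) * p.2 ^ 2) := by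
  have e : (-((p.1 : ℂ) ^ 2 + (p.2 : ℂ) ^ 2) / 4 + Complex.I * p.1 * p.2 / 2)
      = ((-(1 / 4) * p.1 ^ 2 + -(1 / 4) * p.2 ^ 2 : ℝ) : ℂ)
        + ((p.1 * p.2 / 2 : ℝ) : ℂ) * Complex.I := by
    push_cast; ring
  rw [vacuumKernel, Complex.norm_exp, e, Complex.add_re, Complex.re_ofReal_mul, Complex.I_re,
    mul_zero, add_zero, Complex.ofReal_re, Real.exp_add]

theorem integrable_vacuumKernel : Integrable vacuumKernel := by
  have h := (integrable_exp_neg_mul_sq (b := 1 / 4) (by norm_num)).mul_prod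
    (integrable_exp_neg_mul_sq (b := 1 / 4) (by norm_num))
  refine h.mono' continuous_vacuumKernel.aestronglyMeasurable
    (Filter.Eventually.of_forall fun p => ?_)
  rw [norm_vacuumKernel]

theorem memLp_vacuumKernel : MemLp vacuumKernel 2 := by
  rw [memLp_two_iff_integrable_sq_norm continuous_vacuumKernel.aestronglyMeasurable]
  have h := (integrable_exp_neg_mul_sq (b := 1 / 2) (by norm_num)).mul_prod
    (integrable_exp_neg_mul_sq (b := 1 / 2) (by norm_num))
  refine h.congr (Filter.Eventually.of_forall fun p => ?_)
  simp only [norm_vacuumKernel]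
  rw [mul_pow, ← Real.exp_nat_mul, ← Real.exp_nat_mul]
  congr 2 <;> (push_cast; ring)

theorem integral_exp_neg_half_sq (c : ℂ) :
    ∫ x : ℝ, Complex.exp (-(x : ℂ) ^ 2 / 2 + c * x)
      = (2 * Real.pi : ℂ) ^ (1 / 2 : ℂ) * Complex.exp (c ^ 2 / 2) := by
  have h := integral_cexp_quadratic (b := -(1 / 2)) (by norm_num) c 0
  have e1 : (Real.pi : ℂ) / -(-(1 / 2)) = 2 * Real.pi := by ring
  have e2 : (0 : ℂ) - c ^ 2 / (4 * -(1 / 2)) = c ^ 2 / 2 := by ring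
  rw [e1, e2] at h
  rw [← h]
  congr 1
  ext x
  congr 1
  ring

/-- The twisted convolution identity of the Gaussian; it becomes the relation `P W(w) P = 2π
conj(κ(w)) P` below. -/
theorem integral_vacuumKernel_mul (v w : ℝ × ℝ) :
    ∫ p : ℝ × ℝ, vacuumKernel p * vacuumKernel (v - p - w) *
      (Circle.exp (p.2 * w.1 + (p.2 + w.2) * (v.1 - p.1 - w.1)) : ℂ)
      = 2 * Real.pi * (starRingEnd ℂ) (vacuumKernel w) * vacuumKernel v := by
  -- The exponent is quadratic in `p`. The mixed terms `p.1 * p.2` from the two kernels cancel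
  -- against the one from the phase, which leaves two independent Gaussians: `A` and `B` are the
  -- coefficients of `p.1` and `p.2`, and `C` is the constant term.
  set P : ℂ := v.1 - w.1 with hP
  set Q : ℂ := v.2 - w.2 with hQ
  set A : ℂ := (P - Complex.I * Q) / 2 - Complex.I * w.2 with hA
  set B : ℂ := (Q + Complex.I * P) / 2 + Complex.I * w.1 with hB
  set C : ℂ := -P ^ 2 / 4 - Q ^ 2 / 4 + Complex.I * P * Q / 2 + Complex.I * w.2 * P with hC
  have e : ∀ p : ℝ × ℝ, vacuumKernel p * vacuumKernel (v - p - w) *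
      (Circle.exp (p.2 * w.1 + (p.2 + w.2) * (v.1 - p.1 - w.1)) : ℂ)
      = Complex.exp C * (Complex.exp (-(p.1 : ℂ) ^ 2 / 2 + A * p.1) *
        Complex.exp (-(p.2 : ℂ) ^ 2 / 2 + B * p.2)) := fun p => by
    rw [vacuumKernel, vacuumKernel, Circle.coe_exp, ← Complex.exp_add, ← Complex.exp_add,
      ← Complex.exp_add, ← Complex.exp_add]
    congr 1
    simp only [Prod.fst_sub, Prod.snd_sub, hC, hA, hB, hP, hQ]
    push_cast
    ring_nf
  simp only [e]
  rw [integral_const_mul, Measure.volume_eq_prod,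
    integral_prod_mul (fun x : ℝ => Complex.exp (-(x : ℂ) ^ 2 / 2 + A * x))
      (fun x : ℝ => Complex.exp (-(x : ℂ) ^ 2 / 2 + B * x)),
    integral_exp_neg_half_sq, integral_exp_neg_half_sq]
  have hpi : (2 * Real.pi : ℂ) ^ (1 / 2 : ℂ) * (2 * Real.pi : ℂ) ^ (1 / 2 : ℂ) = 2 * Real.pi := by
    rw [← Complex.cpow_add _ _ (by simp [Real.pi_ne_zero])]
    norm_num
  have e2 : Complex.exp C * (Complex.exp (A ^ 2 / 2) * Complex.exp (B ^ 2 / 2))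
      = (starRingEnd ℂ) (vacuumKernel w) * vacuumKernel v := by
    rw [vacuumKernel, vacuumKernel, ← Complex.exp_conj, ← Complex.exp_add, ← Complex.exp_add,
      ← Complex.exp_add]
    congr 1
    simp only [map_add, map_div₀, map_neg, map_mul, map_pow, Complex.conj_ofReal, Complex.conj_I,
      map_ofNat, hC, hA, hB, hP, hQ]
    ring_nf
    simp only [Complex.I_sq]
    ring
  rw [show ∀ a b c d : ℂ, a * (b * c * (b * d)) = (b * b) * (a * (c * d)) from
    fun a b c d => by ring, hpi, e2]
  ring

variable {H : Type*} [NormedAddCommGroup H] [InnerProductSpace ℂ H] {W : ℝ × ℝ → H →ₗᵢ[ℂ] H}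

theorem integrable_vacuumKernel_smul (hcont : ∀ ξ, Continuous fun p => W p ξ) (ξ : H) :
    Integrable fun p => vacuumKernel p • W p ξ := by
  refine (integrable_vacuumKernel.norm.mul_const ‖ξ‖).mono'
    (continuous_vacuumKernel.smul (hcont ξ)).aestronglyMeasurable
    (Filter.Eventually.of_forall fun p => ?_)
  rw [norm_smul, LinearIsometry.norm_map]

theorem weyl_zero (hmul : ∀ p q ξ, W p (W q ξ) = (Circle.exp (p.2 * q.1) : ℂ) • W (p + q) ξ)
    (ξ : H) : W 0 ξ = ξ := by
  have h := hmul 0 0 ξ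
  simp only [Prod.snd_zero, Prod.fst_zero, mul_zero, Circle.exp_zero, Circle.coe_one, one_smul,
    add_zero] at h
  exact (W 0).injective h

variable [CompleteSpace H]

/-- With `P = ∫ κ(q) W(q) dq` this reads `P W(w) P = 2π conj(κ(w)) P`. The Weyl relations combine
the three operators into `W v` with `v = p + w + q`, and the `p`-integral is the Gaussian one above.
-/
theorem integral_vacuumKernel_weyl_integral
    (hmul : ∀ p q ξ, W p (W q ξ) = (Circle.exp (p.2 * q.1) : ℂ) • W (p + q) ξ)
    (hcont : ∀ ξ, Continuous fun p => W p ξ) (w : ℝ × ℝ) (ξ : H) :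
    ∫ p, vacuumKernel p • W p (W w (∫ q, vacuumKernel q • W q ξ))
      = (2 * Real.pi * (starRingEnd ℂ) (vacuumKernel w)) • ∫ q, vacuumKernel q • W q ξ := by
  have h1 : ∀ p, vacuumKernel p • W p (W w (∫ q, vacuumKernel q • W q ξ))
      = ∫ v, (vacuumKernel p * vacuumKernel (v - p - w) *
        (Circle.exp (p.2 * w.1 + (p.2 + w.2) * (v.1 - p.1 - w.1)) : ℂ)) • W v ξ := fun p => by
    have e : W p (W w (∫ q, vacuumKernel q • W q ξ))
        = ∫ q, W p (W w (vacuumKernel q • W q ξ)) :=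
      (((W p).comp (W w)).toContinuousLinearMap.integral_comp_comm
        (integrable_vacuumKernel_smul hcont ξ)).symm
    rw [e, ← integral_smul, ← integral_sub_right_eq_self _ (p + w)]
    refine integral_congr_ae (Filter.Eventually.of_forall fun v => ?_)
    simp only [map_smul, hmul]
    rw [show p + (w + (v - (p + w))) = v by abel, show v - (p + w) = v - p - w by abel]
    simp only [smul_smul]
    congr 1
    rw [mul_assoc, ← Circle.coe_mul, ← Circle.exp_add]
    congr 4
    simp only [Prod.fst_sub, Prod.fst_add]
    ring
  simp only [h1]
  rw [integral_integral_swap]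
  · rw [← integral_smul]
    refine integral_congr_ae (Filter.Eventually.of_forall fun v => ?_)
    simp only
    rw [integral_smul_const, integral_vacuumKernel_mul, smul_smul]
  · have hi : Integrable (fun z : (ℝ × ℝ) × (ℝ × ℝ) => vacuumKernel z.1 * vacuumKernel (z.2 - w))
        (volume.prod volume) :=
      integrable_vacuumKernel.mul_prod (integrable_vacuumKernel.comp_sub_right w)
    have hi2 := (measurePreserving_prod_neg_add (volume : Measure (ℝ × ℝ))
      (volume : Measure (ℝ × ℝ))).integrable_comp_of_integrable hi
    refine (hi2.norm.mul_const ‖ξ‖).mono' (Continuous.aestronglyMeasurable ?_)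
      (Filter.Eventually.of_forall fun z => ?_)
    · have h3 := (hcont ξ).comp (continuous_snd (X := ℝ × ℝ) (Y := ℝ × ℝ))
      have h4 := continuous_vacuumKernel
      have h5 : Continuous fun z : (ℝ × ℝ) × (ℝ × ℝ) => vacuumKernel z.1 *
          vacuumKernel (z.2 - z.1 - w) * (Circle.exp (z.1.2 * w.1 + (z.1.2 + w.2) *
            (z.2.1 - z.1.1 - w.1)) : ℂ) := by fun_prop
      exact h5.smul h3
    · simp only [Function.uncurry, norm_smul, norm_mul, Circle.norm_coe, mul_one,
        LinearIsometry.norm_map, Function.comp_apply]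
      rw [neg_add_eq_sub]

/-- Self-adjointness of `P`: the adjoint of `W(p)` is `W(-p)` up to the phase `exp (i p₁ p₂)`, and
`conj κ(-p)` times this phase is `κ(p)`. -/
theorem inner_integral_vacuumKernel
    (hmul : ∀ p q ξ, W p (W q ξ) = (Circle.exp (p.2 * q.1) : ℂ) • W (p + q) ξ)
    (hcont : ∀ ξ, Continuous fun p => W p ξ) (η ξ : H) :
    inner ℂ (∫ q, vacuumKernel q • W q η) ξ = inner ℂ η (∫ q, vacuumKernel q • W q ξ) := by
  rw [← inner_conj_symm, ← integral_inner (integrable_vacuumKernel_smul hcont η),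
    ← integral_inner (integrable_vacuumKernel_smul hcont ξ), ← integral_conj,
    ← integral_neg_eq_self]
  refine integral_congr_ae (Filter.Eventually.of_forall fun p => ?_)
  simp only [inner_smul_right, map_mul, inner_conj_symm]
  have h1 : inner ℂ (W (-p) η) ξ = (Circle.exp (p.1 * p.2) : ℂ) * inner ℂ η (W p ξ) := by
    have h2 : W (-p) ((Circle.exp (p.1 * p.2) : ℂ) • W p ξ) = ξ := by
      rw [map_smul, hmul, smul_smul, neg_add_cancel, weyl_zero hmul, ← Circle.coe_mul,
        ← Circle.exp_add]
      simp [mul_comm]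
    conv_lhs => rw [← h2, LinearIsometry.inner_map_map, inner_smul_right]
  have h3 : (starRingEnd ℂ) (vacuumKernel (-p)) * (Circle.exp (p.1 * p.2) : ℂ)
      = vacuumKernel p := by
    rw [vacuumKernel, vacuumKernel, ← Complex.exp_conj, Circle.coe_exp, ← Complex.exp_add]
    congr 1
    simp only [map_add, map_div₀, map_neg, map_mul, map_pow, Complex.conj_ofReal, Complex.conj_I,
      map_ofNat, Prod.fst_neg, Prod.snd_neg]
    push_cast
    ring
  rw [h1, ← mul_assoc, h3]

/-- Conjugating `W(p)` by another Weyl operator multiplies it by a character of `p`. If `P = 0`, the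
Fourier transform of `p ↦ κ(p) ⟨ξ, W(p) ξ⟩` vanishes identically, so by Plancherel this continuous
function is zero; but at `p = 0` it equals `‖ξ‖²`. -/
theorem exists_integral_vacuumKernel_ne_zero [Nontrivial H]
    (hmul : ∀ p q ξ, W p (W q ξ) = (Circle.exp (p.2 * q.1) : ℂ) • W (p + q) ξ)
    (hcont : ∀ ξ, Continuous fun p => W p ξ) : ∃ ξ : H, ∫ q, vacuumKernel q • W q ξ ≠ 0 := by
  by_contra! hzero
  obtain ⟨ξ, hξ⟩ := exists_ne (0 : H)
  let F : ℝ × ℝ → ℂ := fun p => vacuumKernel p * inner ℂ ξ (W p ξ)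
  have hFc : Continuous F := continuous_vacuumKernel.mul (continuous_const.inner (hcont ξ))
  have hb : ∀ p, ‖(inner ℂ ξ (W p ξ) : ℂ)‖ ≤ ‖ξ‖ * ‖ξ‖ := fun p =>
    (norm_inner_le_norm _ _).trans (by rw [LinearIsometry.norm_map])
  have hF1 : Integrable F := integrable_vacuumKernel.mul_bdd (c := ‖ξ‖ * ‖ξ‖)
    (continuous_const.inner (hcont ξ)).aestronglyMeasurable (Filter.Eventually.of_forall hb)
  have hF2 : MemLp F 2 := by
    refine (memLp_vacuumKernel.const_mul ((‖ξ‖ * ‖ξ‖ : ℝ) : ℂ)).of_le hFc.aestronglyMeasurable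
      (Filter.Eventually.of_forall fun p => ?_)
    simp only [F, norm_mul, Complex.norm_real, norm_norm]
    rw [mul_comm]
    gcongr
    exact hb p
  have hft : ∀ w : ℝ × ℝ, ∫ p : ℝ × ℝ, (Circle.exp (p.2 * w.1 + p.1 * w.2) : ℂ) * F p = 0 := by
    intro w
    -- The commutation phase of `W p` and `W w'` is `p.2 * w'.1 - w'.2 * p.1`; the sign makes it
    -- `p.2 * w.1 + p.1 * w.2`.
    set w' : ℝ × ℝ := (w.1, -w.2) with hw'
    have h1 : inner ℂ (W w' ξ) (∫ q, vacuumKernel q • W q (W w' ξ)) = 0 := by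
      rw [hzero, inner_zero_right]
    rw [← integral_inner (integrable_vacuumKernel_smul hcont _)] at h1
    rw [← h1]
    refine integral_congr_ae (Filter.Eventually.of_forall fun p => ?_)
    have h2 : W p (W w' ξ) = (Circle.exp (p.2 * w.1 + p.1 * w.2) : ℂ) • W w' (W p ξ) := by
      rw [hmul, hmul, smul_smul, ← Circle.coe_mul, ← Circle.exp_add, add_comm w' p]
      congr 3
      simp only [hw']
      ring
    simp only [F, h2, inner_smul_right, LinearIsometry.inner_map_map]
    ring
  have h4 := lintegral_enorm_integral_exp_plane_sq hF1 hF2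
  simp only [hft, enorm_zero, ne_eq, OfNat.ofNat_ne_zero, not_false_eq_true, zero_pow,
    lintegral_zero] at h4
  have h5 : ∫⁻ p, ‖F p‖ₑ ^ 2 = 0 := by
    rcases mul_eq_zero.1 h4.symm with h | h
    · exact absurd h (ne_of_gt (ENNReal.ofReal_pos.2 (by positivity)))
    · exact h
  rw [lintegral_eq_zero_iff (hFc.enorm.measurable.pow_const 2)] at h5
  have h6 : F =ᵐ[volume] fun _ => 0 := h5.mono fun p hp => by
    simpa using hp
  have h7 := congrFun ((Continuous.ae_eq_iff_eq volume hFc continuous_const).1 h6) 0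
  simp only [F, vacuumKernel_zero, weyl_zero hmul, one_mul, inner_self_eq_zero] at h7
  exact hξ h7

/-- Every representation of the Weyl relations contains a unit vector with the matrix coefficient
of the vacuum. -/
theorem exists_vacuum [Nontrivial H]
    (hmul : ∀ p q ξ, W p (W q ξ) = (Circle.exp (p.2 * q.1) : ℂ) • W (p + q) ξ)
    (hcont : ∀ ξ, Continuous fun p => W p ξ) :
    ∃ v : H, v ≠ 0 ∧ ∀ p, inner ℂ v (W p v) = (starRingEnd ℂ) (vacuumKernel p) := by
  obtain ⟨ξ, hξ⟩ := exists_integral_vacuumKernel_ne_zero hmul hcont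
  set u := ∫ q, vacuumKernel q • W q ξ with hu
  -- With `u = P ξ`: `⟨P ξ, W(p) P ξ⟩ = ⟨ξ, P W(p) P ξ⟩`. The unknown factor `⟨ξ, u⟩` is then
  -- eliminated by the case `p = 0`.
  have h1 : ∀ p, inner ℂ u (W p u)
      = 2 * Real.pi * (starRingEnd ℂ) (vacuumKernel p) * inner ℂ ξ u := fun p => by
    have h2 := inner_integral_vacuumKernel hmul hcont ξ (W p u)
    rw [← hu] at h2
    rw [h2, hu, integral_vacuumKernel_weyl_integral hmul hcont, inner_smul_right, ← hu]
  have h3 : inner ℂ u u = 2 * Real.pi * inner ℂ ξ u := by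
    have := h1 0
    rwa [weyl_zero hmul, vacuumKernel_zero, map_one, mul_one] at this
  have hn : (‖u‖ : ℂ) ≠ 0 := by simpa using hξ
  refine ⟨((‖u‖ : ℂ)⁻¹) • u, smul_ne_zero (inv_ne_zero hn) hξ, fun p => ?_⟩
  rw [map_smul, inner_smul_left, inner_smul_right, h1, mul_right_comm, ← h3,
    inner_self_eq_norm_sq_to_K, map_inv₀, Complex.conj_ofReal]
  simp only [Complex.coe_algebraMap]
  field_simp

end StoneVonNeumann

/-! ## The irreducible representations of `HeisK` -/

section Algebra

variable {K : Type*} [AddCommGroup K] {φ₀ : ℝ →+ K}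

namespace HeisK

theorem mk_mul_mk (y y' x x' : ℝ) (k k' : K) :
    (⟨y, k, x⟩ * ⟨y', k', x'⟩ : HeisK φ₀) = ⟨y + y', k + (k' + φ₀ (x * y')), x + x'⟩ := rfl

theorem mk_eq_central_mul (y x : ℝ) (k : K) :
    (⟨y, k, x⟩ : HeisK φ₀) = ⟨0, k, 0⟩ * ⟨y, 0, x⟩ := by
  simp [mk_mul_mk]

theorem central_comm (k : K) (g : HeisK φ₀) : ⟨0, k, 0⟩ * g = g * ⟨0, k, 0⟩ := by
  obtain ⟨y, l, x⟩ := g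
  simp [mk_mul_mk, add_comm]

end HeisK

end Algebra

section Irreps

variable {K : Type*} [AddCommGroup K] [TopologicalSpace K] {φ₀ : ℝ →+ K}

theorem eq_dualChar (hdense : DenseRange φ₀) (t : dualSubgroup φ₀) {χ : AddChar K Circle}
    (hχ : Continuous χ) (h : ∀ z, χ (φ₀ z) = Circle.exp (t * z)) : χ = dualChar φ₀ t :=
  DFunLike.coe_injective (hdense.equalizer hχ (continuous_dualChar φ₀ t)
    (funext fun z => (h z).trans (dualChar_apply φ₀ t z).symm))

theorem dualChar_zero (hdense : DenseRange φ₀) : dualChar φ₀ 0 = 1 :=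
  (eq_dualChar hdense 0 continuous_const fun z => by simp).symm

theorem dualChar_injective : Function.Injective (dualChar φ₀) := fun s t h => by
  by_contra hne
  have hne' : (s : ℝ) - t ≠ 0 := sub_ne_zero.2 fun h => hne (Subtype.ext h)
  -- At this point the two exponentials differ by the factor `exp (i π) = -1`.
  have h1 := dualChar_apply φ₀ s (Real.pi / (s - t))
  rw [h, dualChar_apply] at h1
  have h2 : Circle.exp ((s - t : ℝ) * (Real.pi / (s - t))) = 1 := by
    rw [sub_mul, Circle.exp_sub, ← h1, div_self']
  rw [mul_div_cancel₀ _ hne'] at h2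
  have h3 := congrArg (fun c : Circle => (c : ℂ)) h2
  simp only [Circle.coe_exp, Complex.exp_pi_mul_I, Circle.coe_one] at h3
  norm_num at h3

theorem exists_eq_dualChar (hcont : Continuous φ₀) (hdense : DenseRange φ₀) {χ : AddChar K Circle}
    (hχ : Continuous χ) : ∃ t : dualSubgroup φ₀, χ = dualChar φ₀ t := by
  let χ' : AddChar ℝ Circle :=
    { toFun := fun z => χ (φ₀ z)
      map_zero_eq_one' := by simp
      map_add_eq_mul' := fun a b => by rw [map_add, AddChar.map_add_eq_mul] }
  obtain ⟨t, ht⟩ := exists_forall_addChar_real_eq (χ := χ') (hχ.comp hcont)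
  exact ⟨⟨t, χ, hχ, ht⟩, eq_dualChar hdense _ hχ ht⟩

/-- The dual group of `K` is the group of its continuous characters. -/
noncomputable def dualSubgroupEquiv (hcont : Continuous φ₀) (hdense : DenseRange φ₀) :
    dualSubgroup φ₀ ≃ {χ : AddChar K Circle // Continuous χ} :=
  Equiv.ofBijective (fun t => ⟨dualChar φ₀ t, continuous_dualChar φ₀ t⟩)
    ⟨fun s t h => dualChar_injective (congrArg Subtype.val h), fun χ => by
      obtain ⟨t, ht⟩ := exists_eq_dualChar hcont hdense χ.2
      exact ⟨t, Subtype.ext ht.symm⟩⟩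

namespace HeisK

theorem continuous_mk {X : Type*} [TopologicalSpace X] {a : X → ℝ} {b : X → K} {c : X → ℝ}
    (ha : Continuous a) (hb : Continuous b) (hc : Continuous c) :
    Continuous fun p => (⟨a p, b p, c p⟩ : HeisK φ₀) :=
  (coordHomeomorph φ₀).symm.continuous.comp (ha.prodMk (hb.prodMk hc))

end HeisK

variable {H : Type*} [NormedAddCommGroup H] [InnerProductSpace ℂ H]
  {H' : Type*} [NormedAddCommGroup H'] [InnerProductSpace ℂ H']

/-- The centre of `HeisK φ₀` acts by the character `χ_t`. -/
def HasCentralChar (ρ : UnitaryRep (HeisK φ₀) H) (t : dualSubgroup φ₀) : Prop :=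
  ∀ k ξ, ρ.toHom ⟨0, k, 0⟩ ξ = (dualChar φ₀ t k : ℂ) • ξ

/-- Schur's lemma makes the central elements scalars. A single non-zero vector then yields a
continuous character, and every continuous character of `K` is some `dualChar`. -/
theorem exists_hasCentralChar [CompleteSpace H] (hcont : Continuous φ₀) (hdense : DenseRange φ₀)
    {ρ : UnitaryRep (HeisK φ₀) H} (hρ : ρ.IsIrreducible) : ∃ t, HasCentralChar ρ t := by
  have hsc : ∀ k, ∃ c : ℂ, ∀ ξ, ρ.toHom ⟨0, k, 0⟩ ξ = c • ξ := fun k =>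
    hρ.exists_smul fun g ξ => by
      rw [← ρ.toHom_mul_apply, HeisK.central_comm, ρ.toHom_mul_apply]
  have := hρ.1
  obtain ⟨u, hu⟩ := exists_ne (0 : H)
  obtain ⟨χ, hχ, hχu⟩ := exists_addChar_of_eigenvector
    (τ := fun k : K => (ρ.toHom ⟨0, k, 0⟩).toLinearIsometry)
    (fun a b ξ => by
      change ρ.toHom _ ξ = ρ.toHom _ (ρ.toHom _ ξ)
      rw [← ρ.toHom_mul_apply, HeisK.mk_mul_mk]
      simp)
    (u := u) ((ρ.continuous_apply u).comp
      (HeisK.continuous_mk continuous_const continuous_id continuous_const)) hu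
    (fun k => (hsc k).imp fun c hc => hc u)
  obtain ⟨t, rfl⟩ := exists_eq_dualChar hcont hdense hχ
  refine ⟨t, fun k ξ => ?_⟩
  obtain ⟨c, hc⟩ := hsc k
  have h1 : c • u = (dualChar φ₀ t k : ℂ) • u := (hc u).symm.trans (hχu k)
  rw [hc, smul_left_injective ℂ hu h1]

/-- Dividing the `y`-coordinate by `t` normalizes the cocycle: `χ_t (φ₀ (p.2 * q.1 / t)) = exp (i
p.2 q.1)`, which is the Weyl relation. Because the centre acts by scalars, the vacuum coefficient is
then known on the whole group. -/
theorem exists_vacuum_of_hasCentralChar [CompleteSpace H] [Nontrivial H]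
    {ρ : UnitaryRep (HeisK φ₀) H} {t : dualSubgroup φ₀} (ht : t ≠ 0) (hρ : HasCentralChar ρ t) :
    ∃ v : H, v ≠ 0 ∧ ∀ g, inner ℂ v (ρ.toHom g v)
      = (dualChar φ₀ t g.k : ℂ) * (starRingEnd ℂ) (vacuumKernel (t * g.y, g.x)) := by
  have ht' : (t : ℝ) ≠ 0 := fun h => ht (Subtype.ext h)
  obtain ⟨v, hv, h⟩ := exists_vacuum
    (W := fun p : ℝ × ℝ => (ρ.toHom ⟨p.1 / t, 0, p.2⟩).toLinearIsometry)
    (fun p q ξ => by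
      change ρ.toHom _ (ρ.toHom _ ξ) = _ • ρ.toHom _ ξ
      rw [← ρ.toHom_mul_apply, HeisK.mk_mul_mk, HeisK.mk_eq_central_mul, ρ.toHom_mul_apply, hρ,
        zero_add, zero_add, dualChar_apply, ← add_div]
      have e : (t : ℝ) * (p.2 * (q.1 / t)) = p.2 * q.1 := by field_simp
      rw [e]
      rfl)
    (fun ξ => (ρ.continuous_apply ξ).comp (HeisK.continuous_mk
      (continuous_fst.div_const _) continuous_const continuous_snd))
  refine ⟨v, hv, fun g => ?_⟩
  obtain ⟨y, k, x⟩ := g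
  have h1 := h (t * y, x)
  change inner ℂ v (ρ.toHom ⟨t * y / t, 0, x⟩ v) = _ at h1
  rw [mul_div_cancel_left₀ _ ht'] at h1
  rw [HeisK.mk_eq_central_mul, ρ.toHom_mul_apply, hρ, inner_smul_right, h1,
    ← HeisK.mk_eq_central_mul]

/-- The Stone-von Neumann theorem. -/
theorem isEquivalent_of_hasCentralChar [CompleteSpace H] [CompleteSpace H']
    {ρ : UnitaryRep (HeisK φ₀) H} {σ : UnitaryRep (HeisK φ₀) H'} (hρ : ρ.IsIrreducible)
    (hσ : σ.IsIrreducible) {t : dualSubgroup φ₀} (ht : t ≠ 0) (hρt : HasCentralChar ρ t)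
    (hσt : HasCentralChar σ t) : ρ.IsEquivalent σ := by
  have := hρ.1
  have := hσ.1
  obtain ⟨v, hv, h⟩ := exists_vacuum_of_hasCentralChar ht hρt
  obtain ⟨w, -, h'⟩ := exists_vacuum_of_hasCentralChar ht hσt
  exact hρ.isEquivalent_of_inner_eq hσ hv fun g => (h g).trans (h' g).symm

theorem HasCentralChar.of_isEquivalent {ρ : UnitaryRep (HeisK φ₀) H}
    {σ : UnitaryRep (HeisK φ₀) H'} (h : ρ.IsEquivalent σ) {t : dualSubgroup φ₀}
    (hρ : HasCentralChar ρ t) : HasCentralChar σ t := by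
  obtain ⟨U, hU⟩ := h
  intro k ξ
  have h1 := hU ⟨0, k, 0⟩ (U.symm ξ)
  rw [hρ, map_smul, LinearIsometryEquiv.apply_symm_apply] at h1
  exact h1.symm

theorem HasCentralChar.unique [Nontrivial H] {ρ : UnitaryRep (HeisK φ₀) H} {s t : dualSubgroup φ₀}
    (hs : HasCentralChar ρ s) (ht : HasCentralChar ρ t) : s = t := by
  obtain ⟨u, hu⟩ := exists_ne (0 : H)
  exact dualChar_injective (DFunLike.ext _ _ fun k => Circle.ext
    (smul_left_injective ℂ hu ((hs k u).symm.trans (ht k u))))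

theorem schrodingerRep_toHom_apply (t : dualSubgroup φ₀) (g : HeisK φ₀) (f : L2R) :
    (schrodingerRep φ₀ t).toHom g f = Weyl.op (dualChar φ₀ t g.k) (t * g.y) g.x f := rfl

theorem planeRep_toHom_apply (w : ℝ × ℝ) (g : HeisK φ₀) (z : ℂ) :
    (planeRep φ₀ w).toHom g z = (Circle.exp (g.x * w.1 + g.y * w.2) : ℂ) * z := rfl

theorem hasCentralChar_schrodingerRep (t : dualSubgroup φ₀) :
    HasCentralChar (schrodingerRep φ₀ t) t := fun k f => by
  rw [schrodingerRep_toHom_apply, Weyl.op_eq, Weyl.unitaryOp_apply]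
  simp only [mul_zero, Weyl.op_one]

theorem hasCentralChar_planeRep (hdense : DenseRange φ₀) (w : ℝ × ℝ) :
    HasCentralChar (planeRep φ₀ w) 0 := fun k z => by
  rw [planeRep_toHom_apply, dualChar_zero hdense]
  simp

theorem isIrreducible_planeRep (w : ℝ × ℝ) : (planeRep φ₀ w).IsIrreducible :=
  ⟨inferInstance, fun W _ _ => eq_bot_or_eq_top W⟩

theorem isEquivalent_planeRep_iff {w w' : ℝ × ℝ} :
    (planeRep φ₀ w).IsEquivalent (planeRep φ₀ w') ↔ w = w' := by
  refine ⟨fun ⟨U, hU⟩ => ?_, fun h => h ▸ ⟨LinearIsometryEquiv.refl ℂ _, fun _ _ => rfl⟩⟩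
  have h1 : ∀ g : HeisK φ₀, Circle.exp (g.x * w.1 + g.y * w.2)
      = Circle.exp (g.x * w'.1 + g.y * w'.2) := fun g => by
    have h2 := hU g 1
    have h3 : U 1 ≠ 0 := by simp
    rw [planeRep_toHom_apply, planeRep_toHom_apply, ← smul_eq_mul, map_smul, smul_eq_mul] at h2
    exact Circle.ext (mul_right_cancel₀ h3 h2)
  have key : ∀ a b : ℝ, (∀ x : ℝ, Circle.exp (x * a) = Circle.exp (x * b)) → a = b := by
    intro a b hab
    by_contra hne
    have hne' : a - b ≠ 0 := sub_ne_zero.2 hne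
    have h4 : Circle.exp ((Real.pi / (a - b)) * (a - b)) = 1 := by
      rw [mul_sub, Circle.exp_sub, hab, div_self']
    rw [div_mul_cancel₀ _ hne'] at h4
    have h3 := congrArg (fun c : Circle => (c : ℂ)) h4
    simp only [Circle.coe_exp, Complex.exp_pi_mul_I, Circle.coe_one] at h3
    norm_num at h3
  exact Prod.ext (key _ _ fun x => by simpa using h1 ⟨0, 0, x⟩)
    (key _ _ fun y => by simpa using h1 ⟨y, 0, 0⟩)

/-- Commutators lie in the centre, which acts trivially, so all operators commute and are scalars by
Schur's lemma. The two coordinate lines give continuous characters of `ℝ`, which supply `w`. -/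
theorem exists_isEquivalent_planeRep [CompleteSpace H] (hdense : DenseRange φ₀)
    {ρ : UnitaryRep (HeisK φ₀) H} (hρ : ρ.IsIrreducible) (h0 : HasCentralChar ρ 0) :
    ∃ w, ρ.IsEquivalent (planeRep φ₀ w) := by
  have hcen : ∀ k ξ, ρ.toHom ⟨0, k, 0⟩ ξ = ξ := fun k ξ => by
    rw [h0, dualChar_zero hdense, AddChar.one_apply, Circle.coe_one, one_smul]
  have hmk : ∀ y x k ξ, ρ.toHom ⟨y, k, x⟩ ξ = ρ.toHom ⟨y, 0, x⟩ ξ := fun y x k ξ => by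
    rw [HeisK.mk_eq_central_mul, ρ.toHom_mul_apply, hcen]
  have hsc : ∀ z, ∃ c : ℂ, ∀ ξ, ρ.toHom z ξ = c • ξ := fun z =>
    hρ.exists_smul fun g ξ => by
      obtain ⟨y, k, x⟩ := z
      obtain ⟨y', k', x'⟩ := g
      rw [← ρ.toHom_mul_apply, ← ρ.toHom_mul_apply, HeisK.mk_mul_mk, HeisK.mk_mul_mk, hmk,
        hmk (y' + y), add_comm y, add_comm x]
  have := hρ.1
  obtain ⟨u, hu⟩ := exists_ne (0 : H)
  obtain ⟨χ₁, hχ₁, h₁⟩ := exists_addChar_of_eigenvector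
    (τ := fun x : ℝ => (ρ.toHom ⟨0, 0, x⟩).toLinearIsometry)
    (fun a b ξ => by
      change ρ.toHom _ ξ = ρ.toHom _ (ρ.toHom _ ξ)
      rw [← ρ.toHom_mul_apply, HeisK.mk_mul_mk]
      simp)
    (u := u) ((ρ.continuous_apply u).comp
      (HeisK.continuous_mk continuous_const continuous_const continuous_id)) hu
    (fun x => (hsc ⟨0, 0, x⟩).imp fun c hc => hc u)
  obtain ⟨χ₂, hχ₂, h₂⟩ := exists_addChar_of_eigenvector
    (τ := fun y : ℝ => (ρ.toHom ⟨y, 0, 0⟩).toLinearIsometry)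
    (fun a b ξ => by
      change ρ.toHom _ ξ = ρ.toHom _ (ρ.toHom _ ξ)
      rw [← ρ.toHom_mul_apply, HeisK.mk_mul_mk]
      simp)
    (u := u) ((ρ.continuous_apply u).comp
      (HeisK.continuous_mk continuous_id continuous_const continuous_const)) hu
    (fun y => (hsc ⟨y, 0, 0⟩).imp fun c hc => hc u)
  obtain ⟨w₁, hw₁⟩ := exists_forall_addChar_real_eq hχ₁
  obtain ⟨w₂, hw₂⟩ := exists_forall_addChar_real_eq hχ₂
  have hn : (‖u‖ : ℂ) ≠ 0 := by simpa using hu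
  have hact : ∀ g, ρ.toHom g u = (Circle.exp (g.x * w₁ + g.y * w₂) : ℂ) • u := fun g => by
    obtain ⟨y, k, x⟩ := g
    have e : (⟨y, 0, x⟩ : HeisK φ₀) = ⟨y, 0, 0⟩ * ⟨0, 0, x⟩ := by simp [HeisK.mk_mul_mk]
    have h3 : ρ.toHom ⟨0, 0, x⟩ u = (χ₁ x : ℂ) • u := h₁ x
    have h4 : ρ.toHom ⟨y, 0, 0⟩ u = (χ₂ y : ℂ) • u := h₂ y
    rw [hmk, e, ρ.toHom_mul_apply, h3, map_smul, h4, smul_smul, hw₁, hw₂, ← Circle.coe_mul,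
      ← Circle.exp_add, mul_comm w₁, mul_comm w₂]
  -- A unit vector has the same diagonal coefficient as `1 ∈ ℂ`, so the dimension of `H` need not be
  -- computed separately.
  refine ⟨(w₁, w₂), hρ.isEquivalent_of_inner_eq (isIrreducible_planeRep _)
    (v := (‖u‖ : ℂ)⁻¹ • u) (w := 1) (smul_ne_zero (inv_ne_zero hn) hu) fun g => ?_⟩
  rw [planeRep_toHom_apply, map_smul, hact, inner_smul_left, inner_smul_right, inner_smul_right,
    inner_self_eq_norm_sq_to_K, map_inv₀, Complex.conj_ofReal]
  simp only [Complex.coe_algebraMap, mul_one, RCLike.inner_apply, map_one]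
  field_simp

/-- For `ξ ∈ W` and `η ∈ Wᗮ` the matrix coefficients vanish. As functions of `y` they are Fourier
transforms of `ψ ↦ ξ(ψ - x) conj η(ψ)`, so these products vanish for almost every `x`. Integrating
their squares over `x` and `ψ` gives `‖ξ‖² ‖η‖² = 0`. -/
theorem isIrreducible_schrodingerRep {t : dualSubgroup φ₀} (ht : t ≠ 0) :
    (schrodingerRep φ₀ t).IsIrreducible := by
  have ht' : (t : ℝ) ≠ 0 := fun h => ht (Subtype.ext h)
  refine ⟨?_, fun W hWc hW => ?_⟩
  · refine ⟨indicatorConstLp 2 (measurableSet_Icc (a := (0 : ℝ)) (b := 1)) (by simp) (1 : ℂ), 0,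
      fun h => ?_⟩
    have h1 := congrArg norm h
    rw [norm_indicatorConstLp (by simp) (by simp)] at h1
    simp at h1
  by_contra! hcon
  obtain ⟨ξ, hξW, hξ⟩ := W.ne_bot_iff.1 hcon.1
  have : CompleteSpace W := hWc.completeSpace_coe
  have hWo : Wᗮ ≠ ⊥ := fun h => hcon.2 (Submodule.orthogonal_eq_bot_iff.1 h)
  obtain ⟨η, hηW, hη⟩ := Wᗮ.ne_bot_iff.1 hWo
  have hξm : Measurable ξ := (Lp.stronglyMeasurable ξ).measurable
  have hηm : Measurable η := (Lp.stronglyMeasurable η).measurable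
  let g : ℝ → ℝ → ℂ := fun x ψ => ξ (ψ - x) * (starRingEnd ℂ) (η ψ)
  have hshift : ∀ x, MemLp (fun ψ => ξ (ψ - x)) 2 := fun x =>
    (Lp.memLp ξ).comp_measurePreserving (measurePreserving_sub_right volume x)
  have hg1 : ∀ x, Integrable (g x) := fun x =>
    (hshift x).integrable_mul (Lp.memLp η).star
  have hgm : Measurable fun p : ℝ × ℝ => ‖g p.1 p.2‖ₑ ^ 2 := by
    refine Measurable.pow_const (Measurable.enorm ?_) 2
    exact (hξm.comp (measurable_snd.sub measurable_fst)).mul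
      (Complex.continuous_conj.measurable.comp (hηm.comp measurable_snd))
  have htot : ∫⁻ x, ∫⁻ ψ, ‖g x ψ‖ₑ ^ 2 = ‖η‖ₑ ^ 2 * ‖ξ‖ₑ ^ 2 := by
    rw [lintegral_lintegral_swap hgm.aemeasurable, Lp.enorm_sq_eq_lintegral η,
      ← lintegral_mul_const _ (hηm.enorm.pow_const 2)]
    refine lintegral_congr fun ψ => ?_
    simp only [g, enorm_mul, mul_pow, RCLike.enorm_conj]
    have hm : Measurable fun x => ‖ξ (ψ - x)‖ₑ ^ 2 :=
      (hξm.comp (measurable_const_sub ψ)).enorm.pow_const 2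
    rw [lintegral_mul_const _ hm,
      lintegral_sub_left_eq_self (fun x => ‖ξ x‖ₑ ^ 2), ← Lp.enorm_sq_eq_lintegral, mul_comm]
  have hzero : ∀ x y, ∫ ψ, (Circle.exp (-(t * ψ * y)) : ℂ) * g x ψ = 0 := fun x y => by
    have h1 : inner ℂ η ((schrodingerRep φ₀ t).toHom ⟨y, 0, x⟩ ξ) = 0 :=
      Submodule.inner_left_of_mem_orthogonal (hW _ ξ hξW) hηW
    rw [schrodingerRep_toHom_apply, L2.inner_def] at h1
    rw [← h1]
    refine integral_congr_ae ?_
    filter_upwards [Weyl.op_ae (dualChar φ₀ t 0) (t * y) x ξ] with ψ hψ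
    rw [hψ, AddChar.map_zero_eq_one, Circle.coe_one, one_mul, RCLike.inner_apply,
      mul_right_comm (t : ℝ)]
    exact (mul_assoc _ _ _).symm
  have hfin : ∫⁻ x, ∫⁻ ψ, ‖g x ψ‖ₑ ^ 2 ≠ ∞ := by
    rw [htot]
    exact ENNReal.mul_ne_top (by simp) (by simp)
  have hae : ∀ᵐ x : ℝ, ∫⁻ ψ, ‖g x ψ‖ₑ ^ 2 = 0 := by
    filter_upwards [ae_lt_top hgm.lintegral_prod_right' hfin] with x hx
    have h2 := lintegral_enorm_integral_exp_sq (hg1 x)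
      ((memLp_two_iff_lintegral (hg1 x).aestronglyMeasurable).2 hx) ht'
    simp only [hzero, enorm_zero, ne_eq, OfNat.ofNat_ne_zero, not_false_eq_true, zero_pow,
      lintegral_zero] at h2
    rcases mul_eq_zero.1 h2.symm with h | h
    · exact absurd h (ne_of_gt (ENNReal.ofReal_pos.2 (by positivity)))
    · exact h
  rw [lintegral_congr_ae hae, lintegral_zero] at htot
  rcases mul_eq_zero.1 htot.symm with h | h
  · exact hη (by simpa using h)
  · exact hξ (by simpa using h)

end Irreps

/-! ## Integrated representations of `HeisK` -/

section Slices

variable {K : Type*} [AddCommGroup K] [TopologicalSpace K] [IsTopologicalAddGroup K]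
  [CompactSpace K] [MeasurableSpace K] [BorelSpace K] {φ₀ : ℝ →+ K}

namespace HeisK

/-- The coordinates `((y, x), k)` of an element of `HeisK`. -/
noncomputable def planeCoord (φ₀ : ℝ →+ K) : HeisK φ₀ ≃ᵐ (ℝ × ℝ) × K :=
  ((coordHomeomorph φ₀).trans (((Homeomorph.refl ℝ).prodCongr (Homeomorph.prodComm K ℝ)).trans
    (Homeomorph.prodAssoc ℝ ℝ K).symm)).toMeasurableEquiv

theorem measurePreserving_planeCoord_symm :
    MeasurePreserving (planeCoord φ₀).symm
      ((volume : Measure (ℝ × ℝ)).prod (normalizedHaar K)) volume := by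
  have h1 : MeasurePreserving (fun p : (ℝ × ℝ) × K => (p.1.1, p.2, p.1.2))
      ((volume : Measure (ℝ × ℝ)).prod (normalizedHaar K))
      ((volume : Measure ℝ).prod ((normalizedHaar K).prod (volume : Measure ℝ))) :=
    ((MeasurePreserving.id (volume : Measure ℝ)).prod
      (Measure.measurePreserving_swap (μ := (volume : Measure ℝ)) (ν := normalizedHaar K))).comp
      (measurePreserving_prodAssoc (volume : Measure ℝ) (volume : Measure ℝ) (normalizedHaar K))
  have h2 : Measurable (coordEquiv φ₀).symm := (coordHomeomorph φ₀).symm.continuous.measurable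
  refine ⟨(planeCoord φ₀).symm.measurable, ?_⟩
  change _ = Measure.map (coordEquiv φ₀).symm _
  rw [← h1.map_eq, Measure.map_map h2 h1.measurable]
  rfl

theorem integrable_comp_planeCoord {E : Type*} [NormedAddCommGroup E] {F : HeisK φ₀ → E} :
    Integrable (fun p : (ℝ × ℝ) × K => F ⟨p.1.1, p.2, p.1.2⟩)
      ((volume : Measure (ℝ × ℝ)).prod (normalizedHaar K)) ↔ Integrable F :=
  measurePreserving_planeCoord_symm.integrable_comp_emb (planeCoord φ₀).symm.measurableEmbedding

theorem integral_eq {E : Type*} [NormedAddCommGroup E] [NormedSpace ℝ E] {F : HeisK φ₀ → E}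
    (hF : Integrable F) :
    ∫ g, F g = ∫ p : ℝ × ℝ, ∫ k, F ⟨p.1, k, p.2⟩ ∂(normalizedHaar K) := by
  rw [← measurePreserving_planeCoord_symm.integral_comp
    (planeCoord φ₀).symm.measurableEmbedding]
  exact integral_prod _ (integrable_comp_planeCoord.2 hF)

theorem memLp_comp_planeCoord {F : HeisK φ₀ → ℂ} (hF : MemLp F 2) :
    MemLp (fun p : (ℝ × ℝ) × K => F ⟨p.1.1, p.2, p.1.2⟩) 2
      ((volume : Measure (ℝ × ℝ)).prod (normalizedHaar K)) :=
  hF.comp_measurePreserving measurePreserving_planeCoord_symm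

/-- The Fourier coefficient of `f` in the central variable at `t`. -/
noncomputable def slice (f : HeisK φ₀ → ℂ) (t : dualSubgroup φ₀) (p : ℝ × ℝ) : ℂ :=
  ∫ k, f ⟨p.1, k, p.2⟩ * (dualChar φ₀ t k : ℂ) ∂(normalizedHaar K)

theorem integrable_mul_dualChar {f : HeisK φ₀ → ℂ} (hf : Integrable f) (t : dualSubgroup φ₀) :
    Integrable fun g => f g * (dualChar φ₀ t g.k : ℂ) := by
  have hc : Continuous fun g : HeisK φ₀ => (dualChar φ₀ t g.k : ℂ) :=
    Continuous.subtype_val ((continuous_dualChar φ₀ t).comp (continuous_k φ₀))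
  exact hf.mul_bdd (c := 1) hc.aestronglyMeasurable
    (Filter.Eventually.of_forall fun p => (Circle.norm_coe _).le)

theorem integrable_slice {f : HeisK φ₀ → ℂ} (hf : Integrable f) (t : dualSubgroup φ₀) :
    Integrable (slice f t) :=
  (integrable_comp_planeCoord.2 (integrable_mul_dualChar hf t)).integral_prod_left

theorem memLp_slice [T2Space K] {f : HeisK φ₀ → ℂ} (hf : MemLp f 2) (t : dualSubgroup φ₀) :
    MemLp (slice f t) 2 :=
  memLp_integral_char (memLp_comp_planeCoord hf) ⟨dualChar φ₀ t, continuous_dualChar φ₀ t⟩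

theorem tsum_lintegral_slice_sq [T2Space K] (hcont : Continuous φ₀) (hdense : DenseRange φ₀)
    {f : HeisK φ₀ → ℂ} (hf : MemLp f 2) :
    ∑' t, ∫⁻ p, ‖slice f t p‖ₑ ^ 2 = eLpNorm f 2 volume ^ 2 := by
  have hF := memLp_comp_planeCoord hf
  rw [← eLpNorm_comp_measurePreserving hf.1 (measurePreserving_planeCoord_symm (φ₀ := φ₀)),
    eLpNorm_two_sq_eq_lintegral]
  -- Required for the separability of `L²(ℝ²)`.
  have : Fact ((2 : ℝ≥0∞) ≠ ∞) := ⟨by simp⟩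
  refine Eq.trans ?_ (tsum_lintegral_integral_char_sq hF)
  rw [← (dualSubgroupEquiv hcont hdense).tsum_eq]
  rfl

end HeisK

theorem UnitaryRep.integrated_apply {H : Type*} [NormedAddCommGroup H] [InnerProductSpace ℂ H]
    (ρ : UnitaryRep (HeisK φ₀) H) {f : HeisK φ₀ → ℂ} (hf : Integrable f) (ξ : H) :
    ρ.integrated f hf ξ = ∫ g, f g • ρ.toHom g ξ := rfl

/-- Integrating over the central variable first leaves only one Fourier coefficient of `f`; this
decouples the central characters from each other. -/
theorem HasCentralChar.integrated_apply {H : Type*} [NormedAddCommGroup H] [InnerProductSpace ℂ H]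
    [CompleteSpace H]
    {ρ : UnitaryRep (HeisK φ₀) H} {t : dualSubgroup φ₀} (hρ : HasCentralChar ρ t)
    {f : HeisK φ₀ → ℂ} (hf : Integrable f) (ξ : H) :
    ρ.integrated f hf ξ = ∫ p : ℝ × ℝ, HeisK.slice f t p • ρ.toHom ⟨p.1, 0, p.2⟩ ξ := by
  rw [ρ.integrated_apply, HeisK.integral_eq (ρ.integrable_smul_apply ξ hf)]
  refine integral_congr_ae (Filter.Eventually.of_forall fun p => ?_)
  simp only [HeisK.slice]
  rw [← integral_smul_const]
  refine integral_congr_ae (Filter.Eventually.of_forall fun k => ?_)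
  simp only
  rw [HeisK.mk_eq_central_mul, ρ.toHom_mul_apply, hρ, smul_smul]

theorem HasCentralChar.inner_integrated_apply {H : Type*} [NormedAddCommGroup H]
    [InnerProductSpace ℂ H] [CompleteSpace H]
    {ρ : UnitaryRep (HeisK φ₀) H} {t : dualSubgroup φ₀} (hρ : HasCentralChar ρ t)
    {f : HeisK φ₀ → ℂ} (hf : Integrable f) (ξ η : H) :
    inner ℂ η (ρ.integrated f hf ξ)
      = ∫ p : ℝ × ℝ, HeisK.slice f t p * inner ℂ η (ρ.toHom ⟨p.1, 0, p.2⟩ ξ) := by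
  have hc : Continuous fun p : ℝ × ℝ => ρ.toHom ⟨p.1, 0, p.2⟩ ξ :=
    (ρ.continuous_apply ξ).comp (HeisK.continuous_mk continuous_fst continuous_const continuous_snd)
  have hint : Integrable fun p : ℝ × ℝ => HeisK.slice f t p • ρ.toHom ⟨p.1, 0, p.2⟩ ξ :=
    (HeisK.integrable_slice hf t).smul_bdd ‖ξ‖ hc.aestronglyMeasurable
      (Filter.Eventually.of_forall fun p => by simp)
  rw [hρ.integrated_apply hf, ← integral_inner hint]
  simp only [inner_smul_right]

theorem integrated_planeRep (hdense : DenseRange φ₀) (w : ℝ × ℝ) {f : HeisK φ₀ → ℂ}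
    (hf : Integrable f) (z : ℂ) :
    (planeRep φ₀ w).integrated f hf z
      = (∫ p : ℝ × ℝ, (Circle.exp (p.2 * w.1 + p.1 * w.2) : ℂ) * HeisK.slice f 0 p) * z := by
  rw [(hasCentralChar_planeRep hdense w).integrated_apply hf, ← integral_mul_const]
  refine integral_congr_ae (Filter.Eventually.of_forall fun p => ?_)
  simp only [planeRep_toHom_apply, smul_eq_mul]
  ring

end Slices

/-! ## The Hilbert-Schmidt norms of the integrated Schrödinger representations -/

section HilbertSchmidt

variable {K : Type*} [AddCommGroup K] [TopologicalSpace K] {φ₀ : ℝ →+ K}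

theorem inner_schrodingerRep_mk (t : dualSubgroup φ₀) (y x : ℝ) (ξ η : L2R) :
    inner ℂ η ((schrodingerRep φ₀ t).toHom ⟨y, 0, x⟩ ξ)
      = ∫ ψ, (Circle.exp (-(t * y * ψ)) : ℂ) * ξ (ψ - x) * (starRingEnd ℂ) (η ψ) := by
  rw [schrodingerRep_toHom_apply, L2.inner_def]
  refine integral_congr_ae ?_
  filter_upwards [Weyl.op_ae (dualChar φ₀ t 0) (t * y) x ξ] with ψ hψ
  rw [hψ, AddChar.map_zero_eq_one, Circle.coe_one, one_mul, RCLike.inner_apply]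

/-- The hypothesis of Fubini's theorem for `inner_integrated_schrodingerRep`: by Cauchy-Schwarz the
`ψ`-integral is bounded by `‖ξ‖ ‖η‖`, uniformly in the group variables, and `G` is integrable in
these. -/
theorem integrable_weyl_kernel {G : ℝ × ℝ → ℂ} (hG : Integrable G) (t : ℝ) (ξ η : L2R) :
    Integrable (fun q : (ℝ × ℝ) × ℝ => G q.1 * ((Circle.exp (-(t * q.1.1 * q.2)) : ℂ)
      * ξ (q.2 - q.1.2) * (starRingEnd ℂ) (η q.2)))
      ((volume : Measure (ℝ × ℝ)).prod volume) := by
  have hξm : Measurable ξ := (Lp.stronglyMeasurable ξ).measurable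
  have hηm : Measurable η := (Lp.stronglyMeasurable η).measurable
  have hshift : ∀ x, MemLp (fun ψ => ξ (ψ - x)) 2 := fun x =>
    (Lp.memLp ξ).comp_measurePreserving (measurePreserving_sub_right volume x)
  have hm : Measurable fun q : (ℝ × ℝ) × ℝ => (Circle.exp (-(t * q.1.1 * q.2)) : ℂ)
      * ξ (q.2 - q.1.2) * (starRingEnd ℂ) (η q.2) := by
    refine Measurable.mul (Measurable.mul (Continuous.measurable (by fun_prop)) ?_) ?_
    · exact hξm.comp (by fun_prop)
    · exact Complex.continuous_conj.measurable.comp (hηm.comp measurable_snd)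
  have hi : ∀ p : ℝ × ℝ, Integrable fun ψ => (Circle.exp (-(t * p.1 * ψ)) : ℂ)
      * ξ (ψ - p.2) * (starRingEnd ℂ) (η ψ) := fun p => by
    have h1 : Integrable fun ψ => ξ (ψ - p.2) * (starRingEnd ℂ) (η ψ) :=
      (hshift p.2).integrable_mul (Lp.memLp η).star
    simp only [mul_assoc]
    exact h1.bdd_mul (c := 1) (Continuous.aestronglyMeasurable (by fun_prop))
      (Filter.Eventually.of_forall fun _ => (Circle.norm_coe _).le)
  have hn : ∀ p : ℝ × ℝ, ∫ ψ, ‖(Circle.exp (-(t * p.1 * ψ)) : ℂ)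
      * ξ (ψ - p.2) * (starRingEnd ℂ) (η ψ)‖ ≤ ‖ξ‖ * ‖η‖ := fun p => by
    have h0 : ∀ ψ, ‖(Circle.exp (-(t * p.1 * ψ)) : ℂ) * ξ (ψ - p.2) * (starRingEnd ℂ) (η ψ)‖
        = ‖ξ (ψ - p.2)‖ * ‖η ψ‖ := fun ψ => by
      rw [norm_mul, norm_mul, Circle.norm_coe, one_mul, RCLike.norm_conj]
    simp only [h0]
    have h1 := integral_mul_norm_le_Lp_mul_Lq (μ := volume) (f := fun ψ => ξ (ψ - p.2)) (g := η)
      (p := 2) (q := 2) (Real.HolderConjugate.two_two)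
      (by simpa using hshift p.2) (by simpa using Lp.memLp η)
    refine h1.trans (le_of_eq ?_)
    have hL : ∀ ζ : L2R, (∫ ψ, ‖ζ ψ‖ ^ (2 : ℝ)) ^ (1 / 2 : ℝ) = ‖ζ‖ := fun ζ => by
      rw [Lp.norm_def, MemLp.eLpNorm_eq_integral_rpow_norm two_ne_zero (by simp) (Lp.memLp ζ),
        ENNReal.toReal_ofReal (by positivity)]
      norm_num
    rw [integral_sub_right_eq_self (fun ψ => ‖ξ ψ‖ ^ (2 : ℝ)), hL, hL]
  have hGm : AEStronglyMeasurable (fun q : (ℝ × ℝ) × ℝ => G q.1 *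
      ((Circle.exp (-(t * q.1.1 * q.2)) : ℂ) * ξ (q.2 - q.1.2) * (starRingEnd ℂ) (η q.2)))
      ((volume : Measure (ℝ × ℝ)).prod volume) := hG.1.comp_fst.mul hm.aestronglyMeasurable
  refine (integrable_prod_iff hGm).2
    ⟨Filter.Eventually.of_forall fun p => (hi p).const_mul (G p), ?_⟩
  simp only [norm_mul (G _), integral_const_mul]
  exact hG.norm.mul_bdd (c := ‖ξ‖ * ‖η‖) hm.norm.aestronglyMeasurable.integral_prod_right'
    (Filter.Eventually.of_forall fun p => by
      rw [Real.norm_of_nonneg (integral_nonneg fun _ => norm_nonneg _)]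
      exact hn p)

/-- The shear `(ψ, u) ↦ (ψ, ψ - u)`. -/
theorem measurePreserving_prod_snd_sub :
    MeasurePreserving (fun p : ℝ × ℝ => (p.1, p.1 - p.2)) volume volume :=
  (MeasurePreserving.id (volume : Measure ℝ)).skew_product (g := fun a b => a - b)
    (by fun_prop) (Filter.Eventually.of_forall fun a =>
      (Measure.measurePreserving_sub_left volume a).map_eq)

variable [IsTopologicalAddGroup K] [CompactSpace K] [MeasurableSpace K] [BorelSpace K]

/-- The integral kernel of the operator `π_t(f)`. -/
noncomputable def schrodingerKernel (f : HeisK φ₀ → ℂ) (t : dualSubgroup φ₀) (p : ℝ × ℝ) : ℂ :=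
  ∫ y, (Circle.exp (-(t * y * p.1)) : ℂ) * HeisK.slice f t (y, p.1 - p.2)

/-- Fubini brings `ψ` outside, and the substitution `u = ψ - x` shows the kernel. Working weakly
avoids pointwise evaluation of an `L²`-valued integral. -/
theorem inner_integrated_schrodingerRep (t : dualSubgroup φ₀) {f : HeisK φ₀ → ℂ}
    (hf : Integrable f) (ξ η : L2R) :
    inner ℂ η ((schrodingerRep φ₀ t).integrated f hf ξ)
      = ∫ ψ, (∫ u, schrodingerKernel f t (ψ, u) * ξ u) * (starRingEnd ℂ) (η ψ) := by
  have hi := integrable_weyl_kernel (HeisK.integrable_slice hf t) t ξ η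
  rw [(hasCentralChar_schrodingerRep t).inner_integrated_apply hf]
  simp only [inner_schrodingerRep_mk, ← integral_const_mul]
  rw [integral_integral_swap (f := fun (p : ℝ × ℝ) (ψ : ℝ) => HeisK.slice f t p *
    ((Circle.exp (-(t * p.1 * ψ)) : ℂ) * ξ (ψ - p.2) * (starRingEnd ℂ) (η ψ))) hi]
  refine integral_congr_ae ?_
  filter_upwards [hi.prod_left_ae] with ψ hψ
  rw [Measure.volume_eq_prod, integral_prod_symm _ hψ, ← integral_mul_const,
    ← integral_sub_left_eq_self _ volume ψ]
  refine integral_congr_ae (Filter.Eventually.of_forall fun u => ?_)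
  simp only [schrodingerKernel, ← integral_mul_const]
  refine integral_congr_ae (Filter.Eventually.of_forall fun y => ?_)
  simp only [sub_sub_cancel]
  ring

variable {t : dualSubgroup φ₀} {f : HeisK φ₀ → ℂ}

theorem aestronglyMeasurable_schrodingerKernel (t : dualSubgroup φ₀) (hf : Integrable f) :
    AEStronglyMeasurable (schrodingerKernel f t) volume :=
  (aestronglyMeasurable_partial_integral_exp (HeisK.integrable_slice hf t).1
    (t : ℝ)).comp_measurePreserving measurePreserving_prod_snd_sub

/-- The kernel is the partial Fourier transform of the slice, composed with a measure preserving
shear. -/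
theorem lintegral_schrodingerKernel_sq [T2Space K] (ht : t ≠ 0) (hf : Integrable f) (hf2 : MemLp f 2) :
    ∫⁻ p, ‖schrodingerKernel f t p‖ₑ ^ 2
      = ENNReal.ofReal (2 * Real.pi / |(t : ℝ)|) * ∫⁻ p, ‖HeisK.slice f t p‖ₑ ^ 2 := by
  have hm := (aestronglyMeasurable_partial_integral_exp (HeisK.integrable_slice hf t).1
    (t : ℝ)).enorm.pow_const 2
  rw [Measure.volume_eq_prod, ← lintegral_partial_integral_exp_sq (HeisK.integrable_slice hf t)
    (HeisK.memLp_slice hf2 t) fun h => ht (Subtype.ext h)]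
  have h := measurePreserving_prod_snd_sub
  rw [Measure.volume_eq_prod] at h
  conv_rhs => rw [← h.map_eq]
  rw [lintegral_map' (by rw [h.map_eq]; exact hm) h.measurable.aemeasurable]
  rfl

theorem hilbertSchmidtNormSq_schrodingerRep [T2Space K] (ht : t ≠ 0) (hf : Integrable f) (hf2 : MemLp f 2) :
    hilbertSchmidtNormSq ((schrodingerRep φ₀ t).integrated f hf)
      = ENNReal.ofReal (2 * Real.pi / |(t : ℝ)|) * ∫⁻ p, ‖HeisK.slice f t p‖ₑ ^ 2 := by
  have : Fact ((2 : ℝ≥0∞) ≠ ∞) := ⟨by simp⟩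
  obtain ⟨w, b, -⟩ := exists_hilbertBasis ℂ L2R
  have : Countable w := b.countable
  have hk : MemLp (schrodingerKernel f t) 2 := by
    rw [memLp_two_iff_lintegral (aestronglyMeasurable_schrodingerKernel t hf),
      lintegral_schrodingerKernel_sq ht hf hf2]
    exact ENNReal.mul_lt_top ENNReal.ofReal_lt_top
      ((memLp_two_iff_lintegral (HeisK.memLp_slice hf2 t).1).1 (HeisK.memLp_slice hf2 t))
  have hsum := tsum_lintegral_integral_mul_basis b (μ := (volume : Measure ℝ)) hk
  have hR : ∀ n, MemLp (fun ψ => ∫ u, schrodingerKernel f t (ψ, u) * b n u) 2 := fun n => by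
    have hm : AEStronglyMeasurable (fun p : ℝ × ℝ => schrodingerKernel f t p * b n p.2)
        ((volume : Measure ℝ).prod volume) :=
      hk.1.mul (Lp.aestronglyMeasurable (b n)).comp_snd
    rw [memLp_two_iff_lintegral hm.integral_prod_right']
    refine lt_of_le_of_lt ?_ ((memLp_two_iff_lintegral hk.1).1 hk)
    rw [Measure.volume_eq_prod, ← hsum]
    exact ENNReal.le_tsum (f := fun i => ∫⁻ ψ, ‖∫ u, schrodingerKernel f t (ψ, u) * b i u‖ₑ ^ 2) n
  have hT : ∀ n, (schrodingerRep φ₀ t).integrated f hf (b n) = (hR n).toLp _ := fun n => by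
    refine ext_inner_left ℂ fun η => ?_
    rw [inner_integrated_schrodingerRep, L2.inner_def]
    refine integral_congr_ae ?_
    filter_upwards [(hR n).coeFn_toLp] with ψ hψ
    rw [hψ, RCLike.inner_apply]
  rw [hilbertSchmidtNormSq_eq b, ← lintegral_schrodingerKernel_sq ht hf hf2,
    Measure.volume_eq_prod, ← hsum]
  refine tsum_congr fun n => ?_
  rw [hT, Lp.enorm_sq_eq_lintegral]
  refine lintegral_congr_ae ?_
  filter_upwards [(hR n).coeFn_toLp] with ψ hψ
  rw [hψ]

theorem hilbertSchmidtNormSq_planeRep (hdense : DenseRange φ₀) (w : ℝ × ℝ) (hf : Integrable f) :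
    hilbertSchmidtNormSq ((planeRep φ₀ w).integrated f hf)
      = ‖∫ p : ℝ × ℝ, (Circle.exp (p.2 * w.1 + p.1 * w.2) : ℂ) * HeisK.slice f 0 p‖ₑ ^ 2 :=
  hilbertSchmidtNormSq_of_apply_eq_mul (integrated_planeRep hdense w hf)

/-- The Plancherel formula, summed over the explicit representations. -/
theorem tsum_hilbertSchmidtNormSq_add_lintegral [T2Space K]
    (hcont : Continuous φ₀) (hdense : DenseRange φ₀)
    (hf : Integrable f) (hf2 : MemLp f 2) :
    ∑' t : {t : dualSubgroup φ₀ // t ≠ 0}, ENNReal.ofReal (|(t.1 : ℝ)| / (2 * Real.pi))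
        * hilbertSchmidtNormSq ((schrodingerRep φ₀ t.1).integrated f hf)
      + ENNReal.ofReal (1 / (4 * Real.pi ^ 2))
        * ∫⁻ w, hilbertSchmidtNormSq ((planeRep φ₀ w).integrated f hf)
      = eLpNorm f 2 volume ^ 2 := by
  have h1 : ∀ t : {t : dualSubgroup φ₀ // t ≠ 0}, ENNReal.ofReal (|(t.1 : ℝ)| / (2 * Real.pi))
      * hilbertSchmidtNormSq ((schrodingerRep φ₀ t.1).integrated f hf)
      = ∫⁻ p, ‖HeisK.slice f t.1 p‖ₑ ^ 2 := fun t => by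
    have ht : |(t.1 : ℝ)| ≠ 0 := abs_ne_zero.2 fun h => t.2 (Subtype.ext h)
    rw [hilbertSchmidtNormSq_schrodingerRep t.2 hf hf2, ← mul_assoc,
      ← ENNReal.ofReal_mul (by positivity)]
    have : |(t.1 : ℝ)| / (2 * Real.pi) * (2 * Real.pi / |(t.1 : ℝ)|) = 1 := by field_simp
    rw [this, ENNReal.ofReal_one, one_mul]
  simp only [h1, hilbertSchmidtNormSq_planeRep hdense]
  rw [lintegral_enorm_integral_exp_plane_sq (HeisK.integrable_slice hf 0)
    (HeisK.memLp_slice hf2 0), ← mul_assoc, ← ENNReal.ofReal_mul (by positivity),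
    one_div_mul_cancel (by positivity), ENNReal.ofReal_one, one_mul,
    ← HeisK.tsum_lintegral_slice_sq hcont hdense hf2,
    ENNReal.tsum_eq_add_tsum_ite (f := fun t => ∫⁻ p, ‖HeisK.slice f t p‖ₑ ^ 2) 0, add_comm]
  congr 1
  classical
  refine (tsum_subtype {t : dualSubgroup φ₀ | t ≠ 0}
    (fun t => ∫⁻ p, ‖HeisK.slice f t p‖ₑ ^ 2)).trans (tsum_congr fun t => ?_)
  by_cases h : t = 0 <;> simp [h]

end HilbertSchmidt

/-! ## The dual of `HeisK` as a set -/

section Transport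

variable {G : Type*} [Group G] [TopologicalSpace G]
  {H : Type*} [NormedAddCommGroup H] [InnerProductSpace ℂ H]
  {H' : Type*} [NormedAddCommGroup H'] [InnerProductSpace ℂ H']

/-- The dual is formed from Hilbert spaces in universe `v`, whereas `L²(ℝ)` and `ℂ` live in `Type`;
lifting them gives bundles in the right universe. -/
noncomputable instance ULift.innerProductSpace : InnerProductSpace ℂ (ULift.{v} H) where
  inner x y := inner ℂ x.down y.down
  norm_sq_eq_re_inner x := norm_sq_eq_re_inner (𝕜 := ℂ) x.down
  conj_inner_symm x y := inner_conj_symm x.down y.down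
  add_left x y z := inner_add_left x.down y.down z.down
  smul_left x y r := inner_smul_left x.down y.down r

namespace UnitaryRep

/-- The transport of a representation to an isomorphic Hilbert space. -/
def conj (ρ : UnitaryRep G H) (U : H ≃ₗᵢ[ℂ] H') : UnitaryRep G H' where
  toHom :=
    { toFun := fun g => (U.symm.trans (ρ.toHom g)).trans U
      map_one' := by ext ξ; simp
      map_mul' := fun g h => by ext ξ; simp }
  continuous_apply ξ := U.continuous.comp (ρ.continuous_apply (U.symm ξ))

theorem isEquivalent_conj (ρ : UnitaryRep G H) (U : H ≃ₗᵢ[ℂ] H') : ρ.IsEquivalent (ρ.conj U) :=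
  ⟨U, fun g ξ => by
    change _ = U (ρ.toHom g (U.symm (U ξ)))
    rw [LinearIsometryEquiv.symm_apply_apply]⟩

theorem IsIrreducible.of_isEquivalent {ρ : UnitaryRep G H} {σ : UnitaryRep G H'}
    (hρ : ρ.IsIrreducible) (h : ρ.IsEquivalent σ) : σ.IsIrreducible := by
  obtain ⟨U, hU⟩ := h
  have := hρ.1
  refine ⟨U.toEquiv.symm.nontrivial, fun W hWc hW => ?_⟩
  have hmem : ∀ ξ, ξ ∈ W.comap U.toLinearEquiv.toLinearMap ↔ U ξ ∈ W := fun ξ => Iff.rfl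
  rcases hρ.2 (W.comap U.toLinearEquiv.toLinearMap) (hWc.preimage U.continuous)
    (fun g ξ hξ => by
      rw [hmem] at hξ ⊢
      rw [hU]
      exact hW g _ hξ) with h | h
  · refine Or.inl ((Submodule.eq_bot_iff _).2 fun η hη => ?_)
    have h1 : U.symm η ∈ W.comap U.toLinearEquiv.toLinearMap := by
      rw [hmem, LinearIsometryEquiv.apply_symm_apply]
      exact hη
    rw [h, Submodule.mem_bot] at h1
    simpa using h1
  · refine Or.inr ((Submodule.eq_top_iff').2 fun η => ?_)
    have h1 : U.symm η ∈ W.comap U.toLinearEquiv.toLinearMap := h ▸ Submodule.mem_top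
    rwa [hmem, LinearIsometryEquiv.apply_symm_apply] at h1

end UnitaryRep

end Transport

namespace UnitaryDual

variable {G : Type u} [Group G] [TopologicalSpace G]
  {H : Type*} [NormedAddCommGroup H] [InnerProductSpace ℂ H]
  {H' : Type*} [NormedAddCommGroup H'] [InnerProductSpace ℂ H']

theorem exists_isClassOf {H : Type} [NormedAddCommGroup H] [InnerProductSpace ℂ H]
    [CompleteSpace H] {ρ : UnitaryRep G H} (hρ : ρ.IsIrreducible) :
    ∃ c : UnitaryDual.{u, v} G, c.IsClassOf ρ := by
  have h := ρ.isEquivalent_conj (LinearIsometryEquiv.ulift.{0, 0, v} ℂ H).symm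
  have : CompleteSpace (ULift.{v} H) :=
    (LinearIsometryEquiv.ulift.{0, 0, v} ℂ H).symm.toIsometryEquiv.completeSpace_iff.1 inferInstance
  let b : IrrepBundle.{u, v} G :=
    ⟨ULift.{v} H, ρ.conj (LinearIsometryEquiv.ulift ℂ H).symm, hρ.of_isEquivalent h⟩
  refine ⟨Quotient.mk _ b, ?_⟩
  have h1 : (Quotient.out (Quotient.mk (irrepSetoid G) b)).rep.IsEquivalent b.rep :=
    Quotient.mk_out b
  exact h1.trans h.symm

theorem IsClassOf.eq {ρ : UnitaryRep G H} {σ : UnitaryRep G H'} {c c' : UnitaryDual.{u, v} G}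
    (hc : c.IsClassOf ρ) (hc' : c'.IsClassOf σ) (h : ρ.IsEquivalent σ) : c = c' := by
  rw [← Quotient.out_eq c, ← Quotient.out_eq c']
  have h1 : c.out.rep.IsEquivalent c'.out.rep := (hc.trans h).trans hc'.symm
  exact Quotient.sound h1

variable [SigmaCompactSpace G] [MeasureSpace G] [BorelSpace G]

theorem _root_.UnitaryRep.integrated_intertwine [CompleteSpace H] [CompleteSpace H']
    {ρ : UnitaryRep G H} {σ : UnitaryRep G H'}
    {U : H ≃ₗᵢ[ℂ] H'} (hU : ∀ g ξ, U (ρ.toHom g ξ) = σ.toHom g (U ξ)) {f : G → ℂ}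
    (hf : Integrable f) (ξ : H) : U (ρ.integrated f hf ξ) = σ.integrated f hf (U ξ) := by
  change U (∫ g, f g • ρ.toHom g ξ) = ∫ g, f g • σ.toHom g (U ξ)
  have h := U.toContinuousLinearEquiv.toContinuousLinearMap.integral_comp_comm
    (ρ.integrable_smul_apply ξ hf)
  refine h.symm.trans (integral_congr_ae (Filter.Eventually.of_forall fun g => ?_))
  change U (f g • ρ.toHom g ξ) = _
  rw [map_smul, hU]

theorem IsClassOf.hilbertSchmidtNormSq [CompleteSpace H] {ρ : UnitaryRep G H}
    {c : UnitaryDual.{u, v} G} (hc : c.IsClassOf ρ) {f : G → ℂ} (hf : Integrable f) :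
    hilbertSchmidtNormSq (c.out.rep.integrated f hf)
      = hilbertSchmidtNormSq (ρ.integrated f hf) := by
  obtain ⟨U, hU⟩ := hc
  exact hilbertSchmidtNormSq_conj U (UnitaryRep.integrated_intertwine hU hf)

theorem IsClassOf.norm_integrated [CompleteSpace H] {ρ : UnitaryRep G H}
    {c : UnitaryDual.{u, v} G} (hc : c.IsClassOf ρ) {f : G → ℂ} (hf : Integrable f) :
    ‖c.out.rep.integrated f hf‖ = ‖ρ.integrated f hf‖ := by
  obtain ⟨U, hU⟩ := hc
  have h := UnitaryRep.integrated_intertwine hU hf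
  refine le_antisymm (ContinuousLinearMap.opNorm_le_bound _ (norm_nonneg _) fun ξ => ?_)
    (ContinuousLinearMap.opNorm_le_bound _ (norm_nonneg _) fun η => ?_)
  · rw [← U.norm_map, h, ← U.norm_map ξ]
    exact ContinuousLinearMap.le_opNorm _ _
  · obtain ⟨ξ, rfl⟩ := U.surjective η
    rw [← h, U.norm_map, U.norm_map]
    exact ContinuousLinearMap.le_opNorm _ _

end UnitaryDual

/-! ### The bijection between the parameters and the dual -/

section DualEquiv

variable {K : Type u} [AddCommGroup K] [TopologicalSpace K] {φ₀ : ℝ →+ K}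

/-- The classification of the irreducible representations of `HeisK`. -/
theorem exists_dualEquiv (hcont : Continuous φ₀) (hdense : DenseRange φ₀) :
    ∃ Φ : {t : dualSubgroup φ₀ // t ≠ 0} ⊕ (ℝ × ℝ) ≃ UnitaryDual.{u, v} (HeisK φ₀),
      (∀ t, (Φ (Sum.inl t)).IsClassOf (schrodingerRep φ₀ t.1)) ∧
      (∀ w, (Φ (Sum.inr w)).IsClassOf (planeRep φ₀ w)) := by
  choose A hA using fun t : {t : dualSubgroup φ₀ // t ≠ 0} =>
    UnitaryDual.exists_isClassOf.{u, v} (isIrreducible_schrodingerRep t.2)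
  choose B hB using fun w : ℝ × ℝ =>
    UnitaryDual.exists_isClassOf.{u, v} (isIrreducible_planeRep (φ₀ := φ₀) w)
  have hAc : ∀ t, HasCentralChar (A t).out.rep t.1 := fun t =>
    (hasCentralChar_schrodingerRep t.1).of_isEquivalent (hA t).symm
  have hBc : ∀ w, HasCentralChar (B w).out.rep 0 := fun w =>
    (hasCentralChar_planeRep hdense w).of_isEquivalent (hB w).symm
  have hnt : ∀ c : UnitaryDual.{u, v} (HeisK φ₀), Nontrivial c.out.space := fun c =>
    c.out.irreducible.1
  refine ⟨Equiv.ofBijective (Sum.elim A B) ⟨?_, fun c => ?_⟩, hA, hB⟩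
  -- The central character separates the `π_t` from one another and from the plane; only two plane
  -- representations need a comparison of their own.
  · rintro (s | w) (t | w') h
    · have h1 := hAc t
      rw [← show A s = A t from h] at h1
      exact congrArg _ (Subtype.ext ((hAc s).unique h1))
    · have h1 := hBc w'
      rw [← show A s = B w' from h] at h1
      exact absurd ((hAc s).unique h1) s.2
    · have h1 := hBc w
      rw [show B w = A t from h] at h1
      exact absurd ((hAc t).unique h1) t.2
    · have h1 := hB w'
      rw [← show B w = B w' from h] at h1
      exact congrArg _ (isEquivalent_planeRep_iff.1 ((hB w).symm.trans h1))
  · have hc : c.IsClassOf c.out.rep := ⟨LinearIsometryEquiv.refl ℂ _, fun _ _ => rfl⟩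
    obtain ⟨t, ht⟩ := exists_hasCentralChar hcont hdense c.out.irreducible
    by_cases h0 : t = 0
    · subst h0
      obtain ⟨w, hw⟩ := exists_isEquivalent_planeRep hdense c.out.irreducible ht
      exact ⟨Sum.inr w, UnitaryDual.IsClassOf.eq (hB w) hc hw.symm⟩
    · exact ⟨Sum.inl ⟨t, h0⟩, UnitaryDual.IsClassOf.eq (hA ⟨t, h0⟩) hc
        (isEquivalent_of_hasCentralChar (isIrreducible_schrodingerRep h0) c.out.irreducible h0
          (hasCentralChar_schrodingerRep t) ht)⟩

end DualEquiv

/-! ## Test functions -/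

section TestFunctions

variable {K : Type*} [AddCommGroup K] [TopologicalSpace K] [IsTopologicalAddGroup K]
  [CompactSpace K] [MeasurableSpace K] [BorelSpace K] {φ₀ : ℝ →+ K}

namespace HeisK

/-- The function `((y, k) x) ↦ conj (χ_t k) h (y, x)`. -/
noncomputable def tensor (t : dualSubgroup φ₀) (h : ℝ × ℝ → ℂ) (g : HeisK φ₀) : ℂ :=
  ((dualChar φ₀ t g.k)⁻¹ : Circle) * h (g.y, g.x)

theorem measurePreserving_yx :
    MeasurePreserving (fun g : HeisK φ₀ => (g.y, g.x)) volume volume :=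
  measurePreserving_fst.comp (measurePreserving_planeCoord_symm (φ₀ := φ₀)).symm

variable {t : dualSubgroup φ₀} {h : ℝ × ℝ → ℂ}

theorem integrable_tensor (t : dualSubgroup φ₀) (hh : Integrable h) : Integrable (tensor t h) := by
  have hc : Continuous fun g : HeisK φ₀ => (((dualChar φ₀ t g.k)⁻¹ : Circle) : ℂ) :=
    Continuous.subtype_val ((continuous_dualChar φ₀ t).comp (continuous_k φ₀)).inv
  exact (measurePreserving_yx.integrable_comp_of_integrable hh).bdd_mul (c := 1)
    hc.aestronglyMeasurable (Filter.Eventually.of_forall fun _ => (Circle.norm_coe _).le)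

theorem memLp_tensor (t : dualSubgroup φ₀) (hh : MemLp h 2) : MemLp (tensor t h) 2 := by
  have hc : Continuous fun g : HeisK φ₀ => (((dualChar φ₀ t g.k)⁻¹ : Circle) : ℂ) :=
    Continuous.subtype_val ((continuous_dualChar φ₀ t).comp (continuous_k φ₀)).inv
  have h1 := hh.comp_measurePreserving (measurePreserving_yx (φ₀ := φ₀))
  refine (memLp_congr_norm (hc.aestronglyMeasurable.mul h1.1) h1.1
    (Filter.Eventually.of_forall fun g => ?_)).2 h1
  rw [Pi.mul_apply, norm_mul, Circle.norm_coe, one_mul]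

theorem slice_tensor_self (t : dualSubgroup φ₀) (h : ℝ × ℝ → ℂ) : slice (tensor t h) t = h := by
  funext p
  have : ∀ k, tensor t h ⟨p.1, k, p.2⟩ * (dualChar φ₀ t k : ℂ) = h p := fun k => by
    simp only [tensor]
    rw [mul_right_comm, ← Circle.coe_mul, inv_mul_cancel, Circle.coe_one, one_mul]
  simp [slice, this]

theorem slice_tensor_of_ne {s t : dualSubgroup φ₀} (hst : s ≠ t) (h : ℝ × ℝ → ℂ) :
    slice (tensor s h) t = 0 := by
  funext p
  have : ∀ k, tensor s h ⟨p.1, k, p.2⟩ * (dualChar φ₀ t k : ℂ)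
      = h p * (((dualChar φ₀ t * (dualChar φ₀ s)⁻¹ : AddChar K Circle) k : Circle) : ℂ) :=
    fun k => by
      simp only [tensor]
      rw [AddChar.mul_apply, AddChar.inv_apply', Circle.coe_mul]
      ring
  have hχ : dualChar φ₀ t * (dualChar φ₀ s)⁻¹ ≠ 1 := fun h1 =>
    hst (dualChar_injective (mul_inv_eq_one.1 h1).symm)
  simp only [slice, this, integral_const_mul, integral_addChar_eq_zero hχ, mul_zero,
    Pi.zero_apply]

theorem eLpNorm_tensor_sq [T2Space K] (hcont : Continuous φ₀) (hdense : DenseRange φ₀)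
    (t : dualSubgroup φ₀) (hh : MemLp h 2) :
    eLpNorm (tensor t h) 2 volume ^ 2 = ∫⁻ p, ‖h p‖ₑ ^ 2 := by
  rw [← tsum_lintegral_slice_sq hcont hdense (memLp_tensor t hh), tsum_eq_single t fun s hs => by
    simp [slice_tensor_of_ne hs.symm], slice_tensor_self]

end HeisK

/-- By orthogonality of characters the test function of `s` has no Fourier coefficient at `t`.
Tensor functions thus localize on a single central character, both for the topology and for the
values of a Plancherel measure. -/
theorem HasCentralChar.integrated_tensor_of_ne {H : Type*} [NormedAddCommGroup H]
    [InnerProductSpace ℂ H] [CompleteSpace H] {ρ : UnitaryRep (HeisK φ₀) H}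
    {s t : dualSubgroup φ₀} (hρ : HasCentralChar ρ t) (hst : s ≠ t) {h : ℝ × ℝ → ℂ}
    (hi : Integrable (HeisK.tensor s h)) : ρ.integrated (HeisK.tensor s h) hi = 0 := by
  ext ξ
  rw [hρ.integrated_apply, HeisK.slice_tensor_of_ne hst]
  simp

theorem norm_integrated_planeRep (hdense : DenseRange φ₀) (w : ℝ × ℝ) {f : HeisK φ₀ → ℂ}
    (hf : Integrable f) : ‖(planeRep φ₀ w).integrated f hf‖
      = ‖∫ p : ℝ × ℝ, (Circle.exp (p.2 * w.1 + p.1 * w.2) : ℂ) * HeisK.slice f 0 p‖ := by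
  have : (planeRep φ₀ w).integrated f hf
      = (∫ p : ℝ × ℝ, (Circle.exp (p.2 * w.1 + p.1 * w.2) : ℂ) * HeisK.slice f 0 p)
        • ContinuousLinearMap.id ℂ ℂ := by
    ext
    rw [integrated_planeRep hdense]
    simp
  rw [this, norm_smul, ContinuousLinearMap.norm_id, mul_one]

end TestFunctions

/-! ## Fourier transforms on the plane -/

section Plane

/-- The Fourier transform on `ℝ²` that occurs in the representations `χ_w`. -/
noncomputable def planeTransform (h : ℝ × ℝ → ℂ) (w : ℝ × ℝ) : ℂ :=
  ∫ p : ℝ × ℝ, (Circle.exp (p.2 * w.1 + p.1 * w.2) : ℂ) * h p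

variable {h : ℝ × ℝ → ℂ}

theorem integrable_exp_mul_plane (hh : Integrable h) (w : ℝ × ℝ) :
    Integrable fun p : ℝ × ℝ => (Circle.exp (p.2 * w.1 + p.1 * w.2) : ℂ) * h p :=
  hh.bdd_mul (c := 1) (Continuous.aestronglyMeasurable (by fun_prop))
    (Filter.Eventually.of_forall fun _ => (Circle.norm_coe _).le)

theorem continuous_planeTransform (hh : Integrable h) : Continuous (planeTransform h) := by
  refine continuous_of_dominated (fun w => (integrable_exp_mul_plane hh w).1)
    (fun w => Filter.Eventually.of_forall fun p => ?_) hh.norm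
    (Filter.Eventually.of_forall fun p => by fun_prop)
  rw [norm_mul, Circle.norm_coe, one_mul]

theorem planeTransform_exp_mul (h : ℝ × ℝ → ℂ) (v w : ℝ × ℝ) :
    planeTransform (fun p => (Circle.exp (-(p.2 * v.1 + p.1 * v.2)) : ℂ) * h p) w
      = planeTransform h (w - v) := by
  refine integral_congr_ae (Filter.Eventually.of_forall fun p => ?_)
  simp only
  rw [← mul_assoc, ← Circle.coe_mul, ← Circle.exp_add, Prod.fst_sub, Prod.snd_sub]
  congr 3
  ring

theorem planeTransform_sub (h : ℝ × ℝ → ℂ) (v w : ℝ × ℝ) :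
    planeTransform (fun p => h (p - v)) w
      = (Circle.exp (v.2 * w.1 + v.1 * w.2) : ℂ) * planeTransform h w := by
  simp only [planeTransform]
  rw [← integral_const_mul, ← integral_add_right_eq_self _ v]
  refine integral_congr_ae (Filter.Eventually.of_forall fun p => ?_)
  simp only [add_sub_cancel_right]
  rw [← mul_assoc, ← Circle.coe_mul, ← Circle.exp_add, Prod.fst_add, Prod.snd_add]
  congr 3
  ring

/-- The standard Gaussian function on the plane. -/
noncomputable def planeGaussian (p : ℝ × ℝ) : ℂ :=
  Complex.exp (-Real.pi * (p.1 : ℂ) ^ 2) * Complex.exp (-Real.pi * (p.2 : ℂ) ^ 2)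

theorem integrable_planeGaussian : Integrable planeGaussian := by
  have h1 : Integrable fun x : ℝ => Complex.exp (-Real.pi * (x : ℂ) ^ 2) :=
    integrable_cexp_neg_mul_sq (by simpa using Real.pi_pos)
  exact h1.mul_prod h1

theorem enorm_planeGaussian_le (p : ℝ × ℝ) : ‖planeGaussian p‖ₑ ≤ 1 := by
  have h1 : ∀ x : ℝ, ‖Complex.exp (-Real.pi * (x : ℂ) ^ 2)‖ ≤ 1 := fun x => by
    have : (-Real.pi * (x : ℂ) ^ 2 : ℂ) = ((-Real.pi * x ^ 2 : ℝ) : ℂ) := by push_cast; ring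
    rw [this, Complex.norm_exp_ofReal, Real.exp_le_one_iff]
    nlinarith [Real.pi_pos, sq_nonneg x]
  rw [← ofReal_norm, planeGaussian, norm_mul, ← ENNReal.ofReal_one]
  exact ENNReal.ofReal_le_ofReal (mul_le_one₀ (h1 _) (norm_nonneg _) (h1 _))

theorem memLp_planeGaussian : MemLp planeGaussian 2 := by
  rw [memLp_two_iff_lintegral integrable_planeGaussian.1]
  refine lt_of_le_of_lt (lintegral_mono fun p => ?_) integrable_planeGaussian.2
  rw [sq]
  exact mul_le_of_le_one_left' (enorm_planeGaussian_le p)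

theorem planeTransform_planeGaussian (w : ℝ × ℝ) :
    planeTransform planeGaussian w
      = (Real.exp (-(w.1 ^ 2 + w.2 ^ 2) / (4 * Real.pi)) : ℂ) := by
  have hπ : (Real.pi : ℂ) ≠ 0 := by exact_mod_cast Real.pi_ne_zero
  have h1 : ∀ a : ℝ, ∫ x : ℝ, (Circle.exp (x * a) : ℂ) * Complex.exp (-Real.pi * (x : ℂ) ^ 2)
      = Complex.exp (-(a : ℂ) ^ 2 / (4 * Real.pi)) := fun a => by
    have h2 := fourierIntegral_gaussian (b := Real.pi) (by simpa using Real.pi_pos) a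
    rw [div_self hπ, Complex.one_cpow, one_mul] at h2
    rw [← h2]
    refine integral_congr_ae (Filter.Eventually.of_forall fun x => ?_)
    simp only [Circle.coe_exp]
    congr 2
    push_cast
    ring
  have h3 : ∀ p : ℝ × ℝ, (Circle.exp (p.2 * w.1 + p.1 * w.2) : ℂ) * planeGaussian p
      = ((Circle.exp (p.1 * w.2) : ℂ) * Complex.exp (-Real.pi * (p.1 : ℂ) ^ 2))
        * ((Circle.exp (p.2 * w.1) : ℂ) * Complex.exp (-Real.pi * (p.2 : ℂ) ^ 2)) := fun p => by
    rw [Circle.exp_add, Circle.coe_mul, planeGaussian]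
    ring
  simp only [planeTransform, h3]
  rw [Measure.volume_eq_prod, integral_prod_mul (μ := (volume : Measure ℝ))
    (ν := (volume : Measure ℝ))
    (fun x : ℝ => (Circle.exp (x * w.2) : ℂ) * Complex.exp (-Real.pi * (x : ℂ) ^ 2))
    (fun x : ℝ => (Circle.exp (x * w.1) : ℂ) * Complex.exp (-Real.pi * (x : ℂ) ^ 2)),
    h1, h1, ← Complex.exp_add, Complex.ofReal_exp]
  congr 1
  push_cast
  ring

theorem lintegral_planeTransform_sq (h1 : Integrable h) (h2 : MemLp h 2) :
    ENNReal.ofReal (1 / (4 * Real.pi ^ 2)) * ∫⁻ w, ‖planeTransform h w‖ₑ ^ 2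
      = ∫⁻ p, ‖h p‖ₑ ^ 2 := by
  refine (congrArg _ (lintegral_enorm_integral_exp_plane_sq h1 h2)).trans ?_
  rw [← mul_assoc, ← ENNReal.ofReal_mul (by positivity), one_div_mul_cancel (by positivity),
    ENNReal.ofReal_one, one_mul]

theorem lintegral_planeGaussian_sq_ne_zero : ∫⁻ p, ‖planeGaussian p‖ₑ ^ 2 ≠ 0 := by
  intro h0
  have hm : AEMeasurable (fun p : ℝ × ℝ => ‖planeGaussian p‖ₑ ^ 2) :=
    integrable_planeGaussian.1.enorm.pow_const 2
  rw [lintegral_eq_zero_iff' hm] at h0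
  obtain ⟨p, hp⟩ := h0.exists
  simp [planeGaussian] at hp

/-- A measure on the plane is determined by its values on the squared moduli of Fourier
transforms. -/
theorem measure_ext_of_lintegral_planeTransform_sq {μ ν : Measure (ℝ × ℝ)}
    (h : ∀ h : ℝ × ℝ → ℂ, Integrable h → MemLp h 2 →
      ∫⁻ w, ‖planeTransform h w‖ₑ ^ 2 ∂μ = ∫⁻ w, ‖planeTransform h w‖ₑ ^ 2 ∂ν)
    (hfin : ∫⁻ w, ‖planeTransform planeGaussian w‖ₑ ^ 2 ∂ν ≠ ∞) : μ = ν := by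
  -- The transform of the Gaussian vanishes nowhere, so this density can be divided out again. It
  -- makes both measures finite, as characteristic functions require.
  set ρ : ℝ × ℝ → ℝ≥0∞ := fun w => ‖planeTransform planeGaussian w‖ₑ ^ 2 with hρ
  have hρm : Measurable ρ :=
    (continuous_planeTransform integrable_planeGaussian).measurable.enorm.pow_const 2
  have hρ0 : ∀ w, ρ w ≠ 0 := fun w => by
    simp [hρ, planeTransform_planeGaussian]
  have hρt : ∀ w, ρ w ≠ ∞ := fun w => by simp [hρ]
  suffices hw : μ.withDensity ρ = ν.withDensity ρ by
    rw [← withDensity_inv_same hρm (μ := μ) (Filter.Eventually.of_forall hρ0)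
      (Filter.Eventually.of_forall hρt), hw, withDensity_inv_same hρm
      (Filter.Eventually.of_forall hρ0) (Filter.Eventually.of_forall hρt)]
  have hμ : IsFiniteMeasure (μ.withDensity ρ) := isFiniteMeasure_withDensity
    (by rw [h _ integrable_planeGaussian memLp_planeGaussian]; exact hfin)
  have hν : IsFiniteMeasure (ν.withDensity ρ) := isFiniteMeasure_withDensity hfin
  -- For the Gaussian plus `c` times its translate by `v`, the transform is that of the Gaussian
  -- times `1 + c exp (i (v₂ w₁ + v₁ w₂))`. The squared modulus of this factor contains the real
  -- part of the exponential times `c`.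
  have key : ∀ (c : Circle) (v : ℝ × ℝ),
      ∫⁻ w, ‖1 + (c * Circle.exp (v.2 * w.1 + v.1 * w.2) : ℂ)‖ₑ ^ 2 ∂(μ.withDensity ρ)
        = ∫⁻ w, ‖1 + (c * Circle.exp (v.2 * w.1 + v.1 * w.2) : ℂ)‖ₑ ^ 2 ∂(ν.withDensity ρ) := by
    intro c v
    have hm : Measurable fun w : ℝ × ℝ =>
        ‖1 + (c * Circle.exp (v.2 * w.1 + v.1 * w.2) : ℂ)‖ₑ ^ 2 :=
      (Continuous.measurable (by fun_prop)).enorm.pow_const 2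
    rw [lintegral_withDensity_eq_lintegral_mul _ hρm hm,
      lintegral_withDensity_eq_lintegral_mul _ hρm hm]
    have i2 : Integrable fun p => (c : ℂ) * planeGaussian (p - v) :=
      (integrable_planeGaussian.comp_sub_right v).const_mul _
    have m2 : MemLp (fun p => (c : ℂ) * planeGaussian (p - v)) 2 :=
      (memLp_planeGaussian.comp_measurePreserving
        (measurePreserving_sub_right volume v)).const_mul _
    have h1 := h (fun p => planeGaussian p + (c : ℂ) * planeGaussian (p - v))
      (integrable_planeGaussian.add i2) (memLp_planeGaussian.add m2)
    have e : ∀ w, planeTransform (fun p => planeGaussian p + (c : ℂ) * planeGaussian (p - v)) w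
        = planeTransform planeGaussian w
          * (1 + (c * Circle.exp (v.2 * w.1 + v.1 * w.2) : ℂ)) := fun w => by
      have e1 : planeTransform (fun p => planeGaussian p + (c : ℂ) * planeGaussian (p - v)) w
          = planeTransform planeGaussian w
            + planeTransform (fun p => (c : ℂ) * planeGaussian (p - v)) w := by
        simp only [planeTransform, mul_add]
        exact integral_add (integrable_exp_mul_plane integrable_planeGaussian w)
          (integrable_exp_mul_plane i2 w)
      have e2 : planeTransform (fun p => (c : ℂ) * planeGaussian (p - v)) w
          = (c : ℂ) * planeTransform (fun p => planeGaussian (p - v)) w := by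
        simp only [planeTransform, mul_left_comm _ (c : ℂ)]
        exact integral_const_mul _ _
      rw [e1, e2, planeTransform_sub]
      ring
    simp only [e, enorm_mul, mul_pow] at h1
    exact h1
  have hexp : ∀ (m : Measure (ℝ × ℝ)) [IsFiniteMeasure m] (v : ℝ × ℝ),
      Integrable (fun w : ℝ × ℝ => (Circle.exp (v.2 * w.1 + v.1 * w.2) : ℂ)) m := fun m _ v =>
    Integrable.of_bound (Continuous.aestronglyMeasurable (by fun_prop)) 1
      (Filter.Eventually.of_forall fun _ => (Circle.norm_coe _).le)
  have hre : ∀ (m : Measure (ℝ × ℝ)) [IsFiniteMeasure m] (c : Circle) (v : ℝ × ℝ),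
      (∫⁻ w, ‖1 + (c * Circle.exp (v.2 * w.1 + v.1 * w.2) : ℂ)‖ₑ ^ 2 ∂m).toReal
        = 2 * m.real Set.univ
          + 2 * ((c : ℂ) * ∫ w, (Circle.exp (v.2 * w.1 + v.1 * w.2) : ℂ) ∂m).re := by
    intro m _ c v
    have hi := (hexp m v).const_mul (c : ℂ)
    have e1 : ∀ z : Circle, ‖1 + (z : ℂ)‖ ^ 2 = 2 + 2 * (z : ℂ).re := fun z => by
      have h1 := Circle.normSq_coe z
      rw [Complex.normSq_apply] at h1
      rw [← Complex.normSq_eq_norm_sq, Complex.normSq_apply]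
      simp only [Complex.add_re, Complex.add_im, Complex.one_re, Complex.one_im]
      linarith
    have e2 : ∀ w : ℝ × ℝ, ‖1 + (c * Circle.exp (v.2 * w.1 + v.1 * w.2) : ℂ)‖ₑ ^ 2
        = ENNReal.ofReal (2 + 2 * (c * Circle.exp (v.2 * w.1 + v.1 * w.2) : ℂ).re) := fun w => by
      rw [← ofReal_norm, ← ENNReal.ofReal_pow (norm_nonneg _), ← Circle.coe_mul, e1]
    simp only [e2]
    rw [← ofReal_integral_eq_lintegral_ofReal, ENNReal.toReal_ofReal, integral_add,
      integral_const_mul, ← integral_const_mul (c : ℂ)]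
    · have := integral_re hi
      simp only [RCLike.re_eq_complex_re] at this
      rw [this]
      simp [mul_comm]
    · exact integrable_const _
    · exact hi.re.const_mul 2
    · refine integral_nonneg fun w => ?_
      rw [Pi.zero_apply, ← Circle.coe_mul, ← e1]
      positivity
    · exact (integrable_const _).add (hi.re.const_mul 2)
    · refine Filter.Eventually.of_forall fun w => ?_
      simp only [Pi.zero_apply]
      rw [← Circle.coe_mul, ← e1]
      positivity
  have hmass : (μ.withDensity ρ).real Set.univ = (ν.withDensity ρ).real Set.univ := by
    have h1 := congrArg ENNReal.toReal (key 1 0)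
    rw [hre, hre] at h1
    simp at h1
    linarith
  refine Measure.ext_of_charFunDual (funext fun L => ?_)
  rw [charFunDual_apply, charFunDual_apply]
  have hL : ∀ w : ℝ × ℝ, Complex.exp ((L w : ℂ) * Complex.I)
      = (Circle.exp (L (1, 0) * w.1 + L (0, 1) * w.2) : ℂ) := fun w => by
    have : L w = L (1, 0) * w.1 + L (0, 1) * w.2 := by
      have e : w = w.1 • ((1, 0) : ℝ × ℝ) + w.2 • ((0, 1) : ℝ × ℝ) := by ext <;> simp
      conv_lhs => rw [e]
      rw [map_add, map_smul, map_smul, smul_eq_mul, smul_eq_mul, mul_comm, mul_comm w.2]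
    rw [Circle.coe_exp, this]
  simp only [hL]
  have hc : ∀ c : Circle,
      ((c : ℂ) * ∫ w, (Circle.exp (L (1, 0) * w.1 + L (0, 1) * w.2) : ℂ) ∂(μ.withDensity ρ)).re
      = ((c : ℂ) * ∫ w, (Circle.exp (L (1, 0) * w.1 + L (0, 1) * w.2) : ℂ)
        ∂(ν.withDensity ρ)).re := fun c => by
    have h1 := congrArg ENNReal.toReal (key c (L (0, 1), L (1, 0)))
    rw [hre, hre, hmass] at h1
    simpa using h1
  -- The factor `c = 1` recovers the real part of the characteristic function, and `c = i` the
  -- imaginary part up to sign.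
  refine Complex.ext (by simpa using hc 1) ?_
  have h1 := hc (Circle.exp (Real.pi / 2))
  have hI : (Circle.exp (Real.pi / 2) : ℂ) = Complex.I := by
    rw [Circle.coe_exp]
    push_cast
    exact Complex.exp_pi_div_two_mul_I
  rw [hI, Complex.I_mul_re, Complex.I_mul_re] at h1
  exact neg_injective h1

end Plane

/-! ## The topology of the dual of `HeisK` -/

theorem UnitaryRep.integrated_smul {G : Type*} [Group G] [TopologicalSpace G] [SigmaCompactSpace G]
    [MeasureSpace G] [BorelSpace G] {H : Type*} [NormedAddCommGroup H] [InnerProductSpace ℂ H]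
    (ρ : UnitaryRep G H) (r : ℂ) {f : G → ℂ} (hf : Integrable f)
    (hrf : Integrable fun g => r * f g) : ρ.integrated (fun g => r * f g) hrf = r • ρ.integrated f hf := by
  ext ξ
  change ∫ g, (r * f g) • ρ.toHom g ξ = r • ∫ g, f g • ρ.toHom g ξ
  simp only [mul_smul]
  exact integral_smul _ _

theorem UnitaryDual.isOpen_setOf_one_lt_norm {G : Type u} [Group G] [TopologicalSpace G]
    [SigmaCompactSpace G] [MeasureSpace G] [BorelSpace G] {f : G → ℂ} (hf : Integrable f) :
    IsOpen {c : UnitaryDual.{u, v} G | 1 < ‖c.out.rep.integrated f hf‖} :=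
  TopologicalSpace.isOpen_generateFrom_of_mem ⟨f, hf, rfl⟩

section DualTopology

variable {K : Type u} [AddCommGroup K] [TopologicalSpace K] [IsTopologicalAddGroup K]
  [CompactSpace K] [MeasurableSpace K] [BorelSpace K] {φ₀ : ℝ →+ K}
  {Φ : {t : dualSubgroup φ₀ // t ≠ 0} ⊕ (ℝ × ℝ) ≃ UnitaryDual.{u, v} (HeisK φ₀)}

theorem integrated_out_inl_tensor (hΦt : ∀ t, (Φ (Sum.inl t)).IsClassOf (schrodingerRep φ₀ t.1))
    {s : dualSubgroup φ₀} {t : {t : dualSubgroup φ₀ // t ≠ 0}} (hst : s ≠ t.1) {h : ℝ × ℝ → ℂ}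
    (hi : Integrable (HeisK.tensor s h)) :
    (Φ (Sum.inl t)).out.rep.integrated (HeisK.tensor s h) hi = 0 :=
  ((hasCentralChar_schrodingerRep t.1).of_isEquivalent (hΦt t).symm).integrated_tensor_of_ne hst hi

theorem integrated_out_inr_tensor (hdense : DenseRange φ₀)
    (hΦw : ∀ w, (Φ (Sum.inr w)).IsClassOf (planeRep φ₀ w))
    {s : dualSubgroup φ₀} (hs : s ≠ 0) (w : ℝ × ℝ) {h : ℝ × ℝ → ℂ}
    (hi : Integrable (HeisK.tensor s h)) :
    (Φ (Sum.inr w)).out.rep.integrated (HeisK.tensor s h) hi = 0 :=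
  ((hasCentralChar_planeRep hdense w).of_isEquivalent (hΦw w).symm).integrated_tensor_of_ne hs hi

theorem hilbertSchmidtNormSq_zero {H : Type*} [NormedAddCommGroup H] [InnerProductSpace ℂ H]
    [CompleteSpace H] : hilbertSchmidtNormSq (0 : H →L[ℂ] H) = 0 := by
  simp [hilbertSchmidtNormSq]

/-- A Gaussian tensor with central character `t` acts by a non-zero operator `T` at `π_t` and by
zero at every other point. Rescaled by `2 / ‖T‖` it has norm `2` there, so the singleton is a basic
open set. -/
theorem isOpen_singleton_inl [T2Space K] (hdense : DenseRange φ₀)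
    (hΦt : ∀ t, (Φ (Sum.inl t)).IsClassOf (schrodingerRep φ₀ t.1))
    (hΦw : ∀ w, (Φ (Sum.inr w)).IsClassOf (planeRep φ₀ w))
    (t : {t : dualSubgroup φ₀ // t ≠ 0}) : IsOpen {Φ (Sum.inl t)} := by
  have hi := HeisK.integrable_tensor t.1 integrable_planeGaussian
  set T := (Φ (Sum.inl t)).out.rep.integrated _ hi with hT
  have ht : |(t.1 : ℝ)| ≠ 0 := abs_ne_zero.2 fun h => t.2 (Subtype.ext h)
  have hT0 : T ≠ 0 := fun h0 => by
    have h1 := (hΦt t).hilbertSchmidtNormSq hi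
    rw [← hT, h0, hilbertSchmidtNormSq_zero, hilbertSchmidtNormSq_schrodingerRep t.2 hi
      (HeisK.memLp_tensor t.1 memLp_planeGaussian), HeisK.slice_tensor_self] at h1
    refine mul_ne_zero ?_ lintegral_planeGaussian_sq_ne_zero h1.symm
    exact ne_of_gt (ENNReal.ofReal_pos.2 (by positivity))
  set r : ℂ := ((2 / ‖T‖ : ℝ) : ℂ)
  convert UnitaryDual.isOpen_setOf_one_lt_norm (hi.const_mul r) using 1
  ext c
  rw [Set.mem_singleton_iff, Set.mem_ofPred_eq, UnitaryRep.integrated_smul _ _ hi]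
  obtain ⟨s | w, rfl⟩ := Φ.surjective c
  · by_cases hst : s = t
    · subst hst
      simp only [true_iff]
      rw [norm_smul, ← hT, Complex.norm_real, Real.norm_of_nonneg (by positivity),
        div_mul_cancel₀ _ (norm_ne_zero_iff.2 hT0)]
      norm_num
    · rw [integrated_out_inl_tensor hΦt fun h => hst (Subtype.ext h.symm)]
      simp [hst]
  · rw [integrated_out_inr_tensor hdense hΦw t.2]
    simp

theorem continuous_dual_inr (hdense : DenseRange φ₀)
    (hΦw : ∀ w, (Φ (Sum.inr w)).IsClassOf (planeRep φ₀ w)) :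
    Continuous fun w => Φ (Sum.inr w) := by
  refine continuous_generateFrom_iff.2 ?_
  rintro S ⟨f, hf, rfl⟩
  have : (fun w => Φ (Sum.inr w)) ⁻¹' {c | 1 < ‖c.out.rep.integrated f hf‖}
      = {w | 1 < ‖planeTransform (HeisK.slice f 0) w‖} := by
    ext w
    rw [Set.mem_preimage, Set.mem_ofPred_eq, Set.mem_ofPred_eq, (hΦw w).norm_integrated, norm_integrated_planeRep hdense]
    rfl
  rw [this]
  exact isOpen_lt continuous_const (continuous_planeTransform (HeisK.integrable_slice hf 0)).norm

/-- Modulation moves the Gaussian transform to `exp (-|w - v|² / 4π)`. With the factor `exp (ε /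
4π)` it exceeds `1` exactly when `|w - v|² < ε`. Trivial central character excludes all `π_t` from
the open set. -/
theorem isOpen_image_inr (hdense : DenseRange φ₀)
    (hΦt : ∀ t, (Φ (Sum.inl t)).IsClassOf (schrodingerRep φ₀ t.1))
    (hΦw : ∀ w, (Φ (Sum.inr w)).IsClassOf (planeRep φ₀ w)) (v : ℝ × ℝ) (ε : ℝ) :
    IsOpen ((fun w => Φ (Sum.inr w)) '' {w | (w.1 - v.1) ^ 2 + (w.2 - v.2) ^ 2 < ε}) := by
  set h : ℝ × ℝ → ℂ := fun p => (Circle.exp (-(p.2 * v.1 + p.1 * v.2)) : ℂ) * planeGaussian p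
    with hh
  have hi : Integrable (HeisK.tensor (0 : dualSubgroup φ₀) h) :=
    HeisK.integrable_tensor 0 (integrable_planeGaussian.bdd_mul (c := 1)
      (Continuous.aestronglyMeasurable (by fun_prop))
      (Filter.Eventually.of_forall fun _ => (Circle.norm_coe _).le))
  convert UnitaryDual.isOpen_setOf_one_lt_norm
    (hi.const_mul ((Real.exp (ε / (4 * Real.pi)) : ℝ) : ℂ)) using 1
  ext c
  rw [Set.mem_ofPred_eq, UnitaryRep.integrated_smul _ _ hi]
  obtain ⟨s | w, rfl⟩ := Φ.surjective c
  · rw [integrated_out_inl_tensor hΦt s.2.symm]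
    simp
  · have hinj : Function.Injective fun w => Φ (Sum.inr w) := Φ.injective.comp Sum.inr_injective
    rw [hinj.mem_set_image (a := w), norm_smul, (hΦw w).norm_integrated,
      norm_integrated_planeRep hdense, HeisK.slice_tensor_self]
    change _ ↔ 1 < _ * ‖planeTransform h w‖
    rw [hh, planeTransform_exp_mul, planeTransform_planeGaussian, Complex.norm_real,
      Complex.norm_real, Real.norm_of_nonneg (Real.exp_pos _).le,
      Real.norm_of_nonneg (Real.exp_pos _).le, ← Real.exp_add, ← add_div, Real.one_lt_exp_iff,
      div_pos_iff_of_pos_right (by positivity), Set.mem_ofPred_eq, Prod.fst_sub, Prod.snd_sub]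
    constructor <;> intro h <;> linarith

theorem isOpenEmbedding_inr (hdense : DenseRange φ₀)
    (hΦt : ∀ t, (Φ (Sum.inl t)).IsClassOf (schrodingerRep φ₀ t.1))
    (hΦw : ∀ w, (Φ (Sum.inr w)).IsClassOf (planeRep φ₀ w)) :
    IsOpenEmbedding fun w => Φ (Sum.inr w) := by
  refine IsOpenEmbedding.of_continuous_injective_isOpenMap (continuous_dual_inr hdense hΦw)
    (Φ.injective.comp Sum.inr_injective) fun U hU => isOpen_iff_forall_mem_open.2 ?_
  rintro _ ⟨v, hv, rfl⟩
  obtain ⟨ε, hε, hball⟩ := Metric.isOpen_iff.1 hU v hv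
  -- The product metric is the maximum metric, whose ball of radius `ε` contains the euclidean disc
  -- of radius `ε`.
  refine ⟨_, Set.image_mono fun w hw => hball ?_,
    isOpen_image_inr hdense hΦt hΦw v (ε ^ 2), v, by simpa using pow_pos hε 2, rfl⟩
  rw [Set.mem_ofPred_eq] at hw
  rw [Metric.mem_ball, Prod.dist_eq, max_lt_iff, Real.dist_eq, Real.dist_eq]
  constructor
  · exact abs_lt_of_sq_lt_sq (by nlinarith [sq_nonneg (w.2 - v.2)]) hε.le
  · exact abs_lt_of_sq_lt_sq (by nlinarith [sq_nonneg (w.1 - v.1)]) hε.le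

/-! ## The Plancherel measure -/

theorem isOpen_image_inl [T2Space K] (hdense : DenseRange φ₀)
    (hΦt : ∀ t, (Φ (Sum.inl t)).IsClassOf (schrodingerRep φ₀ t.1))
    (hΦw : ∀ w, (Φ (Sum.inr w)).IsClassOf (planeRep φ₀ w))
    (s : Set {t : dualSubgroup φ₀ // t ≠ 0}) : IsOpen ((fun t => Φ (Sum.inl t)) '' s) := by
  rw [Set.image_eq_iUnion]
  exact isOpen_biUnion fun t _ =>
    isOpen_singleton_inl hdense hΦt hΦw t

theorem eq_image_inl_union_image_inr {α β γ : Type*} (e : α ⊕ β ≃ γ) (s : Set γ) :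
    s = (fun a => e (Sum.inl a)) '' {a | e (Sum.inl a) ∈ s}
      ∪ (fun b => e (Sum.inr b)) '' {b | e (Sum.inr b) ∈ s} := by
  ext c
  obtain ⟨a | b, rfl⟩ := e.surjective c <;> simp

/-- Every set of atoms is open, so measurability is a question on the plane alone. -/
theorem measurable_dual_of_measurable_inr [T2Space K] (hdense : DenseRange φ₀)
    (hΦt : ∀ t, (Φ (Sum.inl t)).IsClassOf (schrodingerRep φ₀ t.1))
    (hΦw : ∀ w, (Φ (Sum.inr w)).IsClassOf (planeRep φ₀ w))
    {F : UnitaryDual.{u, v} (HeisK φ₀) → ℝ≥0∞} (hF : Measurable fun w => F (Φ (Sum.inr w))) :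
    Measurable F := fun s hs => by
  rw [eq_image_inl_union_image_inr Φ (F ⁻¹' s)]
  exact (isOpen_image_inl hdense hΦt hΦw _).measurableSet.union
    ((isOpenEmbedding_inr hdense hΦt hΦw).measurableEmbedding.measurableSet_image.2 (hF hs))

/-- The measure of a set of atoms all of whose subsets are measurable. -/
theorem measure_image_eq_tsum {α ι : Type*} [MeasurableSpace α] (ν : Measure α) {e : ι → α}
    (he : Function.Injective e) (hpos : ∀ i, ν {e i} ≠ 0)
    (hm : ∀ s : Set ι, MeasurableSet (e '' s)) (s : Set ι) :
    ν (e '' s) = ∑' i : s, ν {e i} := by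
  by_cases hs : s.Countable
  · rw [Set.image_eq_iUnion, measure_biUnion hs]
    · intro i _ j _ hij
      simpa using fun h => hij (he h)
    · exact fun i _ => by simpa using hm {i}
  -- Countable additivity does not reach an uncountable `s`. Finite subsets still give this
  -- inequality, and an uncountable sum of positive terms is infinite, so both sides are `∞`.
  · have hle : ∑' i : s, ν {e i} ≤ ν (e '' s) := by
      rw [ENNReal.tsum_eq_iSup_sum]
      refine iSup_le fun F => ?_
      have h1 := measure_biUnion_finset (μ := ν) (s := F) (f := fun i : s => {e i})
        (fun i _ j _ hij => by simpa using fun h => hij (Subtype.ext (he h)))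
        (fun i _ => by simpa using hm {i.1})
      rw [← h1]
      refine measure_mono (Set.iUnion₂_subset fun i _ => ?_)
      rw [Set.singleton_subset_iff]
      exact Set.mem_image_of_mem e i.2
    have htop : ∑' i : s, ν {e i} = ∞ := by
      by_contra hne
      refine hs (Set.countable_coe_iff.1 (Set.countable_univ_iff.1 ?_))
      have h2 := Summable.countable_support_ennreal hne
      rwa [Function.support_eq_univ fun i : s => hpos i] at h2
    rw [htop] at hle ⊢
    exact top_le_iff.1 hle

end DualTopology

/-! ## Existence and uniqueness of the Plancherel measure -/

section Plancherel

variable {K : Type u} [AddCommGroup K] [TopologicalSpace K] [IsTopologicalAddGroup K]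
  [CompactSpace K] [T2Space K] [MeasurableSpace K] [BorelSpace K] {φ₀ : ℝ →+ K}
  {Φ : {t : dualSubgroup φ₀ // t ≠ 0} ⊕ (ℝ × ℝ) ≃ UnitaryDual.{u, v} (HeisK φ₀)}
  {ν ν' : Measure (UnitaryDual.{u, v} (HeisK φ₀))}

/-- The measure on the dual of `HeisK` that turns out to be the Plancherel measure. -/
noncomputable def heisPlancherel
    (Φ : {t : dualSubgroup φ₀ // t ≠ 0} ⊕ (ℝ × ℝ) ≃ UnitaryDual.{u, v} (HeisK φ₀)) :
    Measure (UnitaryDual.{u, v} (HeisK φ₀)) :=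
  Measure.sum (fun t : {t : dualSubgroup φ₀ // t ≠ 0} =>
    ENNReal.ofReal (|(t.1 : ℝ)| / (2 * Real.pi)) • Measure.dirac (Φ (Sum.inl t)))
    + ENNReal.ofReal (1 / (4 * Real.pi ^ 2)) • Measure.map (fun w => Φ (Sum.inr w)) volume

theorem isPlancherelMeasure_heisPlancherel (hcont : Continuous φ₀) (hdense : DenseRange φ₀)
    (hΦt : ∀ t, (Φ (Sum.inl t)).IsClassOf (schrodingerRep φ₀ t.1))
    (hΦw : ∀ w, (Φ (Sum.inr w)).IsClassOf (planeRep φ₀ w)) :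
    UnitaryDual.IsPlancherelMeasure (heisPlancherel Φ) := fun f hf hf2 => by
  set F : UnitaryDual.{u, v} (HeisK φ₀) → ℝ≥0∞ := fun c =>
    hilbertSchmidtNormSq (c.out.rep.integrated f hf)
  have hFw : ∀ w, F (Φ (Sum.inr w)) = hilbertSchmidtNormSq ((planeRep φ₀ w).integrated f hf) :=
    fun w => (hΦw w).hilbertSchmidtNormSq hf
  have hFt : ∀ t, F (Φ (Sum.inl t))
      = hilbertSchmidtNormSq ((schrodingerRep φ₀ t.1).integrated f hf) :=
    fun t => (hΦt t).hilbertSchmidtNormSq hf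
  have hFm : Measurable F := by
    refine measurable_dual_of_measurable_inr hdense hΦt hΦw ?_
    simp only [hFw, hilbertSchmidtNormSq_planeRep hdense]
    exact (continuous_planeTransform (HeisK.integrable_slice hf 0)).measurable.enorm.pow_const 2
  refine ⟨hFm.aemeasurable, ?_⟩
  change ∫⁻ c, F c ∂_ = _
  rw [heisPlancherel, lintegral_add_measure, lintegral_sum_measure, lintegral_smul_measure,
    (isOpenEmbedding_inr hdense hΦt hΦw).measurableEmbedding.lintegral_map]
  simp only [lintegral_smul_measure, lintegral_dirac' _ hFm, smul_eq_mul, hFw, hFt]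
  exact tsum_hilbertSchmidtNormSq_add_lintegral hcont hdense hf hf2

/-- For a Gaussian tensor at `t` the integrand is supported on the single point `π_t`. With `I` the
squared norm of the Gaussian, the Plancherel formula reads `(2π / |t|) I ν{π_t} = I`. -/
theorem UnitaryDual.IsPlancherelMeasure.measure_singleton_inl
    (hν : UnitaryDual.IsPlancherelMeasure ν) (hcont : Continuous φ₀) (hdense : DenseRange φ₀)
    (hΦt : ∀ t, (Φ (Sum.inl t)).IsClassOf (schrodingerRep φ₀ t.1))
    (hΦw : ∀ w, (Φ (Sum.inr w)).IsClassOf (planeRep φ₀ w)) (t : {t : dualSubgroup φ₀ // t ≠ 0}) :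
    ν {Φ (Sum.inl t)} = ENNReal.ofReal (|(t.1 : ℝ)| / (2 * Real.pi)) := by
  have hi := HeisK.integrable_tensor t.1 integrable_planeGaussian
  have h2 := HeisK.memLp_tensor t.1 memLp_planeGaussian
  have ht : |(t.1 : ℝ)| ≠ 0 := abs_ne_zero.2 fun h => t.2 (Subtype.ext h)
  set I := ∫⁻ p, ‖planeGaussian p‖ₑ ^ 2 with hI
  have hI0 : I ≠ 0 := lintegral_planeGaussian_sq_ne_zero
  have hIt : I ≠ ∞ :=
    ((memLp_two_iff_lintegral integrable_planeGaussian.1).1 memLp_planeGaussian).ne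
  have h := (hν _ hi h2).2
  have hF : (fun c : UnitaryDual.{u, v} (HeisK φ₀) =>
      hilbertSchmidtNormSq (c.out.rep.integrated (HeisK.tensor t.1 planeGaussian) hi))
      = Set.indicator {Φ (Sum.inl t)}
        fun _ => ENNReal.ofReal (2 * Real.pi / |(t.1 : ℝ)|) * I := by
    funext c
    obtain ⟨s | w, rfl⟩ := Φ.surjective c
    · by_cases hst : s = t
      · subst hst
        rw [Set.indicator_of_mem (Set.mem_singleton _), (hΦt s).hilbertSchmidtNormSq,
          hilbertSchmidtNormSq_schrodingerRep s.2 hi h2, HeisK.slice_tensor_self]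
      · rw [integrated_out_inl_tensor hΦt fun h => hst (Subtype.ext h.symm),
          hilbertSchmidtNormSq_zero, Set.indicator_of_notMem (by simpa using hst)]
    · rw [integrated_out_inr_tensor hdense hΦw t.2, hilbertSchmidtNormSq_zero,
        Set.indicator_of_notMem (by simp)]
  rw [hF, lintegral_indicator_const (isOpen_singleton_inl hdense hΦt hΦw t).measurableSet,
    HeisK.eLpNorm_tensor_sq hcont hdense t.1 memLp_planeGaussian, ← hI, mul_right_comm] at h
  have h3 : ENNReal.ofReal (2 * Real.pi / |(t.1 : ℝ)|) * ν {Φ (Sum.inl t)} = 1 := by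
    rw [← ENNReal.mul_left_inj hI0 hIt, h, one_mul]
  have h4 : ENNReal.ofReal (|(t.1 : ℝ)| / (2 * Real.pi))
      * ENNReal.ofReal (2 * Real.pi / |(t.1 : ℝ)|) = 1 := by
    rw [← ENNReal.ofReal_mul (by positivity)]
    have : |(t.1 : ℝ)| / (2 * Real.pi) * (2 * Real.pi / |(t.1 : ℝ)|) = 1 := by field_simp
    rw [this, ENNReal.ofReal_one]
  rw [← one_mul (ν _), ← h4, mul_assoc, h3, mul_one]

/-- Tensors with trivial central character are annihilated by all `π_t`, so the formula becomes a
statement about the plane part alone: it integrates every `|ĥ|²` as `1 / 4π²` times Lebesgue measure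
does. -/
theorem UnitaryDual.IsPlancherelMeasure.comap_inr
    (hν : UnitaryDual.IsPlancherelMeasure ν) (hcont : Continuous φ₀) (hdense : DenseRange φ₀)
    (hΦt : ∀ t, (Φ (Sum.inl t)).IsClassOf (schrodingerRep φ₀ t.1))
    (hΦw : ∀ w, (Φ (Sum.inr w)).IsClassOf (planeRep φ₀ w)) :
    ν.comap (fun w => Φ (Sum.inr w)) = ENNReal.ofReal (1 / (4 * Real.pi ^ 2)) • volume := by
  have hemb := (isOpenEmbedding_inr hdense hΦt hΦw).measurableEmbedding
  refine measure_ext_of_lintegral_planeTransform_sq (fun h h1 h2 => ?_) ?_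
  · rw [lintegral_smul_measure, smul_eq_mul, lintegral_planeTransform_sq h1 h2]
    have hi := HeisK.integrable_tensor (0 : dualSubgroup φ₀) h1
    have h3 := (hν _ hi (HeisK.memLp_tensor 0 h2)).2
    rw [HeisK.eLpNorm_tensor_sq hcont hdense 0 h2] at h3
    rw [← h3]
    have hF : ∀ w, ‖planeTransform h w‖ₑ ^ 2 = hilbertSchmidtNormSq
        ((Φ (Sum.inr w)).out.rep.integrated (HeisK.tensor 0 h) hi) := fun w => by
      rw [(hΦw w).hilbertSchmidtNormSq, hilbertSchmidtNormSq_planeRep hdense,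
        HeisK.slice_tensor_self]
      rfl
    simp only [hF]
    rw [← hemb.lintegral_map (fun c : UnitaryDual.{u, v} (HeisK φ₀) =>
      hilbertSchmidtNormSq (c.out.rep.integrated (HeisK.tensor 0 h) hi)), hemb.map_comap,
      ← lintegral_indicator hemb.measurableSet_range]
    refine lintegral_congr fun c => ?_
    obtain ⟨s | w, rfl⟩ := Φ.surjective c
    · rw [Set.indicator_of_notMem (by simp), integrated_out_inl_tensor hΦt s.2.symm,
        hilbertSchmidtNormSq_zero]
    · rw [Set.indicator_of_mem (Set.mem_range_self w)]
  · rw [lintegral_smul_measure, smul_eq_mul,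
      lintegral_planeTransform_sq integrable_planeGaussian memLp_planeGaussian]
    exact ((memLp_two_iff_lintegral integrable_planeGaussian.1).1 memLp_planeGaussian).ne

/-- A Borel set splits into atoms and a part of the plane. The plane part is fixed by `comap_inr`,
and the atomic part by the individual masses, even when `Γ` is uncountable, because these masses are
positive. -/
theorem UnitaryDual.IsPlancherelMeasure.unique
    (hν : UnitaryDual.IsPlancherelMeasure ν) (hν' : UnitaryDual.IsPlancherelMeasure ν')
    (hcont : Continuous φ₀) (hdense : DenseRange φ₀)
    (hΦt : ∀ t, (Φ (Sum.inl t)).IsClassOf (schrodingerRep φ₀ t.1))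
    (hΦw : ∀ w, (Φ (Sum.inr w)).IsClassOf (planeRep φ₀ w)) : ν = ν' := by
  have hemb := (isOpenEmbedding_inr hdense hΦt hΦw).measurableEmbedding
  have hinl : Function.Injective fun t => Φ (Sum.inl t) := Φ.injective.comp Sum.inl_injective
  have hm := fun s => (isOpen_image_inl hdense hΦt hΦw s).measurableSet
  have hpos : ∀ t : {t : dualSubgroup φ₀ // t ≠ 0},
      ENNReal.ofReal (|(t.1 : ℝ)| / (2 * Real.pi)) ≠ 0 := fun t => by
    have ht : |(t.1 : ℝ)| ≠ 0 := abs_ne_zero.2 fun h => t.2 (Subtype.ext h)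
    exact ne_of_gt (ENNReal.ofReal_pos.2 (by positivity))
  have hatom := hν.measure_singleton_inl hcont hdense hΦt hΦw
  have hatom' := hν'.measure_singleton_inl hcont hdense hΦt hΦw
  refine Measure.ext fun s hs => ?_
  have hsw : MeasurableSet {w | Φ (Sum.inr w) ∈ s} := hemb.measurable hs
  have hdisj : Disjoint ((fun t => Φ (Sum.inl t)) '' {t | Φ (Sum.inl t) ∈ s})
      ((fun w => Φ (Sum.inr w)) '' {w | Φ (Sum.inr w) ∈ s}) := by
    rw [Set.disjoint_left]
    rintro _ ⟨t, -, rfl⟩ ⟨w, -, h⟩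
    exact Sum.inr_ne_inl (Φ.injective h)
  rw [eq_image_inl_union_image_inr Φ s, measure_union hdisj (hemb.measurableSet_image.2 hsw),
    measure_union hdisj (hemb.measurableSet_image.2 hsw), ← hemb.comap_apply, ← hemb.comap_apply,
    hν.comap_inr hcont hdense hΦt hΦw, hν'.comap_inr hcont hdense hΦt hΦw,
    measure_image_eq_tsum ν hinl (fun t => hatom t ▸ hpos t) hm,
    measure_image_eq_tsum ν' hinl (fun t => hatom' t ▸ hpos t) hm]
  simp only [hatom, hatom']

end Plancherel

theorem mainTheorem10 {K : Type u} [AddCommGroup K] [TopologicalSpace K] [IsTopologicalAddGroup K]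
    [CompactSpace K] [T2Space K] [Nontrivial K] [MeasurableSpace K] [BorelSpace K]
    (φ₀ : ℝ →+ K) (hcont : Continuous φ₀) (hdense : DenseRange φ₀) :
    ∃ Φ : {t : dualSubgroup φ₀ // t ≠ 0} ⊕ (ℝ × ℝ) ≃ UnitaryDual.{u, v} (HeisK φ₀),
      (∀ t, (Φ (Sum.inl t)).IsClassOf (schrodingerRep φ₀ t.1)) ∧
      (∀ w, (Φ (Sum.inr w)).IsClassOf (planeRep φ₀ w)) ∧
      (∀ t, IsOpen {Φ (Sum.inl t)}) ∧
      IsOpenEmbedding (fun w => Φ (Sum.inr w)) ∧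
      (∃! ν : Measure (UnitaryDual.{u, v} (HeisK φ₀)), UnitaryDual.IsPlancherelMeasure ν) ∧
      ∀ ν : Measure (UnitaryDual.{u, v} (HeisK φ₀)), UnitaryDual.IsPlancherelMeasure ν →
        ν.comap (fun w => Φ (Sum.inr w)) = ENNReal.ofReal (1 / (4 * Real.pi ^ 2)) • volume ∧
        ∀ t, ν {Φ (Sum.inl t)} = ENNReal.ofReal (|(t.1 : ℝ)| / (2 * Real.pi)) := by
  obtain ⟨Φ, hΦt, hΦw⟩ := exists_dualEquiv.{u, v} hcont hdense
  exact ⟨Φ, hΦt, hΦw, isOpen_singleton_inl hdense hΦt hΦw, isOpenEmbedding_inr hdense hΦt hΦw,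
    ⟨heisPlancherel Φ, isPlancherelMeasure_heisPlancherel hcont hdense hΦt hΦw, fun ν hν =>
      hν.unique (isPlancherelMeasure_heisPlancherel hcont hdense hΦt hΦw) hcont hdense hΦt hΦw⟩,
    fun ν hν => ⟨hν.comap_inr hcont hdense hΦt hΦw,
      hν.measure_singleton_inl hcont hdense hΦt hΦw⟩⟩
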